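/- Let $0\le a<M$ and let $r_\pm=M\pm\sqrt{M^2-a^2}$. Consider the exterior region $\mathcal M=\{r>r_+\}$ of the Kerr spacetime with parameters $M,a$, including its rotation axis, with boundary the future and past event horizons $\mathcal H^\pm$ and with future and past null infinity $\mathcal I^\pm$. Let $p\in\mathcal M$ and let $(e_0,e_1,e_2,e_3)$ be an orthonormal basis of $T_p\mathcal M$ with $e_0$ timelike and future directed (the four-velocity of an observer at $p$). For $k=(k_1,k_2,k_3)$ in the celestial sphere $S^2=\{k\in\mathbb R^3: |k|=1\}$ of the observer, let $\gamma(k|_p)$ be the inextendible null geodesic through $p$ with tangent vector $e_0+k_1e_1+k_2e_2+k_3e_3$ at $p$, and define the future and past trapped sets $$\mathbb T_\pm(p)=\{k\in S^2 : \gamma(k|_p)\cap(\mathcal H^\pm\cup\mathcal I^\pm)=\emptyset\}.$$ Then $\mathbb T_+(p)$ and $\mathbb T_-(p)$ are smooth simple closed curves on $S^2$: each of them is the image of a smooth $2\pi$-periodic map $c:\mathbb R\to S^2$ with nowhere vanishing derivative that is injective on $[0,2\pi)$. In particular each is homeomorphic to a circle. -/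

import Mathlib

open scoped Topology ContDiff

noncomputable section

namespace Kerr

/-- Coordinates `(t, X, Y, Z)` (indices `0, 1, 2, 3`) on the Kerr exterior. They are related to
Boyer-Lindquist coordinates by `X = r sin θ cos φ`, `Y = r sin θ sin φ`, `Z = r cos θ`, with the
same `t`; unlike `(t, r, φ, θ)` they also cover the rotation axis. -/
abbrev Coord : Type := Fin 4 → ℝ

/-- The radius of the event horizon. -/
def rPlus (M a : ℝ) : ℝ := M + Real.sqrt (M ^ 2 - a ^ 2)

/-- The radius of the Cauchy horizon. -/
def rMinus (M a : ℝ) : ℝ := M - Real.sqrt (M ^ 2 - a ^ 2)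

/-- The Boyer-Lindquist radius. -/
def rad (x : Coord) : ℝ := Real.sqrt (x 1 ^ 2 + x 2 ^ 2 + x 3 ^ 2)

/-- The exterior region `r > r₊`. -/
def exterior (M a : ℝ) : Set Coord := {x | rPlus M a < rad x}

/-- `Δ = r² - 2 M r + a²`. -/
def Delta (M a r : ℝ) : ℝ := r ^ 2 - 2 * M * r + a ^ 2

/-- `Σ = r² + a² cos² θ`, with `cos θ = Z / r`. -/
def Sig (a : ℝ) (x : Coord) : ℝ := rad x ^ 2 + a ^ 2 * (x 3 / rad x) ^ 2

/-- The one-form `dr`. -/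
def dr (x v : Coord) : ℝ := (x 1 * v 1 + x 2 * v 2 + x 3 * v 3) / rad x

/-- The one-form `sin² θ dφ`, which is smooth across the axis. -/
def sinSqDphi (x v : Coord) : ℝ := (x 1 * v 2 - x 2 * v 1) / rad x ^ 2

/-- The Kerr metric `g_x(v, w)`. The fourth and fifth terms together are
`Σ dθ² + (sin² θ / Σ) 𝒜 dφ²`, see `metric_boyerLindquist`. -/
def metric (M a : ℝ) (x v w : Coord) : ℝ :=
  -(1 - 2 * M * rad x / Sig a x) * (v 0 * w 0)
    - 2 * M * a * rad x / Sig a x * (v 0 * sinSqDphi x w + sinSqDphi x v * w 0)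
    + Sig a x / Delta M a (rad x) * (dr x v * dr x w)
    + Sig a x / rad x ^ 2 * (v 1 * w 1 + v 2 * w 2 + v 3 * w 3 - dr x v * dr x w)
    + a ^ 2 * (1 + 2 * M * rad x / Sig a x) * (sinSqDphi x v * sinSqDphi x w)

/-- The point with Boyer-Lindquist coordinates `(t, r, φ, θ)`. -/
def blPoint (t r φ θ : ℝ) : Coord :=
  ![t, r * Real.sin θ * Real.cos φ, r * Real.sin θ * Real.sin φ, r * Real.cos θ]

/-- The tangent vector `t' ∂_t + r' ∂_r + φ' ∂_φ + θ' ∂_θ` at `blPoint t r φ θ`. -/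
def blVector (r φ θ t' r' φ' θ' : ℝ) : Coord :=
  ![t',
    r' * Real.sin θ * Real.cos φ + r * Real.cos θ * Real.cos φ * θ'
      - r * Real.sin θ * Real.sin φ * φ',
    r' * Real.sin θ * Real.sin φ + r * Real.cos θ * Real.sin φ * θ'
      + r * Real.sin θ * Real.cos φ * φ',
    r' * Real.cos θ - r * Real.sin θ * θ']

theorem rad_blPoint (t r φ θ : ℝ) (hr : 0 < r) : rad (blPoint t r φ θ) = r := by
  have h1 := Real.sin_sq_add_cos_sq φ
  have h2 := Real.sin_sq_add_cos_sq θ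
  have : (r * Real.sin θ * Real.cos φ) ^ 2 + (r * Real.sin θ * Real.sin φ) ^ 2
      + (r * Real.cos θ) ^ 2 = r ^ 2 := by
    linear_combination (r ^ 2 * Real.sin θ ^ 2) * h1 + r ^ 2 * h2
  simp [rad, blPoint, this, Real.sqrt_sq hr.le]

/-- In Boyer-Lindquist coordinates `metric` is the usual Kerr line element. -/
theorem metric_boyerLindquist (M a t r φ θ t' r' φ' θ' : ℝ) (hr : 0 < r) :
    let S := r ^ 2 + a ^ 2 * Real.cos θ ^ 2
    let A := (r ^ 2 + a ^ 2) ^ 2 - a ^ 2 * Delta M a r * Real.sin θ ^ 2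
    metric M a (blPoint t r φ θ) (blVector r φ θ t' r' φ' θ') (blVector r φ θ t' r' φ' θ') =
      -(1 - 2 * M * r / S) * t' ^ 2 - 2 * M * a * r * Real.sin θ ^ 2 / S * (2 * t' * φ')
        + S / Delta M a r * r' ^ 2 + S * θ' ^ 2 + Real.sin θ ^ 2 / S * A * φ' ^ 2 := by
  intro S A
  have h1 := Real.sin_sq_add_cos_sq φ
  have h2 := Real.sin_sq_add_cos_sq θ
  have hS : S ≠ 0 := by positivity
  have hsig : Sig a (blPoint t r φ θ) = S := by
    simp only [Sig, rad_blPoint t r φ θ hr, S]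
    simp [blPoint, hr.ne']
  have hdr : dr (blPoint t r φ θ) (blVector r φ θ t' r' φ' θ') = r' := by
    simp only [dr, rad_blPoint t r φ θ hr]
    rw [div_eq_iff hr.ne']
    simp only [blPoint, blVector, Matrix.cons_val]
    linear_combination (r * Real.sin θ ^ 2 * r' + r ^ 2 * Real.sin θ * Real.cos θ * θ') * h1
      + r' * r * h2
  have hph : sinSqDphi (blPoint t r φ θ) (blVector r φ θ t' r' φ' θ')
      = Real.sin θ ^ 2 * φ' := by
    simp only [sinSqDphi, rad_blPoint t r φ θ hr]
    rw [div_eq_iff (by positivity)]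
    simp only [blPoint, blVector, Matrix.cons_val]
    linear_combination (r ^ 2 * Real.sin θ ^ 2 * φ') * h1
  have hE : ∀ v, v = blVector r φ θ t' r' φ' θ' →
      v 1 * v 1 + v 2 * v 2 + v 3 * v 3
        = r' ^ 2 + r ^ 2 * (θ' ^ 2 + Real.sin θ ^ 2 * φ' ^ 2) := by
    rintro v rfl
    simp only [blVector, Matrix.cons_val]
    linear_combination ((r' * Real.sin θ + r * Real.cos θ * θ') ^ 2
      + r ^ 2 * Real.sin θ ^ 2 * φ' ^ 2) * h1 + (r' ^ 2 + r ^ 2 * θ' ^ 2) * h2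
  have h0 : (blVector r φ θ t' r' φ' θ') 0 = t' := rfl
  have hA : A = S ^ 2 + a ^ 2 * Real.sin θ ^ 2 * (S + 2 * M * r) := by
    simp only [A, S, Delta, Real.cos_sq']
    ring
  have hdiv : ∀ y : ℝ, Real.sin θ ^ 2 / S * (S ^ 2 + a ^ 2 * Real.sin θ ^ 2 * (S + y))
      = S * Real.sin θ ^ 2 + a ^ 2 * Real.sin θ ^ 4 * (1 + y / S) := by
    intro y
    field_simp
  have hr2 : S / r ^ 2 * (r' ^ 2 + r ^ 2 * (θ' ^ 2 + Real.sin θ ^ 2 * φ' ^ 2) - r' * r')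
      = S * (θ' ^ 2 + Real.sin θ ^ 2 * φ' ^ 2) := by
    field_simp
    ring
  rw [hA, hdiv]
  simp only [metric, hsig, hdr, hph, hE _ rfl, h0, rad_blPoint t r φ θ hr, hr2]
  ring

/-- The components `g_{μν}` as functions of the point. -/
def metricComp (M a : ℝ) (x : Coord) : Matrix (Fin 4) (Fin 4) ℝ :=
  Matrix.of fun μ ν => metric M a x (Pi.single μ 1) (Pi.single ν 1)

/-- The partial derivative `∂_σ g_{μν}`. -/
def dMetricComp (M a : ℝ) (x : Coord) (σ μ ν : Fin 4) : ℝ :=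
  fderiv ℝ (fun y : Coord => metricComp M a y μ ν) x (Pi.single σ 1)

/-- The Christoffel symbols `Γ^κ_{μν}` of the Levi-Civita connection. -/
def christoffel (M a : ℝ) (x : Coord) (κ μ ν : Fin 4) : ℝ :=
  1 / 2 * ∑ σ, (metricComp M a x)⁻¹ κ σ *
    (dMetricComp M a x μ σ ν + dMetricComp M a x ν σ μ - dMetricComp M a x σ μ ν)

/-- `γ` is an affinely parametrized geodesic of the exterior region on the open interval
`(α, β)`, which contains `0`, starting at `p` with velocity `w`. -/
structure IsGeodesicFrom (M a : ℝ) (p w : Coord) (α β : EReal) (γ : ℝ → Coord) : Prop where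
  left_neg : α < 0
  right_pos : 0 < β
  mem_exterior : ∀ s : ℝ, α < (s : EReal) → (s : EReal) < β → γ s ∈ exterior M a
  init : γ 0 = p
  ode : ∃ v : ℝ → Coord, v 0 = w ∧ ∀ s : ℝ, α < (s : EReal) → (s : EReal) < β →
    HasDerivAt γ (v s) s ∧
    HasDerivAt v (fun κ => -∑ μ, ∑ ν, christoffel M a (γ s) κ μ ν * v s μ * v s ν) s

/-- The tortoise coordinate, an antiderivative of `(r² + a²) / Δ`. -/
def tortoise (M a r : ℝ) : ℝ :=
  r + 2 * M / (rPlus M a - rMinus M a) *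
    (rPlus M a * Real.log (r - rPlus M a) - rMinus M a * Real.log (r - rMinus M a))

/-- An antiderivative of `a / Δ`. -/
def twist (M a r : ℝ) : ℝ :=
  a / (rPlus M a - rMinus M a) * Real.log ((r - rPlus M a) / (r - rMinus M a))

/-- Ingoing (`ε = 1`) or outgoing (`ε = -1`) Kerr coordinates with the radius inverted:
`(t + ε r_*, 1 / r, n)`, where the unit vector `n` has colatitude `θ` and azimuth
`φ + ε r_♯`, with `dr_*/dr = (r² + a²)/Δ` and `dr_♯/dr = a/Δ`.
The metric (near `r = ∞`, the metric divided by `r²`) extends smoothly to the boundary values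
`1 / r = 1 / r₊` and `1 / r = 0` of these coordinates. -/
def nullChart (M a ε : ℝ) (x : Coord) : ℝ × ℝ × (Fin 3 → ℝ) :=
  let r := rad x
  let δ := ε * twist M a r
  (x 0 + ε * tortoise M a r, 1 / r,
    ![(x 1 * Real.cos δ - x 2 * Real.sin δ) / r,
      (x 1 * Real.sin δ + x 2 * Real.cos δ) / r,
      x 3 / r])

/-- The boundary `r = r₊` in the coordinates `nullChart`: this is `ℋ⁺` in the ingoing and
`ℋ⁻` in the outgoing ones. -/
def horizonBoundary (M a : ℝ) : Set (ℝ × ℝ × (Fin 3 → ℝ)) :=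
  {q | q.2.1 = 1 / rPlus M a ∧ ∑ i, q.2.2 i ^ 2 = 1}

/-- The conformal boundary `r = ∞` in the coordinates `nullChart`: this is `ℐ⁺` in the outgoing
and `ℐ⁻` in the ingoing ones. -/
def scriBoundary : Set (ℝ × ℝ × (Fin 3 → ℝ)) :=
  {q | q.2.1 = 0 ∧ ∑ i, q.2.2 i ^ 2 = 1}

/-- The real parameter `s` tends to the (possibly infinite) endpoint `β` from below. -/
def toRightEnd (β : EReal) : Filter ℝ := Filter.comap Real.toEReal (𝓝[<] β)

/-- The real parameter `s` tends to the (possibly infinite) endpoint `α` from above. -/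
def toLeftEnd (α : EReal) : Filter ℝ := Filter.comap Real.toEReal (𝓝[>] α)

/-- The geodesic from `p` with future directed initial velocity `w` meets `ℋ⁺`: as its parameter
increases it converges to a point of `ℋ⁺`. -/
def MeetsFutureHorizon (M a : ℝ) (p w : Coord) : Prop :=
  ∃ (α β : EReal) (γ : ℝ → Coord), IsGeodesicFrom M a p w α β γ ∧
    ∃ q ∈ horizonBoundary M a,
      Filter.Tendsto (fun s => nullChart M a 1 (γ s)) (toRightEnd β) (𝓝 q)

/-- The geodesic meets `ℐ⁺`. -/
def MeetsFutureScri (M a : ℝ) (p w : Coord) : Prop :=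
  ∃ (α β : EReal) (γ : ℝ → Coord), IsGeodesicFrom M a p w α β γ ∧
    ∃ q ∈ scriBoundary,
      Filter.Tendsto (fun s => nullChart M a (-1) (γ s)) (toRightEnd β) (𝓝 q)

/-- The geodesic meets `ℋ⁻`. -/
def MeetsPastHorizon (M a : ℝ) (p w : Coord) : Prop :=
  ∃ (α β : EReal) (γ : ℝ → Coord), IsGeodesicFrom M a p w α β γ ∧
    ∃ q ∈ horizonBoundary M a,
      Filter.Tendsto (fun s => nullChart M a (-1) (γ s)) (toLeftEnd α) (𝓝 q)

/-- The geodesic meets `ℐ⁻`. -/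
def MeetsPastScri (M a : ℝ) (p w : Coord) : Prop :=
  ∃ (α β : EReal) (γ : ℝ → Coord), IsGeodesicFrom M a p w α β γ ∧
    ∃ q ∈ scriBoundary,
      Filter.Tendsto (fun s => nullChart M a 1 (γ s)) (toLeftEnd α) (𝓝 q)

/-- The timelike vector `(r² + a²) ∂_t + a ∂_φ`, which fixes the time orientation. -/
def timeVector (a : ℝ) (x : Coord) : Coord := ![rad x ^ 2 + a ^ 2, -(a * x 2), a * x 1, 0]

/-- An orthonormal frame at `p` whose timelike vector `e 0`, the four-velocity of the observer,
is future directed. -/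
structure IsObserverFrame (M a : ℝ) (p : Coord) (e : Fin 4 → Coord) : Prop where
  orthonormal : ∀ i j, metric M a p (e i) (e j) = if i = j then (if i = 0 then -1 else 1) else 0
  future : metric M a p (e 0) (timeVector a p) < 0

/-- The celestial sphere. -/
abbrev celestialSphere : Set (EuclideanSpace ℝ (Fin 3)) := Metric.sphere 0 1

/-- The future directed null vector `e₀ + k₁ e₁ + k₂ e₂ + k₃ e₃` in the direction `k`. -/
def nullVector (e : Fin 4 → Coord) (k : EuclideanSpace ℝ (Fin 3)) : Coord :=
  e 0 + ∑ i : Fin 3, k i • e i.succ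

/-- The future trapped set `𝕋₊(p)` of the observer with frame `e`. -/
def futureTrappedSet (M a : ℝ) (p : Coord) (e : Fin 4 → Coord) :
    Set (EuclideanSpace ℝ (Fin 3)) :=
  {k ∈ celestialSphere | ¬ (MeetsFutureHorizon M a p (nullVector e k) ∨
    MeetsFutureScri M a p (nullVector e k))}

/-- The past trapped set `𝕋₋(p)` of the observer with frame `e`. -/
def pastTrappedSet (M a : ℝ) (p : Coord) (e : Fin 4 → Coord) :
    Set (EuclideanSpace ℝ (Fin 3)) :=
  {k ∈ celestialSphere | ¬ (MeetsPastHorizon M a p (nullVector e k) ∨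
    MeetsPastScri M a p (nullVector e k))}

end Kerr

/-- `S` is a smooth simple closed curve, i.e. a smoothly embedded circle: it is the trace of a
smooth, regular, periodic parametrization that is injective on a period. -/
def IsSmoothClosedCurve {n : ℕ} (S : Set (EuclideanSpace ℝ (Fin n))) : Prop :=
  ∃ c : ℝ → EuclideanSpace ℝ (Fin n),
    ContDiff ℝ ∞ c ∧ Function.Periodic c (2 * Real.pi) ∧ (∀ s, deriv c s ≠ 0) ∧
    Set.InjOn c (Set.Ico 0 (2 * Real.pi)) ∧ Set.range c = S

end

/-!
Future directed null geodesics of Kerr have, besides the energy `E = -g(∂_t, γ')` and Carter's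
constant `K`, the conserved quantity `C = P - r² E`, where `P = prinMom` is minus the product with
`(r² + a²) ∂_t + a ∂_φ`. The radial momentum `u = Σ r'` satisfies `u² = P² - Δ K` with
`P = C + r² E`, so that the radial motion is that of a particle on a line.

*Which geodesics are trapped.* The derivative of `P² / Δ` has the sign of a cubic polynomial
(`critPoly`) which has at most one zero in `r > r₊` where `P > 0`. A double root `x > r₊` of
`P² - Δ K` is an unstable equilibrium of the radial motion. A geodesic moving towards such a
double root, or sitting at it, never reaches the boundary (`RadialOrbit.bounded_of_trapped`), while
for all the others `u / √Δ` is eventually bounded away from zero, so that `r` tends to `r₊` or to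
`∞` (`RadialOrbit.horizon_or_infinity`). For these, maximality of the solution of
the geodesic equation (`exists_maximal_solution`) excludes that they end earlier, and the
components of the ingoing or outgoing null chart, whose derivatives are dominated by that of a
bounded multiple of `r` or `1 / r`, have a limit (`IsNullGeodesic.exists_tendsto_horizonBoundary`,
`IsNullGeodesic.exists_tendsto_scriBoundary`). Thus `not_meets_iff`: being trapped is the
algebraic condition `IsTrappedVector` on the initial velocity.

*The shape of the trapped set.* In a coframe adapted to the principal null directions
(`IsPrincipalCoframe`), null vectors with `P = 1` are described by `(u, y₁, y₂)` on the ellipsoid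
`u² + Δ (y₁² + y₂²) = 1`, and `Σ E = 1 + a sin θ y₁`. Write `(y₁, y₂) = ϱ (cos s, sin s)`. A double
root at `x` determines `ϱ` and `u`, and it occurs exactly if `photonRatio x = a sin θ cos s`.
The function `photonRatio` is a decreasing diffeomorphism of `(r₊, ∞)` onto `ℝ`, because its
derivative is a multiple of that of `photonOffset` (`hasDerivAt_photonRatio`,
`exists_photonRatio_inverse`). So the trapped vectors are a smooth graph over the circle of angles
`s` (`exists_trapped_param`), also on the axis, where `a sin θ = 0`. Passing from the section
`P = 1` of the light cone to the celestial sphere of the observer is a diffeomorphism, and the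
angle `s` shows that the resulting curve is regular and simple.

*The past trapped set* is the future trapped set for the image of the observer under the
isometry `(t, φ) ↦ (-t, -φ)` (`pastTrappedSet_eq`).
-/

noncomputable section

namespace Kerr

open Set Filter

/-! ### Limits at the endpoint of an interval -/

theorem mem_toRightEnd {β : EReal} (hβ : 0 < β) {A : Set ℝ} :
    A ∈ toRightEnd β ↔ ∃ s₀ : ℝ, 0 ≤ s₀ ∧ (s₀ : EReal) < β ∧
      ∀ s : ℝ, s₀ ≤ s → (s : EReal) < β → s ∈ A := by
  have hb := (nhdsLT_basis_of_exists_lt ⟨0, hβ⟩).comap Real.toEReal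
  rw [toRightEnd, hb.mem_iff]
  constructor
  · rintro ⟨c, hc, h⟩
    obtain ⟨s₀, h1, h2⟩ := EReal.lt_iff_exists_real_btwn.1 (max_lt hc hβ)
    refine ⟨s₀, ?_, h2, fun s hs hs' => h ⟨?_, hs'⟩⟩
    · exact_mod_cast ((le_max_right _ _).trans_lt h1).le
    · exact ((le_max_left _ _).trans_lt h1).trans_le (by exact_mod_cast hs)
  · rintro ⟨s₀, -, h2, h⟩
    exact ⟨s₀, h2, fun s hs => h s (by exact_mod_cast hs.1.le) hs.2⟩

theorem eventually_toRightEnd {β : EReal} (hβ : 0 < β) {p : ℝ → Prop} :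
    (∀ᶠ s in toRightEnd β, p s) ↔ ∃ s₀ : ℝ, 0 ≤ s₀ ∧ (s₀ : EReal) < β ∧
      ∀ s : ℝ, s₀ ≤ s → (s : EReal) < β → p s :=
  mem_toRightEnd hβ

theorem toRightEnd_neBot {β : EReal} (hβ : 0 < β) : (toRightEnd β).NeBot := by
  refine ⟨fun h => ?_⟩
  obtain ⟨s₀, -, h2, h3⟩ := (mem_toRightEnd hβ).1 (h ▸ mem_bot : (∅ : Set ℝ) ∈ toRightEnd β)
  exact h3 s₀ le_rfl h2

theorem eventually_lt_toRightEnd {β : EReal} (hβ : 0 < β) {s₁ : ℝ} (hs₁ : (s₁ : EReal) < β) :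
    ∀ᶠ s : ℝ in toRightEnd β, s₁ ≤ s ∧ (s : EReal) < β := by
  refine (eventually_toRightEnd hβ).2 ⟨max 0 s₁, le_max_left _ _, ?_, fun s h1 h2 =>
    ⟨(le_max_right _ _).trans h1, h2⟩⟩
  rcases max_cases 0 s₁ with h | h <;> rw [h.1]
  · exact hβ
  · exact hs₁

/-- The parameters from `s₁` on, up to the endpoint `β`. -/
abbrev upTo (s₁ : ℝ) (β : EReal) : Set ℝ := {s | s₁ ≤ s ∧ (s : EReal) < β}

theorem upTo_ordConnected (s₁ : ℝ) (β : EReal) : (upTo s₁ β).OrdConnected :=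
  ⟨fun _ hx _ hy _ hz => ⟨hx.1.trans hz.1, lt_of_le_of_lt (by exact_mod_cast hz.2) hy.2⟩⟩

theorem convex_upTo (s₁ : ℝ) (β : EReal) : Convex ℝ (upTo s₁ β) :=
  (upTo_ordConnected s₁ β).convex

theorem monotoneOn_upTo {s₁ : ℝ} {β : EReal} {f f' : ℝ → ℝ}
    (hf : ∀ s ∈ upTo s₁ β, HasDerivAt f (f' s) s) (hf' : ∀ s ∈ upTo s₁ β, 0 ≤ f' s) :
    MonotoneOn f (upTo s₁ β) :=
  monotoneOn_of_hasDerivWithinAt_nonneg (convex_upTo s₁ β)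
    (fun s hs => (hf s hs).continuousAt.continuousWithinAt)
    (fun s hs => (hf s (interior_subset hs)).hasDerivWithinAt)
    fun s hs => hf' s (interior_subset hs)

theorem MonotoneOn.exists_tendsto_toRightEnd {s₁ : ℝ} {β : EReal} (hβ : 0 < β)
    (hs₁ : (s₁ : EReal) < β) {f : ℝ → ℝ} (hf : MonotoneOn f (upTo s₁ β))
    (hb : BddAbove (f '' upTo s₁ β)) :
    ∃ l, Tendsto f (toRightEnd β) (𝓝 l) ∧ ∀ s ∈ upTo s₁ β, f s ≤ l := by
  have hne : (f '' upTo s₁ β).Nonempty := ⟨_, s₁, ⟨le_rfl, hs₁⟩, rfl⟩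
  have hle : ∀ s ∈ upTo s₁ β, f s ≤ sSup (f '' upTo s₁ β) :=
    fun s hs => le_csSup hb ⟨s, hs, rfl⟩
  refine ⟨sSup (f '' upTo s₁ β), ?_, hle⟩
  refine tendsto_order.2 ⟨fun c hc => ?_, fun c hc => ?_⟩
  · obtain ⟨_, ⟨s, hs, rfl⟩, h⟩ := exists_lt_of_lt_csSup hne hc
    filter_upwards [eventually_lt_toRightEnd hβ hs.2] with t ht
    exact h.trans_le (hf hs ⟨hs.1.trans ht.1, ht.2⟩ ht.1)
  · filter_upwards [eventually_lt_toRightEnd hβ hs₁] with t ht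
    exact (hle t ht).trans_lt hc

/-- A function whose derivative is dominated by that of a function bounded above converges. -/
theorem exists_tendsto_of_abs_deriv_le {s₁ : ℝ} {β : EReal} (hβ : 0 < β)
    (hs₁ : (s₁ : EReal) < β) {f f' g g' : ℝ → ℝ}
    (hf : ∀ s ∈ upTo s₁ β, HasDerivAt f (f' s) s) (hg : ∀ s ∈ upTo s₁ β, HasDerivAt g (g' s) s)
    (hle : ∀ s ∈ upTo s₁ β, |f' s| ≤ g' s) {B : ℝ} (hB : ∀ s ∈ upTo s₁ β, g s ≤ B) :
    ∃ l, Tendsto f (toRightEnd β) (𝓝 l) := by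
  have hs : s₁ ∈ upTo s₁ β := ⟨le_rfl, hs₁⟩
  have m1 : MonotoneOn g (upTo s₁ β) :=
    monotoneOn_upTo hg fun s hs => (abs_nonneg _).trans (hle s hs)
  have m2 : MonotoneOn (fun s => f s + g s) (upTo s₁ β) :=
    monotoneOn_upTo (fun s hs => (hf s hs).add (hg s hs)) fun s hs => by
      have := abs_le.1 (hle s hs); linarith
  have m3 : MonotoneOn (fun s => g s - f s) (upTo s₁ β) :=
    monotoneOn_upTo (fun s hs => (hg s hs).sub (hf s hs)) fun s hs => by
      have := abs_le.1 (hle s hs); linarith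
  obtain ⟨l1, h1, -⟩ := MonotoneOn.exists_tendsto_toRightEnd hβ hs₁ m1
    ⟨B, by rintro _ ⟨s, hs, rfl⟩; exact hB s hs⟩
  obtain ⟨l2, h2, -⟩ := MonotoneOn.exists_tendsto_toRightEnd hβ hs₁ m2
    ⟨2 * B - (g s₁ - f s₁), by
      rintro _ ⟨s, hs', rfl⟩
      have := m3 hs hs' hs'.1
      have := hB s hs'
      dsimp at *
      linarith⟩
  exact ⟨l2 - l1, by simpa using h2.sub h1⟩

/-- A function with derivative bounded below by a positive constant is unbounded on a half-line. -/
theorem exists_lt_of_deriv_ge {s₁ ε : ℝ} (hε : 0 < ε) {f f' : ℝ → ℝ}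
    (hf : ∀ s, s₁ ≤ s → HasDerivAt f (f' s) s) (hf' : ∀ s, s₁ ≤ s → ε ≤ f' s) (B : ℝ) :
    ∃ s, s₁ ≤ s ∧ B < f s := by
  have hm : MonotoneOn (fun s => f s - ε * s) (upTo s₁ ⊤) := by
    refine monotoneOn_upTo (f' := fun s => f' s - ε * 1)
      (fun s hs => (hf s hs.1).sub ((hasDerivAt_id s).const_mul ε)) fun s hs => ?_
    have := hf' s hs.1
    linarith
  have hs2 : s₁ ≤ s₁ + (|B - f s₁| + 1) / ε := by
    have : 0 ≤ (|B - f s₁| + 1) / ε := by positivity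
    linarith
  refine ⟨_, hs2, ?_⟩
  have := hm ⟨le_rfl, EReal.coe_lt_top _⟩ ⟨hs2, EReal.coe_lt_top _⟩ hs2
  have h3 : ε * ((|B - f s₁| + 1) / ε) = |B - f s₁| + 1 := by field_simp
  have := le_abs_self (B - f s₁)
  dsimp at *
  nlinarith

/-! ### Maximal solutions of ordinary differential equations -/

section ODE

variable {E : Type*} [NormedAddCommGroup E] [NormedSpace ℝ E] [CompleteSpace E]

/-- `z` solves `z' = F z` in `U` on the interval `(-ε, B)`, with `z 0 = z₀`. -/
structure IsSolutionUpTo (F : E → E) (U : Set E) (z₀ : E) (ε : ℝ) (B : EReal) (z : ℝ → E) :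
    Prop where
  le : (ε : EReal) ≤ B
  init : z 0 = z₀
  mem : ∀ s : ℝ, -ε < s → (s : EReal) < B → z s ∈ U
  hasDerivAt : ∀ s : ℝ, -ε < s → (s : EReal) < B → HasDerivAt z (F (z s)) s

/-- A solution that stays in a compact subset of the domain up to a finite time can be extended
beyond that time. -/
theorem IsSolutionUpTo.extend {F : E → E} {U : Set E} (hU : IsOpen U)
    (hF : ∀ z ∈ U, ContDiffAt ℝ 1 F z) {z₀ : E} {ε b : ℝ} (hε : 0 < ε) {z : ℝ → E}
    (hz : IsSolutionUpTo F U z₀ ε b z) {K : Set E} (hK : IsCompact K) (hKU : K ⊆ U)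
    (hzK : ∀ s, 0 ≤ s → s < b → z s ∈ K) :
    ∃ b' > b, ∃ z', IsSolutionUpTo F U z₀ ε (b' : ℝ) z' ∧ ∀ s < b, z s = z' s := by
  have hb : ε ≤ b := by exact_mod_cast hz.le
  have hd : ∀ s, 0 ≤ s → s < b → HasDerivAt z (F (z s)) s := fun s h1 h2 =>
    hz.hasDerivAt s (by linarith) (by exact_mod_cast h2)
  have hFK : ContinuousOn F K := fun x hx => (hF x (hKU hx)).continuousAt.continuousWithinAt
  obtain ⟨L, hL⟩ := hK.exists_bound_of_continuousOn hFK
  -- `z` is Lipschitz on `[0, b)`, hence has a limit at `b`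
  have hlip : ∀ s ∈ Ico 0 b, ∀ t ∈ Ico 0 b, ‖z t - z s‖ ≤ L * ‖t - s‖ := fun s hs t ht =>
    (convex_Ico 0 b).norm_image_sub_le_of_norm_hasDerivWithin_le
      (fun x hx => (hd x hx.1 hx.2).hasDerivWithinAt) (fun x hx => hL _ (hzK x hx.1 hx.2)) hs ht
  have hL0 : 0 ≤ L := (norm_nonneg _).trans (hL _ (hzK 0 le_rfl (by linarith)))
  have hcau : Cauchy (map z (𝓝[<] b)) := by
    refine Metric.cauchy_iff.2 ⟨inferInstance, fun δ hδ => ?_⟩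
    refine ⟨z '' Ioo (max 0 (b - δ / (L + 1))) b, image_mem_map (Ioo_mem_nhdsLT (max_lt (by linarith)
      (by have : 0 < δ / (L + 1) := by positivity
          linarith))), ?_⟩
    rintro _ ⟨s, hs, rfl⟩ _ ⟨t, ht, rfl⟩
    have hs' := max_lt_iff.1 hs.1
    have ht' := max_lt_iff.1 ht.1
    rw [dist_eq_norm]
    have h1 := hlip t ⟨ht'.1.le, ht.2⟩ s ⟨hs'.1.le, hs.2⟩
    have h2 : ‖s - t‖ < δ / (L + 1) := by
      have := hs.2
      have := ht.2
      rw [Real.norm_eq_abs, abs_lt]; constructor <;> linarith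
    have h3 : (L + 1) * (δ / (L + 1)) = δ := by field_simp
    nlinarith [norm_nonneg (s - t)]
  obtain ⟨w, hw⟩ := cauchy_map_iff_exists_tendsto.1 hcau
  have hwK : w ∈ K := by
    refine hK.isClosed.mem_of_tendsto hw ?_
    filter_upwards [Ioo_mem_nhdsLT (show (0 : ℝ) < b by linarith)] with s hs
    exact hzK s hs.1.le hs.2
  obtain ⟨α, hα0, δ, hδ, hα⟩ :=
    (hF w (hKU hwK)).exists_forall_mem_closedBall_exists_eq_forall_mem_Ioo_hasDerivAt₀ b
  have hαb := hα b ⟨by linarith, by linarith⟩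
  obtain ⟨δ', hδ', hαU⟩ : ∃ δ' > 0, ∀ s, dist s b < δ' → α s ∈ U := by
    have := hαb.continuousAt.preimage_mem_nhds (hU.mem_nhds (by rw [hα0]; exact hKU hwK))
    obtain ⟨δ', h1, h2⟩ := Metric.mem_nhds_iff.1 this
    exact ⟨δ', h1, fun s hs => h2 hs⟩
  set η := min δ δ'
  have hη : 0 < η := lt_min hδ hδ'
  set z' : ℝ → E := fun s => if s < b then z s else α s with hz'
  have hlt : ∀ s < b, z' s = z s := fun s hs => by simp [hz', hs]
  have hge : ∀ s, b ≤ s → z' s = α s := fun s hs => by simp [hz', not_lt.2 hs]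
  refine ⟨b + η, by linarith, z', ⟨?_, ?_, ?_, ?_⟩, fun s hs => (hlt s hs).symm⟩
  · exact_mod_cast (by linarith : ε ≤ b + η)
  · rw [hlt 0 (by linarith), hz.init]
  · intro s h1 h2
    have h2' : s < b + η := by exact_mod_cast h2
    rcases lt_or_ge s b with h | h
    · rw [hlt s h]; exact hz.mem s h1 (by exact_mod_cast h)
    · rw [hge s h]
      refine hαU s ?_
      rw [Real.dist_eq, abs_of_nonneg (by linarith)]
      linarith [min_le_right δ δ']
  · intro s h1 h2
    have h2' : s < b + η := by exact_mod_cast h2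
    rcases lt_trichotomy s b with h | h | h
    · rw [hlt s h]
      refine (hz.hasDerivAt s h1 (by exact_mod_cast h)).congr_of_eventuallyEq ?_
      filter_upwards [Iio_mem_nhds h] with t ht using hlt t ht
    · subst h
      have hl : HasDerivWithinAt z' (F w) (Iic s) s := by
        have hIoo : Ioo 0 s ∈ 𝓝[<] s := Ioo_mem_nhdsLT (by linarith)
        have hzd : ∀ t ∈ Ioo 0 s, HasDerivAt z' (F (z t)) t := fun t ht =>
          (hd t ht.1.le ht.2).congr_of_eventuallyEq
            (by filter_upwards [Iio_mem_nhds ht.2] with t ht using hlt t ht)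
        have hzw : Tendsto z' (𝓝[<] s) (𝓝 w) := hw.congr' (by
          filter_upwards [self_mem_nhdsWithin] with t ht using (hlt t ht).symm)
        refine hasDerivWithinAt_Iic_of_tendsto_deriv
          (fun t ht => (hzd t ht).differentiableAt.differentiableWithinAt) ?_ hIoo ?_
        · rw [ContinuousWithinAt, hge s le_rfl, hα0]
          exact hzw.mono_left (nhdsWithin_mono _ fun t ht => ht.2)
        · refine ((hF w (hKU hwK)).continuousAt.tendsto.comp hw).congr' ?_
          filter_upwards [hIoo] with t ht using (hzd t ht).deriv.symm
      have hr : HasDerivWithinAt z' (F w) (Ici s) s := by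
        rw [hα0] at hαb
        exact hαb.hasDerivWithinAt.congr (fun t ht => hge t ht) (hge s le_rfl)
      have := hl.union hr
      rw [Iic_union_Ici, hasDerivWithinAt_univ] at this
      rwa [hge s le_rfl, hα0]
    · rw [hge s h.le]
      refine (hα s ⟨by linarith, by linarith [min_le_left δ δ']⟩).congr_of_eventuallyEq ?_
      filter_upwards [Ioi_mem_nhds h] with t ht using hge t (le_of_lt ht)

/-- Every initial value problem for a `C¹` vector field on an open set has a solution which is
maximal to the right: if its endpoint is finite, it leaves every compact subset. -/
theorem exists_maximal_solution {F : E → E} {U : Set E} (hU : IsOpen U)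
    (hF : ∀ z ∈ U, ContDiffAt ℝ 1 F z) {z₀ : E} (hz₀ : z₀ ∈ U) :
    ∃ ε : ℝ, 0 < ε ∧ ∃ (B : EReal) (z : ℝ → E), IsSolutionUpTo F U z₀ ε B z ∧
      ∀ K ⊆ U, IsCompact K → (∀ s : ℝ, 0 ≤ s → (s : EReal) < B → z s ∈ K) → B = ⊤ := by
  obtain ⟨ζ, hζ0, δ, hδ, hζ⟩ :=
    (hF z₀ hz₀).exists_forall_mem_closedBall_exists_eq_forall_mem_Ioo_hasDerivAt₀ 0
  obtain ⟨δ', hδ', hζU⟩ : ∃ δ' > 0, ∀ s, dist s 0 < δ' → ζ s ∈ U := by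
    have := (hζ 0 ⟨by linarith, by linarith⟩).continuousAt.preimage_mem_nhds
      (hU.mem_nhds (by rwa [hζ0]))
    obtain ⟨δ', h1, h2⟩ := Metric.mem_nhds_iff.1 this
    exact ⟨δ', h1, fun s hs => h2 hs⟩
  set ε := min δ δ'
  have hε : 0 < ε := lt_min hδ hδ'
  refine ⟨ε, hε, ?_⟩
  -- Zorn's lemma for the solutions on `(-ε, B)`, ordered by extension
  let 𝒮 := {q : EReal × (ℝ → E) // IsSolutionUpTo F U z₀ ε q.1 q.2}
  let r : 𝒮 → 𝒮 → Prop := fun q q' => q.1.1 ≤ q'.1.1 ∧ ∀ s : ℝ, (s : EReal) < q.1.1 →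
    q.1.2 s = q'.1.2 s
  have base : IsSolutionUpTo F U z₀ ε ε ζ := by
    refine ⟨le_rfl, hζ0, fun s h1 h2 => hζU s ?_, fun s h1 h2 => hζ s ?_⟩ <;>
    have h2' : s < ε := by exact_mod_cast h2
    · rw [Real.dist_eq, sub_zero, abs_lt]
      constructor <;> linarith [min_le_right δ δ']
    · constructor <;> linarith [min_le_left δ δ']
  have : Nonempty 𝒮 := ⟨⟨(ε, ζ), base⟩⟩
  obtain ⟨m, hm⟩ : ∃ m, ∀ q, r m q → r q m := by
    refine exists_maximal_of_nonempty_chains_bounded (fun c hc hne => ?_) ?_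
    · classical
      set B : EReal := sSup ((fun q : 𝒮 => q.1.1) '' c) with hBdef
      set z : ℝ → E := fun s => if h : ∃ q ∈ c, (s : EReal) < q.1.1 then h.choose.1.2 s else 0
        with hzdef
      have hle : ∀ q ∈ c, q.1.1 ≤ B := fun q hq => le_sSup ⟨q, hq, rfl⟩
      have heq : ∀ q ∈ c, ∀ s : ℝ, (s : EReal) < q.1.1 → z s = q.1.2 s := by
        intro q hq s hs
        have h : ∃ q ∈ c, (s : EReal) < q.1.1 := ⟨q, hq, hs⟩
        have hz : z s = h.choose.1.2 s := by simp only [hzdef, dif_pos h]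
        rw [hz]
        obtain ⟨h1, h2⟩ := h.choose_spec
        by_cases hEq : h.choose = q
        · rw [hEq]
        rcases hc h1 hq hEq with h' | h'
        · exact h'.2 s h2
        · exact (h'.2 s hs).symm
      obtain ⟨q₀, hq₀⟩ := hne
      have hex : ∀ s : ℝ, (s : EReal) < B → ∃ q ∈ c, (s : EReal) < q.1.1 := by
        intro s hs
        obtain ⟨_, ⟨q, hq, rfl⟩, h⟩ := lt_sSup_iff.1 hs
        exact ⟨q, hq, h⟩
      have hB : IsSolutionUpTo F U z₀ ε B z := by
        refine ⟨q₀.2.le.trans (hle q₀ hq₀), ?_, ?_, ?_⟩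
        · rw [heq q₀ hq₀ 0 (lt_of_lt_of_le (by exact_mod_cast hε) q₀.2.le), q₀.2.init]
        · intro s h1 h2
          obtain ⟨q, hq, h⟩ := hex s h2
          rw [heq q hq s h]
          exact q.2.mem s h1 h
        · intro s h1 h2
          obtain ⟨q, hq, h⟩ := hex s h2
          rw [heq q hq s h]
          refine (q.2.hasDerivAt s h1 h).congr_of_eventuallyEq ?_
          filter_upwards [continuous_coe_real_ereal.continuousAt.preimage_mem_nhds
            (Iio_mem_nhds h)] with t ht using heq q hq t ht
      exact ⟨⟨(B, z), hB⟩, fun q hq => ⟨hle q hq, fun s hs => (heq q hq s hs).symm⟩⟩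
    · rintro q₁ q₂ q₃ ⟨h1, h2⟩ ⟨h3, h4⟩
      exact ⟨h1.trans h3, fun s hs => (h2 s hs).trans (h4 s (hs.trans_le h1))⟩
  obtain ⟨⟨B, z⟩, hz⟩ := m
  refine ⟨B, z, hz, fun K hKU hK hzK => ?_⟩
  by_contra hB
  have hbot : B ≠ ⊥ := (lt_of_lt_of_le (EReal.bot_lt_coe ε) hz.le).ne'
  lift B to ℝ using ⟨hB, hbot⟩
  obtain ⟨b', hb', z', hz', heq⟩ := hz.extend hU hF hε hK hKU
    fun s h1 h2 => hzK s h1 (by exact_mod_cast h2)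
  have := (hm ⟨((b' : EReal), z'), hz'⟩ ⟨EReal.coe_le_coe_iff.2 hb'.le, fun s hs =>
    heq s (EReal.coe_lt_coe_iff.1 hs)⟩).1
  exact absurd (EReal.coe_le_coe_iff.1 this) (not_le.2 hb')

end ODE

/-! ### Algebra of the metric -/

/-- The one-form `dt - a sin² θ dφ`. -/
def omegaT (a : ℝ) (x v : Coord) : ℝ := v 0 - a * sinSqDphi x v

/-- `g(v, v)`-part `θ'² + sin² θ φ'²` of the round unit sphere, in polarized form. -/
def sphereForm (x v w : Coord) : ℝ :=
  (v 1 * w 1 + v 2 * w 2 + v 3 * w 3 - dr x v * dr x w) / rad x ^ 2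

/-- The energy `-g(∂_t, v)`. -/
def energy (M a : ℝ) (x v : Coord) : ℝ := v 0 - 2 * M * rad x / Sig a x * omegaT a x v

/-- `-g(v, (r² + a²) ∂_t + a ∂_φ) = (r² + a²) E - a L`, the momentum along the principal null
directions; it is positive on future directed null vectors. -/
def prinMom (M a : ℝ) (x v : Coord) : ℝ := Delta M a (rad x) * omegaT a x v

/-- `Σ r'`, the derivative of `r` with respect to Mino time. -/
def radMom (a : ℝ) (x v : Coord) : ℝ := Sig a x * dr x v

/-- Carter's constant `K = Q + (L - a E)²`, expressed for null vectors through the radial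
equation `(Σ r')² = ((r² + a²) E - a L)² - Δ K`. -/
def carter (M a : ℝ) (x v : Coord) : ℝ :=
  (prinMom M a x v ^ 2 - radMom a x v ^ 2) / Delta M a (rad x)

/-- `a² E - a L`, so that `(r² + a²) E - a L` is `offset + r² E`. -/
def offset (M a : ℝ) (x v : Coord) : ℝ := prinMom M a x v - rad x ^ 2 * energy M a x v

section parameters

variable {M a : ℝ}

theorem mu_pos (ha : 0 ≤ a) (haM : a < M) : 0 < M ^ 2 - a ^ 2 := by nlinarith

theorem rPlus_sub_pos (ha : 0 ≤ a) (haM : a < M) : 0 < rPlus M a - M := by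
  have := Real.sqrt_pos.2 (mu_pos ha haM)
  simp only [rPlus]; linarith

theorem rPlus_pos (ha : 0 ≤ a) (haM : a < M) : 0 < rPlus M a := by
  have := rPlus_sub_pos ha haM; linarith

theorem rPlus_sub_sq (ha : 0 ≤ a) (haM : a < M) : (rPlus M a - M) ^ 2 = M ^ 2 - a ^ 2 := by
  have := Real.sq_sqrt (mu_pos ha haM).le
  simp only [rPlus]; linarith

theorem rPlus_add_rMinus : rPlus M a + rMinus M a = 2 * M := by simp only [rPlus, rMinus]; ring

theorem rPlus_mul_rMinus (ha : 0 ≤ a) (haM : a < M) : rPlus M a * rMinus M a = a ^ 2 := by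
  have := Real.sq_sqrt (mu_pos ha haM).le
  simp only [rPlus, rMinus]; linear_combination -this

theorem rMinus_lt_rPlus (ha : 0 ≤ a) (haM : a < M) : rMinus M a < rPlus M a := by
  have := rPlus_sub_pos ha haM
  have := rPlus_add_rMinus (M := M) (a := a)
  linarith

theorem rMinus_nonneg (ha : 0 ≤ a) (haM : a < M) : 0 ≤ rMinus M a := by
  have h1 := rPlus_mul_rMinus ha haM
  have h2 := rPlus_pos ha haM
  by_contra h
  nlinarith [sq_nonneg a]

theorem Delta_eq_mul (ha : 0 ≤ a) (haM : a < M) (r : ℝ) :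
    Delta M a r = (r - rPlus M a) * (r - rMinus M a) := by
  have h1 := rPlus_mul_rMinus ha haM
  have h2 := rPlus_add_rMinus (M := M) (a := a)
  simp only [Delta]
  linear_combination r * h2 - h1

theorem Delta_pos (ha : 0 ≤ a) (haM : a < M) {r : ℝ} (hr : rPlus M a < r) :
    0 < Delta M a r := by
  rw [Delta_eq_mul ha haM]
  have := rMinus_lt_rPlus ha haM
  exact mul_pos (by linarith) (by linarith)

theorem Delta_rPlus (ha : 0 ≤ a) (haM : a < M) : Delta M a (rPlus M a) = 0 := by
  rw [Delta_eq_mul ha haM]; ring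

theorem Delta_mono (ha : 0 ≤ a) (haM : a < M) {r r' : ℝ} (hr : rPlus M a ≤ r) (h : r ≤ r') :
    Delta M a r ≤ Delta M a r' := by
  have := rPlus_sub_pos ha haM
  simp only [Delta]; nlinarith

end parameters

section

variable {M a : ℝ} {x : Coord}

theorem rad_nonneg (x : Coord) : 0 ≤ rad x := Real.sqrt_nonneg _

theorem rad_sq (x : Coord) : rad x ^ 2 = x 1 ^ 2 + x 2 ^ 2 + x 3 ^ 2 :=
  Real.sq_sqrt (by positivity)

theorem rad_pos_of_mem (ha : 0 ≤ a) (haM : a < M) (hx : x ∈ exterior M a) : 0 < rad x :=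
  (rPlus_pos ha haM).trans hx

theorem Delta_pos_of_mem (ha : 0 ≤ a) (haM : a < M) (hx : x ∈ exterior M a) :
    0 < Delta M a (rad x) := Delta_pos ha haM hx

theorem rad_sq_le_Sig (x : Coord) : rad x ^ 2 ≤ Sig a x := by
  simp only [Sig]; nlinarith [sq_nonneg (a * (x 3 / rad x))]

theorem Sig_pos (hx : 0 < rad x) : 0 < Sig a x :=
  (by positivity : 0 < rad x ^ 2).trans_le (rad_sq_le_Sig x)

theorem Sig_add (hx : 0 < rad x) :
    Sig a x + a ^ 2 * ((x 1 ^ 2 + x 2 ^ 2) / rad x ^ 2) = rad x ^ 2 + a ^ 2 := by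
  have h := rad_sq x
  simp only [Sig]
  field_simp
  linear_combination -a ^ 2 * h

theorem Sig_le (hx : 0 < rad x) : Sig a x ≤ rad x ^ 2 + a ^ 2 := by
  rw [← Sig_add hx]
  have : 0 ≤ a ^ 2 * ((x 1 ^ 2 + x 2 ^ 2) / rad x ^ 2) := by positivity
  linarith

/-- The Kerr metric in terms of `dt - a sin² θ dφ`, `dr` and the round sphere. -/
theorem metric_eq (hx : 0 < rad x) (v w : Coord) : metric M a x v w =
    -(v 0 * w 0) + a ^ 2 * (sinSqDphi x v * sinSqDphi x w)
      + 2 * M * rad x / Sig a x * (omegaT a x v * omegaT a x w)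
      + Sig a x / Delta M a (rad x) * (dr x v * dr x w) + Sig a x * sphereForm x v w := by
  have := (Sig_pos (a := a) hx).ne'
  simp only [metric, omegaT, sphereForm]
  ring

theorem dr_add (x v w : Coord) : dr x (v + w) = dr x v + dr x w := by
  simp only [dr, Pi.add_apply]; ring
theorem dr_smul (x v : Coord) (c : ℝ) : dr x (c • v) = c * dr x v := by
  simp only [dr, Pi.smul_apply, smul_eq_mul]; ring
theorem sinSqDphi_add (x v w : Coord) :
    sinSqDphi x (v + w) = sinSqDphi x v + sinSqDphi x w := by
  simp only [sinSqDphi, Pi.add_apply]; ring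
theorem sinSqDphi_smul (x v : Coord) (c : ℝ) : sinSqDphi x (c • v) = c * sinSqDphi x v := by
  simp only [sinSqDphi, Pi.smul_apply, smul_eq_mul]; ring

theorem metric_comm (M a : ℝ) (x v w : Coord) : metric M a x v w = metric M a x w v := by
  simp only [metric]; ring

/-- The Kerr metric at a point as a bilinear form. -/
def metricForm (M a : ℝ) (x : Coord) : Coord →ₗ[ℝ] Coord →ₗ[ℝ] ℝ :=
  LinearMap.mk₂ ℝ (metric M a x)
    (fun v₁ v₂ w => by simp only [metric, dr_add, sinSqDphi_add, Pi.add_apply]; ring)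
    (fun c v w => by
      simp only [metric, dr_smul, sinSqDphi_smul, Pi.smul_apply, smul_eq_mul]; ring)
    (fun v w₁ w₂ => by simp only [metric, dr_add, sinSqDphi_add, Pi.add_apply]; ring)
    (fun c v w => by
      simp only [metric, dr_smul, sinSqDphi_smul, Pi.smul_apply, smul_eq_mul]; ring)

theorem metricForm_apply (M a : ℝ) (x v w : Coord) :
    metricForm M a x v w = metric M a x v w := rfl

/-- `∂_t`. -/
def vecT : Coord := Pi.single 0 1

/-- `∂_φ`. -/
def vecPhi (x : Coord) : Coord := ![0, -x 2, x 1, 0]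

/-- `r ∂_r`. -/
def vecR (x : Coord) : Coord := ![0, x 1, x 2, x 3]

theorem metric_vecT (hx : 0 < rad x) (v : Coord) :
    metric M a x v vecT = -energy M a x v := by
  rw [metric_eq hx]
  have h0 : vecT 0 = 1 := rfl
  have h1 : vecT 1 = 0 := rfl
  have h2 : vecT 2 = 0 := rfl
  have h3 : vecT 3 = 0 := rfl
  simp only [sphereForm, omegaT, energy, sinSqDphi, dr, h0, h1, h2, h3]
  ring

theorem metric_timeVector (hx : 0 < rad x) (v : Coord) :
    metric M a x v (timeVector a x) = -prinMom M a x v := by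
  rw [metric_eq hx]
  have h0 : timeVector a x 0 = rad x ^ 2 + a ^ 2 := rfl
  have h1 : timeVector a x 1 = -(a * x 2) := rfl
  have h2 : timeVector a x 2 = a * x 1 := rfl
  have h3 : timeVector a x 3 = 0 := rfl
  have hS := Sig_add (a := a) hx
  have hS0 := (Sig_pos (a := a) hx).ne'
  have hd : dr x (timeVector a x) = 0 := by simp only [dr, h1, h2, h3]; ring
  have hs : sinSqDphi x (timeVector a x) = a * ((x 1 ^ 2 + x 2 ^ 2) / rad x ^ 2) := by
    simp only [sinSqDphi, h1, h2]; ring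
  have hf : sphereForm x v (timeVector a x) = a * sinSqDphi x v := by
    simp only [sphereForm, hd, h1, h2, h3, sinSqDphi]; ring
  have ho : omegaT a x (timeVector a x) = Sig a x := by
    simp only [omegaT, hs, h0]; linear_combination -hS
  have e : 2 * M * rad x / Sig a x * (omegaT a x v * Sig a x) = 2 * M * rad x * omegaT a x v := by
    field_simp
  rw [ho, e, hd, hs, hf, h0]
  simp only [omegaT, prinMom, Delta]
  linear_combination a * sinSqDphi x v * hS

theorem metric_vecR (hx : 0 < rad x) (v : Coord) :
    metric M a x v (vecR x) = rad x * radMom a x v / Delta M a (rad x) := by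
  rw [metric_eq hx]
  have h0 : vecR x 0 = 0 := rfl
  have h1 : vecR x 1 = x 1 := rfl
  have h2 : vecR x 2 = x 2 := rfl
  have h3 : vecR x 3 = x 3 := rfl
  have hd : dr x (vecR x) = rad x := by
    simp only [dr, h1, h2, h3]; rw [div_eq_iff hx.ne']; linear_combination -rad_sq x
  have hs : sinSqDphi x (vecR x) = 0 := by
    simp only [sinSqDphi, h1, h2]; ring
  have hf : sphereForm x v (vecR x) = 0 := by
    have : dr x v * rad x = v 1 * x 1 + v 2 * x 2 + v 3 * x 3 := by
      simp only [dr]; field_simp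
    simp only [sphereForm, hd, h1, h2, h3, this]; ring
  rw [hs, hf, h0, hd]
  simp only [omegaT, hs, h0, radMom]
  ring

/-- `sin² θ |n'|² = sin² θ θ'² + (sin² θ φ')²` for a unit vector `n`. -/
theorem sinSqDphi_sq_le (hx : 0 < rad x) (v : Coord) :
    sinSqDphi x v ^ 2 ≤ (x 1 ^ 2 + x 2 ^ 2) / rad x ^ 2 * sphereForm x v v := by
  have h := rad_sq x
  have e : (x 1 ^ 2 + x 2 ^ 2) / rad x ^ 2 * sphereForm x v v - sinSqDphi x v ^ 2
      = ((x 1 * v 1 + x 2 * v 2) * x 3 - (x 1 ^ 2 + x 2 ^ 2) * v 3) ^ 2 / rad x ^ 6 := by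
    simp only [sphereForm, sinSqDphi, dr]
    field_simp
    rw [h]
    ring
  have : 0 ≤ ((x 1 * v 1 + x 2 * v 2) * x 3 - (x 1 ^ 2 + x 2 ^ 2) * v 3) ^ 2 / rad x ^ 6 := by
    positivity
  linarith

theorem sphereForm_nonneg (hx : 0 < rad x) (v : Coord) : 0 ≤ sphereForm x v v := by
  have h := rad_sq x
  have e : sphereForm x v v = ((x 1 * v 2 - x 2 * v 1) ^ 2 + (x 1 * v 3 - x 3 * v 1) ^ 2
      + (x 2 * v 3 - x 3 * v 2) ^ 2) / rad x ^ 4 := by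
    simp only [sphereForm, dr]
    field_simp
    rw [h]
    ring
  rw [e]; positivity

theorem sum_sq_eq (hx : 0 < rad x) (v : Coord) :
    v 1 ^ 2 + v 2 ^ 2 + v 3 ^ 2 = dr x v ^ 2 + rad x ^ 2 * sphereForm x v v := by
  simp only [sphereForm]; field_simp; ring

theorem metric_nondegenerate (ha : 0 ≤ a) (haM : a < M) (hx : x ∈ exterior M a) {v : Coord}
    (h : ∀ w, metric M a x v w = 0) : v = 0 := by
  have hr := rad_pos_of_mem ha haM hx
  have hD := Delta_pos_of_mem ha haM hx
  have hS := Sig_pos (a := a) hr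
  have h1 : omegaT a x v = 0 := by
    have := h (timeVector a x)
    rw [metric_timeVector hr, prinMom] at this
    simpa [hD.ne'] using this
  have h2 : dr x v = 0 := by
    have := h (vecR x)
    rw [metric_vecR hr, radMom] at this
    simpa [hD.ne', hS.ne', hr.ne'] using this
  have h3 : v 0 = a * sinSqDphi x v := by simp only [omegaT] at h1; linarith
  have h4 : sphereForm x v v = 0 := by
    have := h v
    rw [metric_eq hr, h1, h2, h3] at this
    have h5 : Sig a x * sphereForm x v v = 0 := by linarith
    simpa [hS.ne'] using h5
  have h5 := sum_sq_eq hr v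
  rw [h2, h4] at h5
  have e1 : v 1 = 0 := by nlinarith [sq_nonneg (v 1), sq_nonneg (v 2), sq_nonneg (v 3)]
  have e2 : v 2 = 0 := by nlinarith [sq_nonneg (v 1), sq_nonneg (v 2), sq_nonneg (v 3)]
  have e3 : v 3 = 0 := by nlinarith [sq_nonneg (v 1), sq_nonneg (v 2), sq_nonneg (v 3)]
  have e0 : v 0 = 0 := by rw [h3]; simp [sinSqDphi, e1, e2]
  ext i; fin_cases i <;> assumption

theorem metric_eq_sum (M a : ℝ) (x v w : Coord) :
    metric M a x v w = ∑ μ, ∑ ν, metricComp M a x μ ν * v μ * w ν := by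
  have hv : v = ∑ μ, v μ • (Pi.single μ 1 : Coord) := by
    ext i; simp [Finset.sum_apply, Pi.single_apply]
  have hw : w = ∑ μ, w μ • (Pi.single μ 1 : Coord) := by
    ext i; simp [Finset.sum_apply, Pi.single_apply]
  conv_lhs => rw [← metricForm_apply, hv, hw]
  simp only [map_sum, map_smul, LinearMap.sum_apply, LinearMap.smul_apply, smul_eq_mul,
    metricForm_apply, metricComp, Matrix.of_apply, Finset.mul_sum]
  rw [Finset.sum_comm]
  exact Finset.sum_congr rfl fun μ _ => Finset.sum_congr rfl fun ν _ => by ring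

theorem metricComp_comm (M a : ℝ) (x : Coord) (μ ν : Fin 4) :
    metricComp M a x μ ν = metricComp M a x ν μ := metric_comm _ _ _ _ _

theorem metricComp_det_ne_zero (ha : 0 ≤ a) (haM : a < M) (hx : x ∈ exterior M a) :
    (metricComp M a x).det ≠ 0 := by
  intro h
  obtain ⟨v, hv, h0⟩ := Matrix.exists_mulVec_eq_zero_iff.2 h
  refine hv (metric_nondegenerate ha haM hx fun w => ?_)
  rw [metric_comm, metric_eq_sum]
  have : ∀ μ, ∑ ν, metricComp M a x μ ν * v ν = 0 := fun μ => congrFun h0 μ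
  refine Finset.sum_eq_zero fun μ _ => ?_
  calc ∑ ν, metricComp M a x μ ν * w μ * v ν = w μ * ∑ ν, metricComp M a x μ ν * v ν := by
        rw [Finset.mul_sum]; exact Finset.sum_congr rfl fun ν _ => by ring
    _ = 0 := by rw [this, mul_zero]

/-! ### Smoothness of the metric -/

theorem isOpen_exterior (M a : ℝ) : IsOpen (exterior M a) := by
  have : Continuous rad := by unfold rad; fun_prop
  exact isOpen_lt continuous_const this

theorem contDiffAt_rad (hx : 0 < rad x) : ContDiffAt ℝ ∞ rad x := by
  have h : x 1 ^ 2 + x 2 ^ 2 + x 3 ^ 2 ≠ 0 := by rw [← rad_sq]; positivity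
  unfold rad
  exact ContDiffAt.sqrt (by fun_prop) h

theorem contDiffAt_metric (ha : 0 ≤ a) (haM : a < M) (hx : x ∈ exterior M a) (v w : Coord) :
    ContDiffAt ℝ ∞ (fun y => metric M a y v w) x := by
  have hr := rad_pos_of_mem ha haM hx
  have hD := (Delta_pos_of_mem ha haM hx).ne'
  have hS := (Sig_pos (a := a) hr).ne'
  have h1 := contDiffAt_rad hr
  have h2 : ContDiffAt ℝ ∞ (fun y => Sig a y) x := by
    unfold Sig
    have : ContDiffAt ℝ ∞ (fun y : Coord => y 3 / rad y) x :=
      ContDiffAt.div (by fun_prop) h1 hr.ne'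
    fun_prop
  have h3 : ∀ v, ContDiffAt ℝ ∞ (fun y => dr y v) x := fun v =>
    ContDiffAt.div (by fun_prop) h1 hr.ne'
  have h4 : ∀ v, ContDiffAt ℝ ∞ (fun y => sinSqDphi y v) x := fun v =>
    ContDiffAt.div (by fun_prop) (h1.pow 2) (by positivity)
  have h5 : ContDiffAt ℝ ∞ (fun y => Delta M a (rad y)) x := by unfold Delta; fun_prop
  have h3v := h3 v
  have h3w := h3 w
  have h4v := h4 v
  have h4w := h4 w
  have h6 : ∀ f : Coord → ℝ, ContDiffAt ℝ ∞ f x → ContDiffAt ℝ ∞ (fun y => f y / Sig a y) x :=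
    fun f hf => hf.div h2 hS
  have h7 := h2.div h5 hD
  have h8 := h2.div (h1.pow 2) (by positivity : rad x ^ 2 ≠ 0)
  have h9 := h6 (fun y => 2 * M * rad y) (by fun_prop)
  have h10 := h6 (fun y => 2 * M * a * rad y) (by fun_prop)
  have hc : ∀ c : ℝ, ContDiffAt ℝ ∞ (fun _ : Coord => c) x := fun c => contDiffAt_const
  exact ((((((hc 1).sub h9).neg.mul (hc _)).sub
    (h10.mul (((hc _).mul h4w).add (h4v.mul (hc _))))).add (h7.mul (h3v.mul h3w))).add
    (h8.mul ((hc _).sub (h3v.mul h3w)))).add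
    (((hc _).mul ((hc 1).add h9)).mul (h4v.mul h4w))

theorem contDiffAt_metricComp (ha : 0 ≤ a) (haM : a < M) (hx : x ∈ exterior M a)
    (μ ν : Fin 4) : ContDiffAt ℝ ∞ (fun y => metricComp M a y μ ν) x :=
  contDiffAt_metric ha haM hx _ _

theorem contDiffAt_dMetricComp (ha : 0 ≤ a) (haM : a < M) (hx : x ∈ exterior M a)
    (σ μ ν : Fin 4) : ContDiffAt ℝ ∞ (fun y => dMetricComp M a y σ μ ν) x := by
  have := (contDiffAt_metricComp ha haM hx μ ν).fderiv_right (m := ∞) (by simp)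
  exact this.clm_apply contDiffAt_const

/-- The inverse of a smooth family of invertible matrices is smooth. -/
theorem contDiffAt_matrix_inv {n E : Type*} [Fintype n] [DecidableEq n] [NormedAddCommGroup E]
    [NormedSpace ℝ E] {k : WithTop ℕ∞} {A : E → Matrix n n ℝ} {x : E}
    (hA : ∀ i j, ContDiffAt ℝ k (fun y => A y i j) x) (hdet : (A x).det ≠ 0) (i j : n) :
    ContDiffAt ℝ k (fun y => (A y)⁻¹ i j) x := by
  have hdetA : ∀ B : E → Matrix n n ℝ, (∀ i j, ContDiffAt ℝ k (fun y => B y i j) x) →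
      ContDiffAt ℝ k (fun y => (B y).det) x := by
    intro B hB
    simp only [Matrix.det_apply]
    exact ContDiffAt.sum fun σ _ => (contDiffAt_prod fun i _ => hB _ _).const_smul _
  simp only [Matrix.inv_def, Ring.inverse_eq_inv', Matrix.smul_apply, smul_eq_mul,
    Matrix.adjugate_apply]
  refine ((hdetA A hA).inv hdet).mul (hdetA _ fun i' j' => ?_)
  by_cases h : i' = j
  · subst h
    simp only [Matrix.updateRow_self]
    exact contDiffAt_const
  · simp only [Matrix.updateRow_ne h]
    exact hA _ _

theorem contDiffAt_christoffel (ha : 0 ≤ a) (haM : a < M) (hx : x ∈ exterior M a)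
    (κ μ ν : Fin 4) : ContDiffAt ℝ ∞ (fun y => christoffel M a y κ μ ν) x := by
  unfold christoffel
  refine contDiffAt_const.mul (ContDiffAt.sum fun σ _ => ?_)
  exact (contDiffAt_matrix_inv (contDiffAt_metricComp ha haM hx)
    (metricComp_det_ne_zero ha haM hx) κ σ).mul
    (((contDiffAt_dMetricComp ha haM hx μ σ ν).add (contDiffAt_dMetricComp ha haM hx ν σ μ)).sub
      (contDiffAt_dMetricComp ha haM hx σ μ ν))

/-- The geodesic spray: geodesics are the solutions of `(x, v)' = spray (x, v)`. -/
def spray (M a : ℝ) (z : Coord × Coord) : Coord × Coord :=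
  (z.2, fun κ => -∑ μ, ∑ ν, christoffel M a z.1 κ μ ν * z.2 μ * z.2 ν)

theorem contDiffAt_spray (ha : 0 ≤ a) (haM : a < M) {z : Coord × Coord}
    (hz : z.1 ∈ exterior M a) : ContDiffAt ℝ 1 (spray M a) z := by
  refine contDiffAt_snd.prodMk (contDiffAt_pi.2 fun κ => ContDiffAt.neg ?_)
  refine ContDiffAt.sum fun μ _ => ContDiffAt.sum fun ν _ => ?_
  have h1 : ContDiffAt ℝ 1 (fun z : Coord × Coord => christoffel M a z.1 κ μ ν) z :=
    ((contDiffAt_christoffel ha haM hz κ μ ν).of_le (by simp)).comp z contDiffAt_fst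
  exact (h1.mul (by fun_prop)).mul (by fun_prop)

end

section

variable {M a : ℝ} {x : Coord}

/-! ### Conservation laws along null geodesics -/

/-- The derivative of the metric in the direction `b`, contracted with `c` and `d`. -/
def metricDeriv (M a : ℝ) (x b c d : Coord) : ℝ :=
  ∑ μ, ∑ ν, fderiv ℝ (fun y => metricComp M a y μ ν) x b * c μ * d ν

theorem hasDerivAt_metric (ha : 0 ≤ a) (haM : a < M) {X V W : ℝ → Coord} {b c d : Coord} {s : ℝ}
    (hx : X s ∈ exterior M a) (hX : HasDerivAt X b s) (hV : HasDerivAt V c s)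
    (hW : HasDerivAt W d s) :
    HasDerivAt (fun s => metric M a (X s) (V s) (W s))
      (metricDeriv M a (X s) b (V s) (W s) + metric M a (X s) c (W s)
        + metric M a (X s) (V s) d) s := by
  have hg : ∀ μ ν, HasDerivAt (fun s => metricComp M a (X s) μ ν)
      (fderiv ℝ (fun y => metricComp M a y μ ν) (X s) b) s := fun μ ν =>
    (((contDiffAt_metricComp ha haM hx μ ν).differentiableAt (by simp)).hasFDerivAt).comp_hasDerivAt
      s hX
  have hV' := hasDerivAt_pi.1 hV
  have hW' := hasDerivAt_pi.1 hW
  have := HasDerivAt.fun_sum (u := Finset.univ) fun μ _ =>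
    HasDerivAt.fun_sum (u := Finset.univ) fun ν _ => ((hg μ ν).mul (hV' μ)).mul (hW' ν)
  simp only [metric_eq_sum]
  refine this.congr_deriv ?_
  simp only [metricDeriv, ← Finset.sum_add_distrib, Pi.mul_apply]
  exact Finset.sum_congr rfl fun μ _ => Finset.sum_congr rfl fun ν _ => by ring

/-- The covariant acceleration of a geodesic, in terms of the derivatives of the metric. -/
theorem metric_spray (ha : 0 ≤ a) (haM : a < M) (hx : x ∈ exterior M a) (v w : Coord) :
    metric M a x (spray M a (x, v)).2 w =
      1 / 2 * metricDeriv M a x w v v - metricDeriv M a x v v w := by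
  have hfd : ∀ b μ ν, fderiv ℝ (fun y => metricComp M a y μ ν) x b
      = ∑ σ, b σ * dMetricComp M a x σ μ ν := by
    intro b μ ν
    have hb : b = ∑ σ, b σ • (Pi.single σ 1 : Coord) := by
      ext i; simp [Finset.sum_apply, Pi.single_apply]
    conv_lhs => rw [hb]
    simp only [map_sum, map_smul, smul_eq_mul, dMetricComp]
  have hinv : ∀ l σ, ∑ κ, metricComp M a x l κ * (metricComp M a x)⁻¹ κ σ
      = if l = σ then 1 else 0 := by
    intro l σ
    rw [← Matrix.mul_apply, Matrix.mul_nonsing_inv _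
      (isUnit_iff_ne_zero.2 (metricComp_det_ne_zero ha haM hx)), Matrix.one_apply]
  have hlow : ∀ l μ ν, ∑ κ, metricComp M a x l κ * christoffel M a x κ μ ν
      = 1 / 2 * (dMetricComp M a x μ l ν + dMetricComp M a x ν l μ - dMetricComp M a x l μ ν) := by
    intro l μ ν
    simp only [christoffel, Finset.mul_sum]
    rw [Finset.sum_comm]
    calc _ = ∑ σ, (∑ κ, metricComp M a x l κ * (metricComp M a x)⁻¹ κ σ) * (1 / 2 *
          (dMetricComp M a x μ σ ν + dMetricComp M a x ν σ μ - dMetricComp M a x σ μ ν)) :=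
          Finset.sum_congr rfl fun σ _ => by
            rw [Finset.sum_mul]; exact Finset.sum_congr rfl fun κ _ => by ring
      _ = _ := by simp [hinv]
  have hsymm : ∀ σ μ ν, dMetricComp M a x σ μ ν = dMetricComp M a x σ ν μ := by
    intro σ μ ν
    simp only [dMetricComp, metricComp_comm M a _ μ ν]
  have hleft : metric M a x (spray M a (x, v)).2 w =
      -∑ l, ∑ μ, ∑ ν, (1 / 2 * (dMetricComp M a x μ l ν + dMetricComp M a x ν l μ
        - dMetricComp M a x l μ ν)) * (w l * v μ * v ν) := by
    rw [metric_comm, metric_eq_sum, ← Finset.sum_neg_distrib]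
    refine Finset.sum_congr rfl fun l _ => ?_
    simp only [← hlow, spray]
    simp only [mul_neg, Finset.sum_neg_distrib, Finset.mul_sum, Finset.sum_mul, neg_inj]
    rw [Finset.sum_comm]
    refine Finset.sum_congr rfl fun μ _ => ?_
    rw [Finset.sum_comm]
    exact Finset.sum_congr rfl fun ν _ => Finset.sum_congr rfl fun κ _ => by ring
  have h1 : metricDeriv M a x w v v
      = ∑ l, ∑ μ, ∑ ν, dMetricComp M a x l μ ν * (w l * v μ * v ν) := by
    simp only [metricDeriv, hfd, Finset.sum_mul]
    rw [Finset.sum_comm_cycle]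
    exact Finset.sum_congr rfl fun l _ => Finset.sum_congr rfl fun μ _ =>
      Finset.sum_congr rfl fun ν _ => by ring
  have h2 : metricDeriv M a x v v w
      = ∑ l, ∑ μ, ∑ ν, dMetricComp M a x μ l ν * (w l * v μ * v ν) := by
    simp only [metricDeriv, hfd, Finset.sum_mul]
    rw [Finset.sum_comm]
    refine Finset.sum_congr rfl fun l _ => ?_
    rw [Finset.sum_comm]
    exact Finset.sum_congr rfl fun μ _ =>
      Finset.sum_congr rfl fun ν _ => by rw [hsymm μ l ν]; ring
  have h3 : metricDeriv M a x v v w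
      = ∑ l, ∑ μ, ∑ ν, dMetricComp M a x ν l μ * (w l * v μ * v ν) := by
    rw [h2]
    refine Finset.sum_congr rfl fun l _ => ?_
    rw [Finset.sum_comm]
    exact Finset.sum_congr rfl fun μ _ => Finset.sum_congr rfl fun ν _ => by ring
  have : metric M a x (spray M a (x, v)).2 w = 1 / 2 * metricDeriv M a x w v v
      - 1 / 2 * (metricDeriv M a x v v w + metricDeriv M a x v v w) := by
    rw [hleft]
    nth_rewrite 1 [h2]
    rw [h3, h1]
    simp only [Finset.mul_sum, ← Finset.sum_add_distrib, ← Finset.sum_sub_distrib,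
      ← Finset.sum_neg_distrib]
    exact Finset.sum_congr rfl fun l _ => Finset.sum_congr rfl fun μ _ =>
      Finset.sum_congr rfl fun ν _ => by ring
  rw [this]; ring

/-- The curve `γ` with velocity `v` satisfies the geodesic equation at the parameter `s`. -/
structure GeodesicAt (M a : ℝ) (γ v : ℝ → Coord) (s : ℝ) : Prop where
  mem : γ s ∈ exterior M a
  pos : HasDerivAt γ (v s) s
  vel : HasDerivAt v (spray M a (γ s, v s)).2 s

theorem GeodesicAt.eventually_mem {γ v : ℝ → Coord} {s : ℝ}
    (h : GeodesicAt M a γ v s) : ∀ᶠ t in 𝓝 s, γ t ∈ exterior M a :=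
  h.pos.continuousAt.preimage_mem_nhds ((isOpen_exterior M a).mem_nhds h.mem)

theorem GeodesicAt.eventually_rad_pos (ha : 0 ≤ a) (haM : a < M) {γ v : ℝ → Coord} {s : ℝ}
    (h : GeodesicAt M a γ v s) : ∀ᶠ t in 𝓝 s, 0 < rad (γ t) :=
  h.eventually_mem.mono fun _ ht => rad_pos_of_mem ha haM ht

theorem GeodesicAt.hasDerivAt_metric_self (ha : 0 ≤ a) (haM : a < M) {γ v : ℝ → Coord} {s : ℝ}
    (h : GeodesicAt M a γ v s) : HasDerivAt (fun s => metric M a (γ s) (v s) (v s)) 0 s := by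
  refine (hasDerivAt_metric ha haM h.mem h.pos h.vel h.vel).congr_deriv ?_
  rw [metric_comm M a _ (v s), metric_spray ha haM h.mem]
  ring

/-- The Euler-Lagrange equations: `g(v, ξ)` changes at the rate at which `g(v, v) / 2` changes
when the tangent vector `v` is carried along a curve of tangent vectors with initial velocity
`(ξ, ξ')`, e.g. by the flow of `ξ`. -/
theorem GeodesicAt.hasDerivAt_metric_vec (ha : 0 ≤ a) (haM : a < M) {γ v : ℝ → Coord} {s : ℝ}
    (h : GeodesicAt M a γ v s) {ξ : ℝ → Coord} {ξ' : Coord} (hξ : HasDerivAt ξ ξ' s)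
    {X V : ℝ → Coord} (hX0 : X 0 = γ s) (hV0 : V 0 = v s) (hX : HasDerivAt X (ξ s) 0)
    (hV : HasDerivAt V ξ' 0) {D : ℝ}
    (hD : HasDerivAt (fun τ => metric M a (X τ) (V τ) (V τ)) D 0) :
    HasDerivAt (fun s => metric M a (γ s) (v s) (ξ s)) (D / 2) s := by
  refine (hasDerivAt_metric ha haM h.mem h.pos h.vel hξ).congr_deriv ?_
  have h1 := hasDerivAt_metric ha haM (by rw [hX0]; exact h.mem) hX hV hV
  rw [hX0, hV0] at h1
  rw [hD.unique h1, metric_spray ha haM h.mem, metric_comm M a _ ξ']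
  ring

theorem GeodesicAt.hasDerivAt_energy (ha : 0 ≤ a) (haM : a < M) {γ v : ℝ → Coord} {s : ℝ}
    (h : GeodesicAt M a γ v s) :
    HasDerivAt (fun s => energy M a (γ s) (v s)) 0 s := by
  have hX : HasDerivAt (fun τ : ℝ => γ s + τ • vecT) vecT 0 := by
    simpa using ((hasDerivAt_id (0 : ℝ)).smul_const vecT).const_add (γ s)
  have hD : HasDerivAt (fun τ : ℝ => metric M a (γ s + τ • vecT) (v s) (v s)) 0 0 := by
    refine (hasDerivAt_const (0 : ℝ) (metric M a (γ s) (v s) (v s))).congr_of_eventuallyEq ?_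
    refine Eventually.of_forall fun τ => ?_
    have h1 : (γ s + τ • vecT) 1 = γ s 1 := by simp [vecT]
    have h2 : (γ s + τ • vecT) 2 = γ s 2 := by simp [vecT]
    have h3 : (γ s + τ • vecT) 3 = γ s 3 := by simp [vecT]
    simp only [metric, Sig, dr, sinSqDphi, rad, h1, h2, h3]
  have := h.hasDerivAt_metric_vec ha haM (hasDerivAt_const s vecT) (by simp) rfl hX
    (hasDerivAt_const 0 (v s)) hD
  refine ((this.neg).congr_of_eventuallyEq ?_).congr_deriv (by simp)
  filter_upwards [h.eventually_rad_pos ha haM] with t ht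
  rw [Pi.neg_apply, metric_vecT ht, neg_neg]

theorem GeodesicAt.hasDerivAt_metric_vecPhi (ha : 0 ≤ a) (haM : a < M) {γ v : ℝ → Coord} {s : ℝ}
    (h : GeodesicAt M a γ v s) :
    HasDerivAt (fun s => metric M a (γ s) (v s) (vecPhi (γ s))) 0 s := by
  let R : ℝ → Coord → Coord := fun τ x =>
    ![x 0, x 1 * Real.cos τ - x 2 * Real.sin τ, x 1 * Real.sin τ + x 2 * Real.cos τ, x 3]
  have hR : ∀ x, HasDerivAt (fun τ => R τ x) (vecPhi x) 0 := by
    intro x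
    refine hasDerivAt_pi.2 fun i => ?_
    have h1 := Real.hasDerivAt_cos 0
    have h2 := Real.hasDerivAt_sin 0
    fin_cases i
    · exact hasDerivAt_const _ _
    · exact ((h1.const_mul (x 1)).sub (h2.const_mul (x 2))).congr_deriv (by simp [vecPhi])
    · exact ((h2.const_mul (x 1)).add (h1.const_mul (x 2))).congr_deriv (by simp [vecPhi])
    · exact hasDerivAt_const _ _
  have hR0 : ∀ x, R 0 x = x := by
    intro x; ext i; fin_cases i <;> simp [R]
  have hξ : HasDerivAt (fun s => vecPhi (γ s)) (vecPhi (v s)) s := by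
    have := hasDerivAt_pi.1 h.pos
    refine hasDerivAt_pi.2 fun i => ?_
    fin_cases i
    · exact hasDerivAt_const _ _
    · exact (this 2).neg
    · exact this 1
    · exact hasDerivAt_const _ _
  have hD : HasDerivAt (fun τ : ℝ => metric M a (R τ (γ s)) (R τ (v s)) (R τ (v s))) 0 0 := by
    refine (hasDerivAt_const (0 : ℝ) (metric M a (γ s) (v s) (v s))).congr_of_eventuallyEq ?_
    refine Eventually.of_forall fun τ => ?_
    have e0 : ∀ x, R τ x 0 = x 0 := fun x => rfl
    have e1 : ∀ x, R τ x 1 = x 1 * Real.cos τ - x 2 * Real.sin τ := fun x => rfl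
    have e2 : ∀ x, R τ x 2 = x 1 * Real.sin τ + x 2 * Real.cos τ := fun x => rfl
    have e3 : ∀ x, R τ x 3 = x 3 := fun x => rfl
    have hcs := Real.sin_sq_add_cos_sq τ
    have f1 : ∀ x y : Coord, R τ x 1 * R τ y 1 + R τ x 2 * R τ y 2 = x 1 * y 1 + x 2 * y 2 := by
      intro x y
      simp only [e1, e2]
      linear_combination (x 1 * y 1 + x 2 * y 2) * hcs
    have f2 : ∀ x y : Coord, R τ x 1 * R τ y 2 - R τ x 2 * R τ y 1 = x 1 * y 2 - x 2 * y 1 := by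
      intro x y
      simp only [e1, e2]
      linear_combination (x 1 * y 2 - x 2 * y 1) * hcs
    have g1 : rad (R τ (γ s)) = rad (γ s) := by
      have := f1 (γ s) (γ s)
      simp only [rad, sq, this, e3]
    have g2 : dr (R τ (γ s)) (R τ (v s)) = dr (γ s) (v s) := by
      simp only [dr, g1, f1, e3]
    have g3 : sinSqDphi (R τ (γ s)) (R τ (v s)) = sinSqDphi (γ s) (v s) := by
      simp only [sinSqDphi, g1, f2]
    simp only [metric, Sig, g1, g2, g3, e0, e3, f1]
  simpa using h.hasDerivAt_metric_vec ha haM hξ (hR0 _) (hR0 _) (hR _) (hR _) hD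

theorem hasDerivAt_rad {γ : ℝ → Coord} {v : Coord} {s : ℝ} (hγ : HasDerivAt γ v s)
    (hr : 0 < rad (γ s)) : HasDerivAt (fun s => rad (γ s)) (dr (γ s) v) s := by
  have h := hasDerivAt_pi.1 hγ
  have h0 : γ s 1 ^ 2 + γ s 2 ^ 2 + γ s 3 ^ 2 ≠ 0 := by rw [← rad_sq]; positivity
  have := (((((h 1).pow 2).add ((h 2).pow 2)).add ((h 3).pow 2))).sqrt h0
  refine this.congr_deriv ?_
  have e : √(γ s 1 ^ 2 + γ s 2 ^ 2 + γ s 3 ^ 2) = rad (γ s) := rfl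
  simp only [Pi.add_apply, Pi.pow_apply, e, dr]
  field_simp
  ring

theorem prinMom_eq (hx : 0 < rad x) (v : Coord) : prinMom M a x v =
    (rad x ^ 2 + a ^ 2) * energy M a x v - a * metric M a x v (vecPhi x) := by
  have e : timeVector a x = (rad x ^ 2 + a ^ 2) • vecT + a • vecPhi x := by
    ext i; fin_cases i <;> simp [timeVector, vecT, vecPhi]
  have h := metric_timeVector (M := M) (a := a) hx v
  rw [e, ← metricForm_apply, map_add, map_smul, map_smul, metricForm_apply, metricForm_apply,
    metric_vecT hx, smul_eq_mul, smul_eq_mul] at h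
  linarith

theorem GeodesicAt.hasDerivAt_offset (ha : 0 ≤ a) (haM : a < M) {γ v : ℝ → Coord} {s : ℝ}
    (h : GeodesicAt M a γ v s) :
    HasDerivAt (fun s => offset M a (γ s) (v s)) 0 s := by
  have := ((h.hasDerivAt_energy ha haM).const_mul (a ^ 2)).sub
    ((h.hasDerivAt_metric_vecPhi ha haM).const_mul a)
  refine (this.congr_of_eventuallyEq ?_).congr_deriv (by simp)
  filter_upwards [h.eventually_rad_pos ha haM] with t ht
  rw [offset, prinMom_eq ht, Pi.sub_apply]
  ring

/-- The radial equation of motion of a null geodesic, as an equation for `Σ r'`. -/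
theorem GeodesicAt.hasDerivAt_radMom (ha : 0 ≤ a) (haM : a < M) {γ v : ℝ → Coord} {s : ℝ}
    (h : GeodesicAt M a γ v s)
    (hnull : metric M a (γ s) (v s) (v s) = 0) :
    HasDerivAt (fun s => radMom a (γ s) (v s))
      ((2 * rad (γ s) * energy M a (γ s) (v s) * prinMom M a (γ s) (v s)
        - (rad (γ s) - M) * carter M a (γ s) (v s)) / Sig a (γ s)) s := by
  have hr0 := rad_pos_of_mem ha haM h.mem
  have hD0 := Delta_pos_of_mem ha haM h.mem
  have hS0 := Sig_pos (a := a) hr0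
  set x := γ s with hx
  set w := v s with hw
  -- the dilation `(t, x) ↦ (t, (1 + τ) x)`
  let R : ℝ → Coord → Coord := fun τ y => y + τ • vecR y
  have hRd : ∀ y, HasDerivAt (fun τ => R τ y) (vecR y) 0 := fun y =>
    (((hasDerivAt_id (0 : ℝ)).smul_const (vecR y)).const_add y).congr_deriv (by simp)
  have hR0 : ∀ y, R 0 y = y := fun y => by simp [R]
  have hξ : HasDerivAt (fun s => vecR (γ s)) (vecR w) s := by
    have := hasDerivAt_pi.1 h.pos
    refine hasDerivAt_pi.2 fun i => ?_
    fin_cases i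
    · exact hasDerivAt_const _ _
    · exact this 1
    · exact this 2
    · exact this 3
  set r := rad x with hrdef
  set c := x 3 / r with hc
  set o := omegaT a x w with ho
  set σ := sinSqDphi x w with hσ
  set ρ := dr x w with hρ
  set W := sphereForm x w w with hW
  have hSc : Sig a x = r ^ 2 + a ^ 2 * c ^ 2 := rfl
  have hDc : Delta M a r = r ^ 2 - 2 * M * r + a ^ 2 := rfl
  have hval : ∀ᶠ τ : ℝ in 𝓝 0, metric M a (R τ x) (R τ w) (R τ w) =
      -(w 0 * w 0) + a ^ 2 * (σ * σ)
      + 2 * M * ((1 + τ) * r) / (((1 + τ) * r) ^ 2 + a ^ 2 * c ^ 2) * (o * o)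
      + (((1 + τ) * r) ^ 2 + a ^ 2 * c ^ 2)
        / (((1 + τ) * r) ^ 2 - 2 * M * ((1 + τ) * r) + a ^ 2) * ((1 + τ) * ρ * ((1 + τ) * ρ))
      + (((1 + τ) * r) ^ 2 + a ^ 2 * c ^ 2) * W := by
    filter_upwards [Ioi_mem_nhds (show (-1 : ℝ) < 0 by norm_num)] with τ hτ
    have hτ : 0 < 1 + τ := by have : -1 < τ := hτ; linarith
    have e0 : ∀ y, R τ y 0 = y 0 := fun y => show y 0 + τ * 0 = y 0 by ring
    have e1 : ∀ y, R τ y 1 = (1 + τ) * y 1 := fun y =>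
      show y 1 + τ * y 1 = (1 + τ) * y 1 by ring
    have e2 : ∀ y, R τ y 2 = (1 + τ) * y 2 := fun y =>
      show y 2 + τ * y 2 = (1 + τ) * y 2 by ring
    have e3 : ∀ y, R τ y 3 = (1 + τ) * y 3 := fun y =>
      show y 3 + τ * y 3 = (1 + τ) * y 3 by ring
    have g1 : rad (R τ x) = (1 + τ) * r := by
      rw [rad, e1, e2, e3, show ((1 + τ) * x 1) ^ 2 + ((1 + τ) * x 2) ^ 2 + ((1 + τ) * x 3) ^ 2
        = ((1 + τ) * r) ^ 2 by rw [mul_pow _ r, rad_sq]; ring]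
      exact Real.sqrt_sq (by positivity)
    have g2 : dr (R τ x) (R τ w) = (1 + τ) * ρ := by
      simp only [dr, g1, e1, e2, e3, hρ]; rw [← hrdef]; field_simp
    have g3 : sinSqDphi (R τ x) (R τ w) = σ := by
      simp only [sinSqDphi, g1, e1, e2, hσ]; rw [← hrdef]; field_simp
    have g4 : sphereForm (R τ x) (R τ w) (R τ w) = W := by
      simp only [hW, sphereForm, g1, g2, e1, e2, e3]
      rw [← hρ, ← hrdef]
      field_simp
    have g5 : omegaT a (R τ x) (R τ w) = o := by simp only [omegaT, g3, e0, ho, ← hσ]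
    have g6 : Sig a (R τ x) = ((1 + τ) * r) ^ 2 + a ^ 2 * c ^ 2 := by
      have : (1 + τ) * x 3 / ((1 + τ) * r) = c := by rw [hc]; field_simp
      rw [Sig, g1, e3, this]
    rw [metric_eq (by rw [g1]; positivity), g1, g2, g3, g4, g5, g6, e0]
    rfl
  have hl : HasDerivAt (fun τ : ℝ => (1 + τ) * r) r 0 := by
    simpa using ((hasDerivAt_id (0 : ℝ)).const_add 1).mul_const r
  have hl1 : HasDerivAt (fun τ : ℝ => (1 + τ) * ρ) ρ 0 := by
    simpa using ((hasDerivAt_id (0 : ℝ)).const_add 1).mul_const ρ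
  have hSl := (hl.pow 2).add_const (a ^ 2 * c ^ 2)
  have hDl := ((hl.pow 2).sub (hl.const_mul (2 * M))).add_const (a ^ 2)
  have hDd := (((((hl.const_mul (2 * M)).div hSl
    (by simpa [← hSc] using hS0.ne')).mul_const (o * o)).const_add
      (-(w 0 * w 0) + a ^ 2 * (σ * σ))).add
    ((hSl.div hDl (by simpa [← hDc] using hD0.ne')).mul (hl1.mul hl1))).add (hSl.mul_const W)
  have hmain := h.hasDerivAt_metric_vec ha haM hξ (hR0 _) (hR0 _) (hRd _) (hRd _)
    (hDd.congr_of_eventuallyEq hval)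
  -- solve for `Σ r'`
  have hrad := hasDerivAt_rad h.pos hr0
  have hDelta := ((hrad.pow 2).sub (hrad.const_mul (2 * M))).add_const (a ^ 2)
  have hfin := (hmain.mul hDelta).div hrad hr0.ne'
  refine (hfin.congr_of_eventuallyEq ?_).congr_deriv ?_
  · filter_upwards [h.eventually_rad_pos ha haM, h.eventually_mem] with t ht ht'
    have := (Delta_pos_of_mem ha haM ht').ne'
    simp only [Pi.div_apply, Pi.mul_apply, Pi.sub_apply, Pi.pow_apply,
      metric_vecR ht]
    have e : rad (γ t) ^ 2 - 2 * M * rad (γ t) + a ^ 2 = Delta M a (rad (γ t)) := rfl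
    rw [e]
    field_simp
  · have hE : energy M a x w = w 0 - 2 * M * r / Sig a x * o := rfl
    have hσo : w 0 = o + a * σ := by simp only [ho, omegaT, ← hσ]; ring
    have hP : prinMom M a x w = Delta M a r * o := rfl
    have hu : radMom a x w = Sig a x * ρ := rfl
    have hmv := metric_vecR (M := M) (a := a) hr0 w
    rw [metric_eq hr0, ← hσ, ← hρ, ← hW, ← ho, ← hrdef] at hnull
    have hWe : W = (w 0 * w 0 - a ^ 2 * (σ * σ) - 2 * M * r / Sig a x * (o * o)
      - Sig a x / Delta M a r * (ρ * ρ)) / Sig a x := by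
      rw [eq_div_iff hS0.ne']; linarith
    rw [carter, hP, hu, hE]
    simp only [Pi.mul_apply, Pi.sub_apply, Pi.pow_apply, Pi.div_apply]
    simp only [← hx, ← hw, ← hrdef, ← hρ, hmv, hu]
    rw [hWe, hσo]
    simp only [add_zero, one_mul, Nat.cast_ofNat, pow_one, ← hSc, ← hDc, Nat.add_one_sub_one]
    have hSne := hS0.ne'
    have hDne := hD0.ne'
    have hrne := hr0.ne'
    clear_value r o σ ρ W c x w
    field_simp
    rw [hDc]
    ring

end

/-! ### The radial equation -/

/-- `2 ρ E Δ - (ρ - M) P` for `P = C + ρ² E`; it has the sign of the derivative of `P² / Δ` where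
`P` is positive. -/
def critPoly (M a E C ρ : ℝ) : ℝ :=
  2 * ρ * E * Delta M a ρ - (ρ - M) * (C + ρ ^ 2 * E)

/-- The radial motion of a future directed null geodesic with energy `E`, Carter constant `K` and
`C = a² E - a L`, so that `P = C + r² E`, from parameter `0` up to `β`. The function `u` is `Σ r'`
and `S` is `Σ` along the geodesic. -/
structure RadialOrbit (M a E C K : ℝ) (β : EReal) (r u S : ℝ → ℝ) : Prop where
  pos : 0 < β
  gt : ∀ s ∈ upTo 0 β, rPlus M a < r s
  deriv_r : ∀ s ∈ upTo 0 β, HasDerivAt r (u s / S s) s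
  deriv_u : ∀ s ∈ upTo 0 β, HasDerivAt u
    ((2 * r s * E * (C + r s ^ 2 * E) - (r s - M) * K) / S s) s
  u_sq : ∀ s ∈ upTo 0 β, u s ^ 2 = (C + r s ^ 2 * E) ^ 2 - Delta M a (r s) * K
  S_ge : ∀ s ∈ upTo 0 β, r s ^ 2 ≤ S s
  S_le : ∀ s ∈ upTo 0 β, S s ≤ r s ^ 2 + a ^ 2
  K_nonneg : 0 ≤ K
  of_K_eq_zero : K = 0 → 0 < E ∧ 0 ≤ C
  init_pos : 0 < C + r 0 ^ 2 * E

/-- `R = P² - Δ K` has a double root at `x`, and `P x > 0`. -/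
structure IsDoubleRoot (M a E C K x : ℝ) : Prop where
  gt : rPlus M a < x
  E_pos : 0 < E
  crit : (C + x ^ 2 * E) * (x - M) = 2 * x * Delta M a x * E
  root : (C + x ^ 2 * E) ^ 2 = Delta M a x * K

theorem pos_of_ne_zero {β : EReal} {f : ℝ → ℝ} (hf : ∀ s ∈ upTo 0 β, ContinuousAt f s)
    (hne : ∀ s ∈ upTo 0 β, f s ≠ 0) (h0 : 0 < f 0) : ∀ s ∈ upTo 0 β, 0 < f s := by
  intro s hs
  by_contra h
  have hsub : Icc 0 s ⊆ upTo 0 β := fun t ht =>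
    ⟨ht.1, lt_of_le_of_lt (EReal.coe_le_coe_iff.2 ht.2) hs.2⟩
  obtain ⟨t, ht, h0⟩ := intermediate_value_Icc' hs.1
    (fun t ht => (hf t (hsub ht)).continuousWithinAt) ⟨not_lt.1 h, h0.le⟩
  exact hne t (hsub ht) h0

section

variable {M a E C K : ℝ}

/-- Splitting off the double root from the quartic polynomial `P² - Δ K`. -/
theorem radial_eq_sq_mul (ha : 0 ≤ a) (haM : a < M) {x : ℝ} (hx : rPlus M a < x)
    (hcrit : (C + x ^ 2 * E) * (x - M) = 2 * x * Delta M a x * E)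
    (hroot : (C + x ^ 2 * E) ^ 2 = Delta M a x * K) (ρ : ℝ) :
    (C + ρ ^ 2 * E) ^ 2 - Delta M a ρ * K =
      E ^ 2 * (ρ - x) ^ 2 * ((ρ + x) ^ 2 - 4 * M * x * Delta M a x / (x - M) ^ 2) := by
  have hxM : x - M ≠ 0 := by have := rPlus_sub_pos ha haM; linarith
  have hD := (Delta_pos ha haM hx).ne'
  have hC : C = 2 * x * Delta M a x * E / (x - M) - x ^ 2 * E := by
    field_simp; linarith
  have hK : K = 4 * x ^ 2 * Delta M a x * E ^ 2 / (x - M) ^ 2 := by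
    have hP : C + x ^ 2 * E = 2 * x * Delta M a x * E / (x - M) := by
      rw [eq_div_iff hxM]; exact hcrit
    rw [hP] at hroot
    refine mul_left_cancel₀ hD (hroot.symm.trans ?_)
    field_simp
    ring
  rw [hK, hC]
  field_simp
  simp only [Delta]
  ring

/-- The double root is the only root outside the horizon, and it is a minimum of the quartic: the
equilibrium is unstable. -/
theorem factor_pos (ha : 0 ≤ a) (haM : a < M) {x ρ : ℝ} (hx : rPlus M a < x)
    (hρ : rPlus M a < ρ) : 0 < (ρ + x) ^ 2 - 4 * M * x * Delta M a x / (x - M) ^ 2 := by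
  have h1 := rPlus_sub_pos ha haM
  have h2 := mu_pos ha haM
  have hM : 0 < M := by linarith
  have h3 : Delta M a x / (x - M) ^ 2 ≤ 1 := by
    rw [div_le_one (by nlinarith)]
    simp only [Delta]; nlinarith
  have h4 : 4 * M * x * Delta M a x / (x - M) ^ 2 ≤ 4 * M * x := by
    rw [mul_div_assoc]
    have : 0 < 4 * M * x := by nlinarith
    nlinarith
  nlinarith [sq_nonneg (x - M)]

theorem factor_le (ha : 0 ≤ a) (haM : a < M) {x ρ : ℝ} (hx : rPlus M a < x) :
    (ρ + x) ^ 2 - 4 * M * x * Delta M a x / (x - M) ^ 2 ≤ (ρ + x) ^ 2 := by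
  have h1 := rPlus_sub_pos ha haM
  have hM : 0 < M := by linarith
  have : 0 ≤ 4 * M * x * Delta M a x / (x - M) ^ 2 := by
    have := Delta_pos ha haM hx
    have : 0 < x := by linarith
    positivity
  linarith

theorem add_sq_mul_anti (hE : E ≤ 0) {ρ ρ' : ℝ} (h0 : 0 ≤ ρ) (h : ρ ≤ ρ') :
    C + ρ' ^ 2 * E ≤ C + ρ ^ 2 * E := by
  have : ρ ^ 2 ≤ ρ' ^ 2 := by gcongr
  nlinarith

theorem critPoly_eq (ρ : ℝ) : critPoly M a E C ρ =
    E * (ρ - M) ^ 3 - (C + E * (M ^ 2 + 2 * (M ^ 2 - a ^ 2))) * (ρ - M)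
      - 2 * M * (M ^ 2 - a ^ 2) * E := by
  simp only [critPoly, Delta]; ring

theorem critPoly_neg_of_nonpos (ha : 0 ≤ a) (haM : a < M) (hE : E ≤ 0) {ρ : ℝ}
    (hρ : rPlus M a < ρ) (hP : 0 < C + ρ ^ 2 * E) : critPoly M a E C ρ < 0 := by
  have h1 := rPlus_sub_pos ha haM
  have h2 := Delta_pos ha haM hρ
  have h3 : 0 < (ρ - M) * (C + ρ ^ 2 * E) := mul_pos (by linarith) hP
  have h4 : 0 ≤ ρ * Delta M a ρ := mul_nonneg (by linarith) h2.le
  simp only [critPoly]; nlinarith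

theorem critPoly_pos_of_nonpos (ha : 0 ≤ a) (haM : a < M) (hE : 0 < E)
    (hC : C + rPlus M a ^ 2 * E ≤ 0) {ρ : ℝ} (hρ : rPlus M a < ρ) : 0 < critPoly M a E C ρ := by
  have h1 := rPlus_sub_pos ha haM
  have h2 := rMinus_lt_rPlus ha haM
  have h3 := rPlus_add_rMinus (M := M) (a := a)
  have h4 := rMinus_nonneg ha haM
  have h5 : critPoly M a E C ρ = E * (ρ - rPlus M a) * (2 * ρ * (ρ - rMinus M a)
      - (ρ - M) * (ρ + rPlus M a)) - (ρ - M) * (C + rPlus M a ^ 2 * E) := by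
    rw [critPoly, Delta_eq_mul ha haM]; ring
  have h6 : 0 < 2 * ρ * (ρ - rMinus M a) - (ρ - M) * (ρ + rPlus M a) := by nlinarith
  have h7 : 0 < E * (ρ - rPlus M a) * (2 * ρ * (ρ - rMinus M a) - (ρ - M) * (ρ + rPlus M a)) :=
    mul_pos (mul_pos hE (by linarith)) h6
  have h8 : (ρ - M) * (C + rPlus M a ^ 2 * E) ≤ 0 :=
    mul_nonpos_of_nonneg_of_nonpos (by linarith) hC
  linarith

/-- `P² / Δ` has a unique critical point outside the horizon when `E > 0` and `P` is positive on
the horizon, and it is a minimum. -/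
theorem exists_critPoly_root (ha : 0 ≤ a) (haM : a < M) (hE : 0 < E)
    (hC : 0 < C + rPlus M a ^ 2 * E) : ∃ x, rPlus M a < x ∧ critPoly M a E C x = 0 ∧
      (∀ ρ, rPlus M a < ρ → ρ < x → critPoly M a E C ρ < 0) ∧
      ∀ ρ, x < ρ → 0 < critPoly M a E C ρ := by
  have h1 := rPlus_sub_pos ha haM
  have h2 := mu_pos ha haM
  have hM : 0 < M := by linarith
  set m := M ^ 2 - a ^ 2 with hm
  set c := C + E * (M ^ 2 + 2 * m) with hc
  have hform : ∀ ρ, critPoly M a E C ρ = E * (ρ - M) ^ 3 - c * (ρ - M) - 2 * M * m * E :=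
    critPoly_eq
  have hr : critPoly M a E C (rPlus M a) < 0 := by
    rw [critPoly, Delta_rPlus ha haM]
    have := mul_pos h1 hC
    linarith
  set y := 1 + (|c| + 2 * M * m * E) / E + (rPlus M a - M) with hy
  have hq : 0 ≤ (|c| + 2 * M * m * E) / E := by positivity
  have hqE : E * ((|c| + 2 * M * m * E) / E) = |c| + 2 * M * m * E := by field_simp
  have hbig : 0 < critPoly M a E C (y + M) := by
    rw [hform, add_sub_cancel_right]
    have hy1 : 1 ≤ y := by linarith
    have e1 : |c| + 2 * M * m * E + E ≤ E * y := by nlinarith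
    have e2 : E * y ≤ E * y ^ 2 := mul_le_mul_of_nonneg_left (by nlinarith) hE.le
    have e3 : c ≤ |c| := le_abs_self c
    have e4 : 0 ≤ 2 * M * m * E := by positivity
    have e5 : E * y ^ 3 = y * (E * y ^ 2) := by ring
    nlinarith
  have hcont : ContinuousOn (critPoly M a E C) (Icc (rPlus M a) (y + M)) := by
    unfold critPoly Delta; fun_prop
  obtain ⟨x, hx, hx0⟩ := intermediate_value_Icc (by linarith : rPlus M a ≤ y + M) hcont
    ⟨hr.le, hbig.le⟩
  have hxr : rPlus M a < x := lt_of_le_of_ne hx.1 fun h => by rw [← h] at hx0; linarith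
  have hkey : ∀ ρ, critPoly M a E C ρ * (x - M) = E * (ρ - x) *
      ((ρ - M) * (x - M) * ((ρ - M) + (x - M)) + 2 * M * m) := by
    intro ρ
    have := hform x
    rw [hx0] at this
    rw [hform ρ]
    linear_combination -(ρ - M) * this
  have hxM : 0 < x - M := by linarith
  refine ⟨x, hxr, hx0, fun ρ h h' => ?_, fun ρ h => ?_⟩
  · have hρM : 0 < ρ - M := by linarith
    have e : 0 < E * (x - ρ) * ((ρ - M) * (x - M) * ((ρ - M) + (x - M)) + 2 * M * m) := by
      have : 0 < x - ρ := by linarith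
      positivity
    have := hkey ρ
    nlinarith
  · have hρM : 0 < ρ - M := by linarith
    have e : 0 < E * (ρ - x) * ((ρ - M) * (x - M) * ((ρ - M) + (x - M)) + 2 * M * m) := by
      have : 0 < ρ - x := by linarith
      positivity
    have := hkey ρ
    nlinarith

namespace RadialOrbit

variable {β : EReal} {r u S : ℝ → ℝ}

theorem zero_mem (h : RadialOrbit M a E C K β r u S) : (0 : ℝ) ∈ upTo 0 β := ⟨le_rfl, h.pos⟩

theorem P_pos (ha : 0 ≤ a) (haM : a < M) (h : RadialOrbit M a E C K β r u S) :
    ∀ s ∈ upTo 0 β, 0 < C + r s ^ 2 * E := by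
  rcases h.K_nonneg.eq_or_lt with hK | hK
  · obtain ⟨h1, h2⟩ := h.of_K_eq_zero hK.symm
    intro s hs
    have : 0 < r s := (rPlus_pos ha haM).trans (h.gt s hs)
    positivity
  · refine pos_of_ne_zero (fun s hs => ?_) (fun s hs h0 => ?_) h.init_pos
    · have := (h.deriv_r s hs).continuousAt
      fun_prop
    · have h1 := h.u_sq s hs
      have h2 := mul_pos (Delta_pos ha haM (h.gt s hs)) hK
      rw [h0] at h1
      nlinarith [sq_nonneg (u s)]

theorem S_pos (ha : 0 ≤ a) (haM : a < M) (h : RadialOrbit M a E C K β r u S) {s : ℝ}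
    (hs : s ∈ upTo 0 β) : 0 < S s := by
  have : 0 < r s := (rPlus_pos ha haM).trans (h.gt s hs)
  exact lt_of_lt_of_le (by positivity) (h.S_ge s hs)

/-- Near a double root the radial motion is slow: `|r'|` is at most a multiple of `|r - x|`, so a
geodesic that is at the double root at one time has always been there. -/
theorem eq_iff_of_isDoubleRoot (ha : 0 ≤ a) (haM : a < M)
    (h : RadialOrbit M a E C K β r u S) {x : ℝ} (hx : IsDoubleRoot M a E C K x) {s : ℝ}
    (hs : s ∈ upTo 0 β) : r s = x ↔ r 0 = x := by
  have hp := rPlus_pos ha haM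
  have hbound : ∀ t ∈ upTo 0 β, ‖u t / S t‖ ≤
      E * (1 / rPlus M a + x / rPlus M a ^ 2) * ‖r t - x‖ := by
    intro t ht
    have hr := h.gt t ht
    have hr0 : 0 < r t := hp.trans hr
    have hx0 : 0 < x := hp.trans hx.gt
    have h1 : |u t| ≤ E * |r t - x| * (r t + x) := by
      have h0 : 0 ≤ E * |r t - x| * (r t + x) :=
        mul_nonneg (mul_nonneg hx.E_pos.le (abs_nonneg _)) (by linarith)
      refine abs_le_of_sq_le_sq ?_ h0
      rw [h.u_sq t ht, radial_eq_sq_mul ha haM hx.gt hx.crit hx.root, mul_pow, mul_pow, sq_abs]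
      exact mul_le_mul_of_nonneg_left (factor_le ha haM hx.gt) (by positivity)
    rw [norm_div, Real.norm_eq_abs, Real.norm_eq_abs, Real.norm_eq_abs,
      abs_of_pos (h.S_pos ha haM ht), div_le_iff₀ (h.S_pos ha haM ht)]
    have h2 : r t + x ≤ (1 / rPlus M a + x / rPlus M a ^ 2) * r t ^ 2 := by
      have e1 : r t ≤ 1 / rPlus M a * r t ^ 2 := by
        rw [one_div, inv_mul_eq_div, le_div_iff₀ hp]; nlinarith
      have e2 : x ≤ x / rPlus M a ^ 2 * r t ^ 2 := by
        rw [div_mul_eq_mul_div, le_div_iff₀ (by positivity)]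
        exact mul_le_mul_of_nonneg_left (by nlinarith) hx0.le
      linarith
    calc |u t| ≤ E * |r t - x| * (r t + x) := h1
      _ ≤ E * |r t - x| * ((1 / rPlus M a + x / rPlus M a ^ 2) * S t) := by
        refine mul_le_mul_of_nonneg_left (h2.trans ?_)
          (mul_nonneg hx.E_pos.le (abs_nonneg _))
        exact mul_le_mul_of_nonneg_left (h.S_ge t ht) (by positivity)
      _ = _ := by ring
  have hsub : Icc 0 s ⊆ upTo 0 β := fun t ht =>
    ⟨ht.1, lt_of_le_of_lt (EReal.coe_le_coe_iff.2 ht.2) hs.2⟩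
  constructor
  · intro hsx
    -- Grönwall's inequality for the reversed motion
    have hrev : ∀ t ∈ Icc 0 s, s - t ∈ Icc 0 s := fun t ht =>
      ⟨by linarith [ht.2], by linarith [ht.1]⟩
    have hd : ∀ t ∈ Icc 0 s, HasDerivAt (fun t => r (s - t) - x) (-(u (s - t) / S (s - t))) t := by
      intro t ht
      have h1 := h.deriv_r _ (hsub (hrev t ht))
      have h2 : HasDerivAt (fun t => s - t) (-1) t := (hasDerivAt_id t).const_sub s
      exact ((h1.comp t h2).sub_const x).congr_deriv (by ring)
    have := eq_zero_of_abs_deriv_le_mul_abs_self_of_eq_zero_right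
      (f := fun t => r (s - t) - x) (a := 0) (b := s)
      (fun t ht => (hd t ht).continuousAt.continuousWithinAt)
      (fun t ht => (hd t (Ico_subset_Icc_self ht)).hasDerivWithinAt) (by simp [hsx])
      (fun t ht => by
        rw [norm_neg]; exact hbound _ (hsub (hrev t (Ico_subset_Icc_self ht)))) s ⟨hs.1, le_rfl⟩
    simp only [sub_self] at this
    linarith
  · intro h0
    have hd : ∀ t ∈ Icc 0 s, HasDerivAt (fun t => r t - x) (u t / S t) t := fun t ht =>
      (h.deriv_r t (hsub ht)).sub_const x
    have := eq_zero_of_abs_deriv_le_mul_abs_self_of_eq_zero_right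
      (f := fun t => r t - x) (a := 0) (b := s)
      (fun t ht => (hd t ht).continuousAt.continuousWithinAt)
      (fun t ht => (hd t (Ico_subset_Icc_self ht)).hasDerivWithinAt) (by simp [h0])
      (fun t ht => hbound _ (hsub (Ico_subset_Icc_self ht))) s ⟨hs.1, le_rfl⟩
    linarith

theorem continuousAt_r (h : RadialOrbit M a E C K β r u S) {s : ℝ} (hs : s ∈ upTo 0 β) :
    ContinuousAt r s := (h.deriv_r s hs).continuousAt

theorem mono_of_u_nonneg (ha : 0 ≤ a) (haM : a < M) (h : RadialOrbit M a E C K β r u S) {s₁ : ℝ}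
    (hs₁ : 0 ≤ s₁) (hu : ∀ s ∈ upTo s₁ β, 0 ≤ u s) : MonotoneOn r (upTo s₁ β) :=
  monotoneOn_upTo (fun s hs => h.deriv_r s ⟨hs₁.trans hs.1, hs.2⟩) fun s hs =>
    div_nonneg (hu s hs) (h.S_pos ha haM ⟨hs₁.trans hs.1, hs.2⟩).le

theorem anti_of_u_nonpos (ha : 0 ≤ a) (haM : a < M) (h : RadialOrbit M a E C K β r u S) {s₁ : ℝ}
    (hs₁ : 0 ≤ s₁) (hu : ∀ s ∈ upTo s₁ β, u s ≤ 0) : AntitoneOn r (upTo s₁ β) := by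
  have := monotoneOn_upTo (f := fun s => -r s) (f' := fun s => -(u s / S s))
    (fun s hs => (h.deriv_r s ⟨hs₁.trans hs.1, hs.2⟩).neg) (s₁ := s₁) (β := β) fun s hs => by
      rw [← neg_div]
      exact div_nonneg (by linarith [hu s hs]) (h.S_pos ha haM ⟨hs₁.trans hs.1, hs.2⟩).le
  exact fun s hs t ht hst => neg_le_neg_iff.1 (this hs ht hst)

theorem u_ne_zero (ha : 0 ≤ a) (haM : a < M) (h : RadialOrbit M a E C K β r u S) {x : ℝ}
    (hx : IsDoubleRoot M a E C K x) (h0 : r 0 ≠ x) {s : ℝ} (hs : s ∈ upTo 0 β) : u s ≠ 0 := by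
  intro hu
  have h1 := h.u_sq s hs
  rw [radial_eq_sq_mul ha haM hx.gt hx.crit hx.root, hu] at h1
  have h2 := factor_pos ha haM hx.gt (h.gt s hs)
  have h3 := hx.E_pos
  have h4 : r s - x ≠ 0 := fun h4 =>
    h0 ((h.eq_iff_of_isDoubleRoot ha haM hx hs).1 (by linarith))
  have : 0 < E ^ 2 * (r s - x) ^ 2 * ((r s + x) ^ 2 - 4 * M * x * Delta M a x / (x - M) ^ 2) := by
    positivity
  rw [zero_pow two_ne_zero] at h1
  linarith

/-- A geodesic moving towards a double root of the radial potential never gets past it. -/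
theorem bounded_of_trapped (ha : 0 ≤ a) (haM : a < M) (h : RadialOrbit M a E C K β r u S) {x : ℝ}
    (hx : IsDoubleRoot M a E C K x) (hux : 0 ≤ (x - r 0) * u 0) :
    ∃ ρ₁ ρ₂, rPlus M a < ρ₁ ∧ ∀ s ∈ upTo 0 β, ρ₁ ≤ r s ∧ r s ≤ ρ₂ := by
  rcases lt_trichotomy (r 0) x with h0 | h0 | h0
  · have hu0 : 0 < u 0 := lt_of_le_of_ne
      (nonneg_of_mul_nonneg_right hux (by linarith))
      (h.u_ne_zero ha haM hx h0.ne h.zero_mem).symm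
    have hu := pos_of_ne_zero (fun s hs => (h.deriv_u s hs).continuousAt)
      (fun s hs => h.u_ne_zero ha haM hx h0.ne hs) hu0
    have hlt := pos_of_ne_zero (f := fun s => x - r s)
      (fun s hs => continuousAt_const.sub (h.continuousAt_r hs))
      (fun s hs h1 => h0.ne ((h.eq_iff_of_isDoubleRoot ha haM hx hs).1 (by linarith)))
      (by linarith)
    refine ⟨r 0, x, h.gt 0 h.zero_mem, fun s hs => ⟨?_, by linarith [hlt s hs]⟩⟩
    exact h.mono_of_u_nonneg ha haM le_rfl (fun s hs => (hu s hs).le) h.zero_mem hs hs.1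
  · refine ⟨x, x, hx.gt, fun s hs => ?_⟩
    rw [(h.eq_iff_of_isDoubleRoot ha haM hx hs).2 h0]
    exact ⟨le_rfl, le_rfl⟩
  · have hu0 : 0 < -u 0 := lt_of_le_of_ne
      (nonneg_of_mul_nonneg_right (by linarith : 0 ≤ (r 0 - x) * -u 0) (by linarith))
      (neg_ne_zero.2 (h.u_ne_zero ha haM hx h0.ne' h.zero_mem)).symm
    have hu := pos_of_ne_zero (f := fun s => -u s) (fun s hs => (h.deriv_u s hs).continuousAt.neg)
      (fun s hs => neg_ne_zero.2 (h.u_ne_zero ha haM hx h0.ne' hs)) hu0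
    have hlt := pos_of_ne_zero (f := fun s => r s - x)
      (fun s hs => (h.continuousAt_r hs).sub continuousAt_const)
      (fun s hs h1 => h0.ne' ((h.eq_iff_of_isDoubleRoot ha haM hx hs).1 (by linarith)))
      (by linarith)
    refine ⟨x, r 0, hx.gt, fun s hs => ⟨by linarith [hlt s hs], ?_⟩⟩
    exact h.anti_of_u_nonpos ha haM le_rfl (fun s hs => by linarith [hu s hs]) h.zero_mem hs hs.1

/-- The variable `u / √Δ`, whose square is `P² / Δ - K`, changes at the rate
`P (2 r E Δ - (r - M) P) / (Σ Δ^{3/2})`. -/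
theorem deriv_zeta (ha : 0 ≤ a) (haM : a < M) (h : RadialOrbit M a E C K β r u S) {s : ℝ}
    (hs : s ∈ upTo 0 β) : HasDerivAt (fun s => u s / √(Delta M a (r s)))
      ((C + r s ^ 2 * E) * critPoly M a E C (r s) /
        (S s * (Delta M a (r s) * √(Delta M a (r s))))) s := by
  have hD := Delta_pos ha haM (h.gt s hs)
  have hS := h.S_pos ha haM hs
  have hr := h.deriv_r s hs
  have hDd : HasDerivAt (fun s => Delta M a (r s)) ((2 * (r s - M)) * (u s / S s)) s := by
    refine (((hr.pow 2).sub (hr.const_mul (2 * M))).add_const (a ^ 2)).congr_deriv ?_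
    norm_num; ring
  have hq := hDd.sqrt hD.ne'
  have hsq := Real.sq_sqrt hD.le
  have hsp := Real.sqrt_pos.2 hD
  refine ((h.deriv_u s hs).div hq hsp.ne').congr_deriv ?_
  have hu := h.u_sq s hs
  set q := √(Delta M a (r s))
  simp only [critPoly]
  rw [← hsq] at hu ⊢
  field_simp
  linear_combination -(r s - M) * hu

theorem bounds_Icc (h : RadialOrbit M a E C K β r u S) {s₁ : ℝ} (hs₁ : s₁ ∈ upTo 0 β) :
    ∃ ρ₁ ρ₂, rPlus M a < ρ₁ ∧ ∀ s ∈ Icc 0 s₁, ρ₁ ≤ r s ∧ r s ≤ ρ₂ := by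
  have hsub : Icc 0 s₁ ⊆ upTo 0 β := fun t ht =>
    ⟨ht.1, lt_of_le_of_lt (EReal.coe_le_coe_iff.2 ht.2) hs₁.2⟩
  have hc : ContinuousOn r (Icc 0 s₁) := fun t ht =>
    (h.continuousAt_r (hsub ht)).continuousWithinAt
  obtain ⟨t, ht, h1⟩ := isCompact_Icc.exists_isMinOn ⟨0, le_rfl, hs₁.1⟩ hc
  obtain ⟨t', ht', h2⟩ := isCompact_Icc.exists_isMaxOn ⟨0, le_rfl, hs₁.1⟩ hc
  exact ⟨r t, r t', h.gt t (hsub ht), fun s hs => ⟨h1 hs, h2 hs⟩⟩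

/-- Completeness: the geodesic can be continued as long as `r` stays in a compact subset of
`(r₊, ∞)`. -/
def Complete (M a : ℝ) (β : EReal) (r : ℝ → ℝ) : Prop :=
  ∀ ρ₁ ρ₂, rPlus M a < ρ₁ → (∀ s ∈ upTo 0 β, ρ₁ ≤ r s ∧ r s ≤ ρ₂) → β = ⊤

/-- If `u / √Δ` is bounded below by a positive constant, then `r` cannot stay bounded. -/
theorem tendsto_atTop (ha : 0 ≤ a) (haM : a < M) (h : RadialOrbit M a E C K β r u S)
    (hc : Complete M a β r) {s₁ ζ₁ : ℝ} (hs₁ : s₁ ∈ upTo 0 β) (hζ₁ : 0 < ζ₁)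
    (hζ : ∀ s ∈ upTo s₁ β, ζ₁ ≤ u s / √(Delta M a (r s))) : Tendsto r (toRightEnd β) atTop := by
  have hup : ∀ s ∈ upTo s₁ β, s ∈ upTo 0 β := fun s hs => ⟨hs₁.1.trans hs.1, hs.2⟩
  have hq : ∀ s ∈ upTo s₁ β, 0 < √(Delta M a (r s)) := fun s hs =>
    Real.sqrt_pos.2 (Delta_pos ha haM (h.gt s (hup s hs)))
  have hu : ∀ s ∈ upTo s₁ β, ζ₁ * √(Delta M a (r s)) ≤ u s := fun s hs =>
    (le_div_iff₀ (hq s hs)).1 (hζ s hs)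
  have hm := h.mono_of_u_nonneg ha haM hs₁.1 fun s hs =>
    (mul_pos hζ₁ (hq s hs)).le.trans (hu s hs)
  have hs₁' : s₁ ∈ upTo s₁ β := ⟨le_rfl, hs₁.2⟩
  refine Filter.tendsto_atTop.2 fun B => ?_
  by_cases hB : ∃ s ∈ upTo s₁ β, B ≤ r s
  · obtain ⟨s, hs, hB⟩ := hB
    filter_upwards [eventually_lt_toRightEnd h.pos hs.2] with t ht
    exact hB.trans (hm hs ⟨hs.1.trans ht.1, ht.2⟩ ht.1)
  · push Not at hB
    exfalso
    obtain ⟨ρ₁, ρ₂, h1, h2⟩ := h.bounds_Icc hs₁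
    have htop : β = ⊤ := by
      refine hc ρ₁ (max ρ₂ B) h1 fun s hs => ?_
      rcases le_total s s₁ with hle | hle
      · exact ⟨(h2 s ⟨hs.1, hle⟩).1, (h2 s ⟨hs.1, hle⟩).2.trans (le_max_left _ _)⟩
      · have hs' : s ∈ upTo s₁ β := ⟨hle, hs.2⟩
        exact ⟨(h2 s₁ ⟨hs₁.1, le_rfl⟩).1.trans (hm hs₁' hs' hle),
          (hB s hs').le.trans (le_max_right _ _)⟩
    subst htop
    have hB0 : 0 < B := ((rPlus_pos ha haM).trans (h.gt s₁ hs₁)).trans (hB s₁ hs₁')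
    obtain ⟨s, hs, hlt⟩ := exists_lt_of_deriv_ge
      (ε := ζ₁ * √(Delta M a (r s₁)) / (B ^ 2 + a ^ 2))
      (div_pos (mul_pos hζ₁ (hq s₁ hs₁')) (by positivity))
      (fun s (hs : s₁ ≤ s) => h.deriv_r s (hup s ⟨hs, EReal.coe_lt_top _⟩))
      (fun s hs => by
        have hs' : s ∈ upTo s₁ ⊤ := ⟨hs, EReal.coe_lt_top _⟩
        have hr0 := (rPlus_pos ha haM).trans (h.gt s (hup s hs'))
        have hrB := hB s hs'
        have e1 : √(Delta M a (r s₁)) ≤ √(Delta M a (r s)) := Real.sqrt_le_sqrt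
          (Delta_mono ha haM (h.gt s₁ hs₁).le (hm hs₁' hs' hs))
        have e2 := hu s hs'
        have e3 := h.S_le s (hup s hs')
        refine div_le_div₀ ?_ ?_ (h.S_pos ha haM (hup s hs')) ?_
        · exact (mul_pos hζ₁ (hq s hs')).le.trans e2
        · nlinarith
        · nlinarith) B
    exact lt_irrefl _ (hlt.trans (hB s ⟨hs, EReal.coe_lt_top _⟩))

/-- If `u / √Δ` is bounded above by a negative constant, then `r` decreases, and its limit cannot
be larger than `r₊`. -/
theorem tendsto_rPlus (ha : 0 ≤ a) (haM : a < M) (h : RadialOrbit M a E C K β r u S)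
    (hc : Complete M a β r) {s₁ ζ₁ : ℝ} (hs₁ : s₁ ∈ upTo 0 β) (hζ₁ : 0 < ζ₁)
    (hζ : ∀ s ∈ upTo s₁ β, u s / √(Delta M a (r s)) ≤ -ζ₁) :
    Tendsto r (toRightEnd β) (𝓝 (rPlus M a)) := by
  have hup : ∀ s ∈ upTo s₁ β, s ∈ upTo 0 β := fun s hs => ⟨hs₁.1.trans hs.1, hs.2⟩
  have hq : ∀ s ∈ upTo s₁ β, 0 < √(Delta M a (r s)) := fun s hs =>
    Real.sqrt_pos.2 (Delta_pos ha haM (h.gt s (hup s hs)))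
  have hu : ∀ s ∈ upTo s₁ β, ζ₁ * √(Delta M a (r s)) ≤ -u s := fun s hs => by
    have := (div_le_iff₀ (hq s hs)).1 (hζ s hs); linarith
  have hm := h.anti_of_u_nonpos ha haM hs₁.1 fun s hs => by
    have := (mul_pos hζ₁ (hq s hs)).le.trans (hu s hs); linarith
  have hs₁' : s₁ ∈ upTo s₁ β := ⟨le_rfl, hs₁.2⟩
  obtain ⟨l, hl, hle⟩ := MonotoneOn.exists_tendsto_toRightEnd h.pos hs₁.2 (f := fun s => -r s)
    (fun s hs t ht hst => neg_le_neg (hm hs ht hst))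
    ⟨-rPlus M a, by
      rintro _ ⟨s, hs, rfl⟩
      have := h.gt s (hup s hs)
      dsimp only; linarith⟩
  have hl' : Tendsto r (toRightEnd β) (𝓝 (-l)) := by simpa using hl.neg
  have : (toRightEnd β).NeBot := toRightEnd_neBot h.pos
  have hge : rPlus M a ≤ -l := ge_of_tendsto hl' (by
    filter_upwards [eventually_lt_toRightEnd h.pos hs₁.2] with t ht
    exact (h.gt t (hup t ht)).le)
  rcases hge.eq_or_lt with hEq | hlt
  · rwa [hEq]
  · exfalso
    obtain ⟨ρ₁, ρ₂, h1, h2⟩ := h.bounds_Icc hs₁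
    have htop : β = ⊤ := by
      refine hc (min ρ₁ (-l)) ρ₂ (lt_min h1 hlt) fun s hs => ?_
      rcases le_total s s₁ with hle' | hle'
      · exact ⟨(min_le_left _ _).trans (h2 s ⟨hs.1, hle'⟩).1, (h2 s ⟨hs.1, hle'⟩).2⟩
      · have hs' : s ∈ upTo s₁ β := ⟨hle', hs.2⟩
        exact ⟨(min_le_right _ _).trans (by linarith [hle s hs']),
          (hm hs₁' hs' hle').trans (h2 s₁ ⟨hs₁.1, le_rfl⟩).2⟩
    subst htop
    obtain ⟨s, hs, hlt'⟩ := exists_lt_of_deriv_ge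
      (ε := ζ₁ * √(Delta M a (-l)) / (r s₁ ^ 2 + a ^ 2))
      (div_pos (mul_pos hζ₁ (Real.sqrt_pos.2 (Delta_pos ha haM hlt)))
        (by have := (rPlus_pos ha haM).trans (h.gt s₁ hs₁); positivity))
      (fun s (hs : s₁ ≤ s) => (h.deriv_r s (hup s ⟨hs, EReal.coe_lt_top _⟩)).neg)
      (fun s hs => by
        have hs' : s ∈ upTo s₁ ⊤ := ⟨hs, EReal.coe_lt_top _⟩
        have hr0 := (rPlus_pos ha haM).trans (h.gt s (hup s hs'))
        have hrB := hm hs₁' hs' hs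
        have e1 : √(Delta M a (-l)) ≤ √(Delta M a (r s)) := Real.sqrt_le_sqrt
          (Delta_mono ha haM hge (by linarith [hle s hs']))
        have e2 := hu s hs'
        have e3 := h.S_le s (hup s hs')
        rw [← neg_div]
        refine div_le_div₀ ?_ ?_ (h.S_pos ha haM (hup s hs')) ?_
        · exact (mul_pos hζ₁ (hq s hs')).le.trans e2
        · nlinarith
        · nlinarith) l
    exact lt_irrefl _ (hlt'.trans_le (hle s ⟨hs, EReal.coe_lt_top _⟩))

/-- If `P² / Δ` is strictly monotone along the motion, then `u / √Δ` acquires the corresponding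
sign `σ`, after at most one turning point: otherwise the motion would be confined to a compact
interval, on which `u / √Δ` changes at a rate bounded away from zero. -/
theorem exists_zeta_sign (ha : 0 ≤ a) (haM : a < M) (h : RadialOrbit M a E C K β r u S)
    (hc : Complete M a β r) (hK : 0 < K) (σ : ℝ) {ρ₁ ρ₂ : ℝ} (hρ₁ : rPlus M a < ρ₁)
    (hN : ∀ s ∈ upTo 0 β, 0 < σ * critPoly M a E C (r s))
    (hstay : (∀ s ∈ upTo 0 β, σ * u s ≤ 0) → ∀ s ∈ upTo 0 β, ρ₁ ≤ r s ∧ r s ≤ ρ₂)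
    (hcpt : ∀ ρ ∈ Icc ρ₁ ρ₂, 0 < C + ρ ^ 2 * E → Delta M a ρ * K ≤ (C + ρ ^ 2 * E) ^ 2 →
      0 < σ * critPoly M a E C ρ) :
    ∃ s₁ ∈ upTo 0 β, ∃ ζ₁ > 0, ∀ s ∈ upTo s₁ β, ζ₁ ≤ σ * (u s / √(Delta M a (r s))) := by
  have hq : ∀ s ∈ upTo 0 β, 0 < √(Delta M a (r s)) := fun s hs =>
    Real.sqrt_pos.2 (Delta_pos ha haM (h.gt s hs))
  have hd := fun s (hs : s ∈ upTo 0 β) => (h.deriv_zeta ha haM hs).const_mul σ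
  have hm : MonotoneOn (fun s => σ * (u s / √(Delta M a (r s)))) (upTo 0 β) := by
    refine monotoneOn_upTo hd fun s hs => ?_
    have e1 := h.P_pos ha haM s hs
    have e2 := hN s hs
    have e3 := Delta_pos ha haM (h.gt s hs)
    have e4 := h.S_pos ha haM hs
    have e5 := hq s hs
    rw [← mul_div_assoc, mul_left_comm]
    positivity
  by_cases hex : ∃ s ∈ upTo 0 β, 0 < σ * (u s / √(Delta M a (r s)))
  · obtain ⟨s₁, hs₁, hpos⟩ := hex
    exact ⟨s₁, hs₁, _, hpos, fun s hs => hm hs₁ ⟨hs₁.1.trans hs.1, hs.2⟩ hs.1⟩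
  · exfalso
    push Not at hex
    have hin := hstay fun s hs => by
      have := hex s hs
      rw [← mul_div_assoc, div_le_iff₀ (hq s hs), zero_mul] at this
      exact this
    have htop := hc ρ₁ ρ₂ hρ₁ hin
    subst htop
    -- the part of the interval accessible to the motion
    set A : Set ℝ := Icc ρ₁ ρ₂ ∩
      {ρ | 0 ≤ C + ρ ^ 2 * E ∧ Delta M a ρ * K ≤ (C + ρ ^ 2 * E) ^ 2} with hA
    have hAc : IsCompact A := by
      have c1 : Continuous fun ρ : ℝ => C + ρ ^ 2 * E := by fun_prop
      have c2 : Continuous fun ρ : ℝ => Delta M a ρ * K := by unfold Delta; fun_prop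
      exact isCompact_Icc.inter_right
        ((isClosed_le continuous_const c1).inter (isClosed_le c2 (c1.pow 2)))
    have hAr : ∀ s ∈ upTo 0 ⊤, r s ∈ A := fun s hs =>
      ⟨hin s hs, (h.P_pos ha haM s hs).le, by nlinarith [h.u_sq s hs, sq_nonneg (u s)]⟩
    obtain ⟨ρ₀, hρ₀, hmin⟩ := hAc.exists_isMinOn ⟨_, hAr 0 h.zero_mem⟩
      (f := fun ρ => (C + ρ ^ 2 * E) * (σ * critPoly M a E C ρ))
      (by unfold critPoly Delta; fun_prop)
    have hPpos : 0 < C + ρ₀ ^ 2 * E := by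
      have h1 := mul_pos (Delta_pos ha haM (hρ₁.trans_le hρ₀.1.1)) hK
      refine lt_of_le_of_ne hρ₀.2.1 fun h0 => ?_
      have := hρ₀.2.2
      rw [← h0] at this
      norm_num at this
      linarith
    have hn0 : 0 < (C + ρ₀ ^ 2 * E) * (σ * critPoly M a E C ρ₀) :=
      mul_pos hPpos (hcpt ρ₀ hρ₀.1 hPpos hρ₀.2.2)
    have hρ₂ : rPlus M a < ρ₂ := hρ₁.trans_le (hρ₀.1.1.trans hρ₀.1.2)
    have hD2 := Delta_pos ha haM hρ₂
    have hp := rPlus_pos ha haM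
    have hρ₂0 : 0 < ρ₂ := hp.trans hρ₂
    obtain ⟨s, hs, hlt⟩ := exists_lt_of_deriv_ge
      (ε := (C + ρ₀ ^ 2 * E) * (σ * critPoly M a E C ρ₀) /
        ((ρ₂ ^ 2 + a ^ 2) * (Delta M a ρ₂ * √(Delta M a ρ₂))))
      (div_pos hn0 (by have := Real.sqrt_pos.2 hD2; positivity))
      (fun s (hs : 0 ≤ s) => hd s ⟨hs, EReal.coe_lt_top _⟩)
      (fun s hs => by
        have hs' : s ∈ upTo 0 ⊤ := ⟨hs, EReal.coe_lt_top _⟩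
        have e0 := hin s hs'
        have hr0 := hp.trans (h.gt s hs')
        have e1 : (C + ρ₀ ^ 2 * E) * (σ * critPoly M a E C ρ₀) ≤
            σ * ((C + r s ^ 2 * E) * critPoly M a E C (r s)) :=
          (hmin (hAr s hs')).trans_eq (by ring)
        have e2 := Delta_mono ha haM (h.gt s hs').le e0.2
        have e3 := Delta_pos ha haM (h.gt s hs')
        have e4 := h.S_pos ha haM hs'
        have e5 : S s ≤ ρ₂ ^ 2 + a ^ 2 := (h.S_le s hs').trans (by nlinarith)
        have e6 := hq s hs'
        rw [← mul_div_assoc]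
        refine div_le_div₀ (hn0.le.trans e1) e1 (by positivity) ?_
        have e7 := Real.sqrt_le_sqrt e2
        gcongr) 0
    exact absurd (hex s ⟨hs, EReal.coe_lt_top _⟩) (not_le.2 hlt)

/-- The future of a geodesic that is not trapped: it falls into the horizon or escapes. -/
theorem horizon_or_infinity (ha : 0 ≤ a) (haM : a < M) (h : RadialOrbit M a E C K β r u S)
    (hc : Complete M a β r)
    (hnt : ∀ x, IsDoubleRoot M a E C K x → (x - r 0) * u 0 < 0) :
    (0 < C + rPlus M a ^ 2 * E ∧ Tendsto r (toRightEnd β) (𝓝 (rPlus M a)) ∧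
        ∃ s₁ ∈ upTo 0 β, ∀ s ∈ upTo s₁ β, u s < 0) ∨
      (0 < E ∧ Tendsto r (toRightEnd β) atTop ∧ ∃ s₁ ∈ upTo 0 β, ∀ s ∈ upTo s₁ β, 0 < u s) := by
  have hq : ∀ s ∈ upTo 0 β, 0 < √(Delta M a (r s)) := fun s hs =>
    Real.sqrt_pos.2 (Delta_pos ha haM (h.gt s hs))
  have hr0 := h.gt 0 h.zero_mem
  have hp := rPlus_pos ha haM
  have h1 := rPlus_sub_pos ha haM
  have hM : 0 < M := by linarith
  have key_in : 0 < C + rPlus M a ^ 2 * E → (∃ s₁ ∈ upTo 0 β, ∃ ζ₁ > 0, ∀ s ∈ upTo s₁ β,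
      ζ₁ ≤ (-1) * (u s / √(Delta M a (r s)))) →
      (0 < C + rPlus M a ^ 2 * E ∧ Tendsto r (toRightEnd β) (𝓝 (rPlus M a)) ∧
        ∃ s₁ ∈ upTo 0 β, ∀ s ∈ upTo s₁ β, u s < 0) := by
    rintro h1 ⟨s₁, hs₁, ζ₁, hζ₁, hζ⟩
    refine ⟨h1, h.tendsto_rPlus ha haM hc hs₁ hζ₁ fun s hs => by linarith [hζ s hs],
      s₁, hs₁, fun s hs => ?_⟩
    have h2 := hq s ⟨hs₁.1.trans hs.1, hs.2⟩
    have h3 : u s / √(Delta M a (r s)) < 0 := by linarith [hζ s hs]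
    have := (div_lt_iff₀ h2).1 h3
    linarith
  have key_out : 0 < E → (∃ s₁ ∈ upTo 0 β, ∃ ζ₁ > 0, ∀ s ∈ upTo s₁ β,
      ζ₁ ≤ 1 * (u s / √(Delta M a (r s)))) →
      (0 < E ∧ Tendsto r (toRightEnd β) atTop ∧ ∃ s₁ ∈ upTo 0 β, ∀ s ∈ upTo s₁ β, 0 < u s) := by
    rintro h1 ⟨s₁, hs₁, ζ₁, hζ₁, hζ⟩
    refine ⟨h1, h.tendsto_atTop ha haM hc hs₁ hζ₁ fun s hs => by linarith [hζ s hs],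
      s₁, hs₁, fun s hs => ?_⟩
    have h2 := hq s ⟨hs₁.1.trans hs.1, hs.2⟩
    have h3 : 0 < u s / √(Delta M a (r s)) := by linarith [hζ s hs]
    exact (div_pos_iff_of_pos_right h2).1 h3
  have hR : ∀ s ∈ upTo 0 β, Delta M a (r s) * K ≤ (C + r s ^ 2 * E) ^ 2 := fun s hs => by
    nlinarith [h.u_sq s hs, sq_nonneg (u s)]
  have hP := h.P_pos ha haM
  rcases le_or_gt E 0 with hE | hE
  · -- no radial barrier on the inside
    left
    have hK : 0 < K := lt_of_le_of_ne h.K_nonneg fun hK => by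
      have := (h.of_K_eq_zero hK.symm).1; linarith
    have hneg : ∀ ρ, rPlus M a < ρ → 0 < C + ρ ^ 2 * E → 0 < -1 * critPoly M a E C ρ :=
      fun ρ h1 h2 => by have := critPoly_neg_of_nonpos ha haM hE h1 h2; linarith
    refine key_in ((hP 0 h.zero_mem).trans_le (add_sq_mul_anti hE hp.le hr0.le)) ?_
    refine h.exists_zeta_sign ha haM hc hK (-1)
      (ρ₂ := M + 1 + (C + r 0 ^ 2 * E) ^ 2 / K + M ^ 2) hr0
      (fun s hs => hneg _ (h.gt s hs) (hP s hs)) (fun hu s hs => ?_)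
      (fun ρ hρ h1 _ => hneg ρ (hr0.trans_le hρ.1) h1)
    have hm := h.mono_of_u_nonneg ha haM le_rfl (fun s hs => by linarith [hu s hs])
      h.zero_mem hs hs.1
    refine ⟨hm, ?_⟩
    have e1 : C + r s ^ 2 * E ≤ C + r 0 ^ 2 * E := add_sq_mul_anti hE (hp.trans hr0).le hm
    have e2 : (C + r s ^ 2 * E) ^ 2 ≤ (C + r 0 ^ 2 * E) ^ 2 := by nlinarith [hP s hs]
    have e3 : Delta M a (r s) ≤ (C + r 0 ^ 2 * E) ^ 2 / K := by
      rw [le_div_iff₀ hK]; exact (hR s hs).trans e2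
    simp only [Delta] at e3
    nlinarith [sq_nonneg (r s - M - 1), sq_nonneg a]
  rcases le_or_gt (C + rPlus M a ^ 2 * E) 0 with hC | hC
  · -- no radial barrier on the outside
    right
    have hK : 0 < K := lt_of_le_of_ne h.K_nonneg fun hK => by
      have := (h.of_K_eq_zero hK.symm).2
      have : 0 < rPlus M a ^ 2 * E := by positivity
      linarith
    have hpos : ∀ ρ, rPlus M a < ρ → 0 < 1 * critPoly M a E C ρ := fun ρ h1 => by
      have := critPoly_pos_of_nonpos ha haM hE hC h1; linarith
    have hmp := rMinus_lt_rPlus ha haM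
    have hr00 : 0 < r 0 := hp.trans hr0
    set d := (rPlus M a - rMinus M a) * K / ((r 0 + rPlus M a) ^ 2 * E ^ 2) with hd
    have hd0 : 0 < d := div_pos (mul_pos (by linarith) hK) (by positivity)
    refine key_out hE (h.exists_zeta_sign ha haM hc hK 1 (ρ₁ := rPlus M a + d) (ρ₂ := r 0)
      (by linarith) (fun s hs => hpos _ (h.gt s hs)) (fun hu s hs => ?_)
      (fun ρ hρ _ _ => hpos ρ (by linarith [hρ.1])))
    have hm := h.anti_of_u_nonpos ha haM le_rfl (fun s hs => by linarith [hu s hs])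
      h.zero_mem hs hs.1
    refine ⟨?_, hm⟩
    -- `P` vanishes to first order at `r₊`, `P²` to second order and `Δ` only to first order
    have hrs := h.gt s hs
    set y := r s - rPlus M a with hy
    have hy0 : 0 < y := by linarith
    have e1 : C + r s ^ 2 * E ≤ y * (r s + rPlus M a) * E := by rw [hy]; nlinarith
    have e2 : y * (r s + rPlus M a) * E ≤ y * (r 0 + rPlus M a) * E := by
      gcongr
    have e3 : (C + r s ^ 2 * E) ^ 2 ≤ (y * (r 0 + rPlus M a) * E) ^ 2 :=
      pow_le_pow_left₀ (hP s hs).le (e1.trans e2) 2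
    have e4 : y * (rPlus M a - rMinus M a) * K ≤ Delta M a (r s) * K := by
      rw [Delta_eq_mul ha haM]
      gcongr
    have e5 : (rPlus M a - rMinus M a) * K ≤ y * ((r 0 + rPlus M a) ^ 2 * E ^ 2) := by
      have : y * ((rPlus M a - rMinus M a) * K) ≤ y * (y * ((r 0 + rPlus M a) ^ 2 * E ^ 2)) := by
        have := hR s hs
        nlinarith
      exact le_of_mul_le_mul_left this hy0
    have e6 : d ≤ y := by rwa [hd, div_le_iff₀ (by positivity)]
    linarith
  obtain ⟨x, hx, hx0, hxl, hxr⟩ := exists_critPoly_root ha haM hE hC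
  have hDx := Delta_pos ha haM hx
  have hPx : 0 < C + x ^ 2 * E := by
    have : rPlus M a ^ 2 ≤ x ^ 2 := by gcongr
    nlinarith
  have hcrit : (C + x ^ 2 * E) * (x - M) = 2 * x * Delta M a x * E := by
    simp only [critPoly] at hx0; linarith
  rcases lt_trichotomy (Delta M a x * K) ((C + x ^ 2 * E) ^ 2) with hlt | heq | hgt
  · -- no turning points at all
    set δ := (C + x ^ 2 * E) ^ 2 / Delta M a x - K with hδ
    have hδ0 : 0 < δ := by rw [hδ, sub_pos, lt_div_iff₀ hDx]; linarith
    have hu2 : ∀ s ∈ upTo 0 β, δ * Delta M a (r s) ≤ u s ^ 2 := by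
      intro s hs
      have e1 := radial_eq_sq_mul (K := K + δ) ha haM hx hcrit (by rw [hδ]; field_simp; ring) (r s)
      have e2 : 0 ≤ E ^ 2 * (r s - x) ^ 2 *
          ((r s + x) ^ 2 - 4 * M * x * Delta M a x / (x - M) ^ 2) :=
        mul_nonneg (by positivity) (factor_pos ha haM hx (h.gt s hs)).le
      have := h.u_sq s hs
      nlinarith
    have hne : ∀ s ∈ upTo 0 β, u s ≠ 0 := fun s hs h0 => by
      have := hu2 s hs
      have := mul_pos hδ0 (Delta_pos ha haM (h.gt s hs))
      rw [h0] at *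
      norm_num at *
      linarith
    have hsq : ∀ s ∈ upTo 0 β, √δ ≤ |u s| / √(Delta M a (r s)) := by
      intro s hs
      rw [le_div_iff₀ (hq s hs), ← Real.sqrt_mul hδ0.le, ← Real.sqrt_sq_eq_abs]
      exact Real.sqrt_le_sqrt (hu2 s hs)
    rcases lt_or_gt_of_ne (hne 0 h.zero_mem) with hu0 | hu0
    · left
      have hu := pos_of_ne_zero (f := fun s => -u s) (fun s hs => (h.deriv_u s hs).continuousAt.neg)
        (fun s hs => neg_ne_zero.2 (hne s hs)) (by linarith)
      refine key_in hC ⟨0, h.zero_mem, √δ, Real.sqrt_pos.2 hδ0, fun s hs => ?_⟩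
      have := hsq s hs
      rw [abs_of_neg (by linarith [hu s hs]), neg_div] at this
      linarith
    · right
      have hu := pos_of_ne_zero (fun s hs => (h.deriv_u s hs).continuousAt) hne hu0
      refine key_out hE ⟨0, h.zero_mem, √δ, Real.sqrt_pos.2 hδ0, fun s hs => ?_⟩
      have := hsq s hs
      rw [abs_of_pos (hu s hs)] at this
      linarith
  · -- a double root, but the motion is directed away from it
    have hroot : IsDoubleRoot M a E C K x := ⟨hx, hE, hcrit, heq.symm⟩
    have hneg := hnt x hroot
    have hd := fun s (hs : s ∈ upTo 0 β) => h.deriv_zeta ha haM hs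
    have hrate : ∀ s ∈ upTo 0 β, ∀ σ : ℝ, 0 < σ * critPoly M a E C (r s) →
        0 ≤ σ * ((C + r s ^ 2 * E) * critPoly M a E C (r s) /
        (S s * (Delta M a (r s) * √(Delta M a (r s))))) := by
      intro s hs σ hσ
      have e1 := hP s hs
      have e3 := Delta_pos ha haM (h.gt s hs)
      have e4 := h.S_pos ha haM hs
      have e5 := hq s hs
      rw [← mul_div_assoc, mul_left_comm]
      positivity
    rcases lt_trichotomy (r 0) x with h0 | h0 | h0
    · left
      have hu0 : u 0 < 0 := by by_contra hc; nlinarith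
      have hlt := pos_of_ne_zero (f := fun s => x - r s)
        (fun s hs => continuousAt_const.sub (h.continuousAt_r hs))
        (fun s hs h1 => h0.ne ((h.eq_iff_of_isDoubleRoot ha haM hroot hs).1 (by linarith)))
        (by linarith)
      have hm := monotoneOn_upTo (fun s hs => (hd s hs).const_mul (-1)) fun s hs =>
        hrate s hs (-1) (by
          have := hxl (r s) (h.gt s hs) (by linarith [hlt s hs]); linarith)
      refine key_in hC ⟨0, h.zero_mem, -1 * (u 0 / √(Delta M a (r 0))), ?_, fun s hs =>
        hm h.zero_mem hs hs.1⟩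
      have := div_neg_of_neg_of_pos hu0 (hq 0 h.zero_mem)
      linarith
    · rw [h0] at hneg; simp at hneg
    · right
      have hu0 : 0 < u 0 := by by_contra hc; nlinarith
      have hlt := pos_of_ne_zero (f := fun s => r s - x)
        (fun s hs => (h.continuousAt_r hs).sub continuousAt_const)
        (fun s hs h1 => h0.ne' ((h.eq_iff_of_isDoubleRoot ha haM hroot hs).1 (by linarith)))
        (by linarith)
      have hm := monotoneOn_upTo (fun s hs => (hd s hs).const_mul 1) fun s hs =>
        hrate s hs 1 (by
          have := hxr (r s) (by linarith [hlt s hs]); linarith)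
      refine key_out hE ⟨0, h.zero_mem, 1 * (u 0 / √(Delta M a (r 0))), ?_, fun s hs =>
        hm h.zero_mem hs hs.1⟩
      have := div_pos hu0 (hq 0 h.zero_mem)
      linarith
  · -- a barrier around `x`
    have hK : 0 < K := by
      by_contra hc
      nlinarith
    have hne : ∀ s ∈ upTo 0 β, r s ≠ x := fun s hs he => by
      have := hR s hs
      rw [he] at this
      linarith
    rcases lt_or_gt_of_ne (hne 0 h.zero_mem) with h0 | h0
    · left
      have hlt := pos_of_ne_zero (f := fun s => x - r s)
        (fun s hs => continuousAt_const.sub (h.continuousAt_r hs))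
        (fun s hs h1 => hne s hs (by linarith)) (by linarith)
      refine key_in hC (h.exists_zeta_sign ha haM hc hK (-1) (ρ₁ := r 0) (ρ₂ := x) hr0
        (fun s hs => ?_) (fun hu s hs => ⟨?_, by linarith [hlt s hs]⟩) fun ρ hρ _ h2 => ?_)
      · have := hxl (r s) (h.gt s hs) (by linarith [hlt s hs]); linarith
      · exact h.mono_of_u_nonneg ha haM le_rfl (fun s hs => by linarith [hu s hs])
          h.zero_mem hs hs.1
      · have hne' : ρ ≠ x := fun he => by rw [he] at h2; linarith
        have := hxl ρ (hr0.trans_le hρ.1) (lt_of_le_of_ne hρ.2 hne')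
        linarith
    · right
      have hlt := pos_of_ne_zero (f := fun s => r s - x)
        (fun s hs => (h.continuousAt_r hs).sub continuousAt_const)
        (fun s hs h1 => hne s hs (by linarith)) (by linarith)
      refine key_out hE (h.exists_zeta_sign ha haM hc hK 1 (ρ₁ := x) (ρ₂ := r 0) hx
        (fun s hs => ?_) (fun hu s hs => ⟨by linarith [hlt s hs], ?_⟩) fun ρ hρ _ h2 => ?_)
      · have := hxr (r s) (by linarith [hlt s hs]); linarith
      · exact h.anti_of_u_nonpos ha haM le_rfl (fun s hs => by linarith [hu s hs])
          h.zero_mem hs hs.1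
      · have hne' : ρ ≠ x := fun he => by rw [he] at h2; linarith
        have := hxr ρ (lt_of_le_of_ne hρ.1 hne'.symm)
        linarith

end RadialOrbit

end

/-! ### Null geodesics and their constants of motion -/

/-- A null geodesic with initial point `p` and initial velocity `w`, from the parameter `0` up to
`β`; the field `prinMom_pos` says that it is future directed. -/
structure IsNullGeodesic (M a : ℝ) (p w : Coord) (β : EReal) (γ v : ℝ → Coord) : Prop where
  pos : 0 < β
  geo : ∀ s ∈ upTo 0 β, GeodesicAt M a γ v s
  init : γ 0 = p
  init_vel : v 0 = w
  null : metric M a p w w = 0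
  prinMom_pos : 0 < prinMom M a p w

/-- `sin² θ`. -/
def sinSq (x : Coord) : ℝ := (x 1 ^ 2 + x 2 ^ 2) / rad x ^ 2

/-- `sin² θ ((r² + a²) dφ - a dt)`. -/
def omegaPhi (a : ℝ) (x v : Coord) : ℝ := Sig a x * sinSqDphi x v - a * sinSq x * omegaT a x v

section

variable {M a : ℝ} {x : Coord}

theorem sinSq_nonneg (x : Coord) : 0 ≤ sinSq x := by unfold sinSq; positivity

theorem sinSq_le_one (hx : 0 < rad x) : sinSq x ≤ 1 := by
  rw [sinSq, div_le_one (by positivity), rad_sq]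
  nlinarith [sq_nonneg (x 3)]

theorem Sig_eq (hx : 0 < rad x) : Sig a x = rad x ^ 2 + a ^ 2 - a ^ 2 * sinSq x := by
  have := Sig_add (a := a) hx
  simp only [sinSq]; linarith

theorem carter_eq (ha : 0 ≤ a) (haM : a < M) (hx : x ∈ exterior M a) {v : Coord}
    (hv : metric M a x v v = 0) : carter M a x v = Sig a x ^ 2 * sphereForm x v v
      - 2 * a * Sig a x * omegaT a x v * sinSqDphi x v + a ^ 2 * sinSq x * omegaT a x v ^ 2 := by
  have hr := rad_pos_of_mem ha haM hx
  have hD := (Delta_pos_of_mem ha haM hx).ne'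
  have hS := (Sig_pos (a := a) hr).ne'
  have hSe := Sig_eq (a := a) hr
  rw [metric_eq hr] at hv
  have h0 : v 0 = omegaT a x v + a * sinSqDphi x v := by simp only [omegaT]; ring
  have hDe : Delta M a (rad x) = rad x ^ 2 - 2 * M * rad x + a ^ 2 := rfl
  simp only [carter, prinMom, radMom]
  rw [h0] at hv
  field_simp at hv ⊢
  linear_combination -hv + (Delta M a (rad x) * omegaT a x v ^ 2) * hDe
    - (Delta M a (rad x) * omegaT a x v ^ 2) * hSe

/-- Cauchy-Schwarz on the sphere, by which `carter` bounds the angular motion. -/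
theorem omegaPhi_sq_le (ha : 0 ≤ a) (haM : a < M) (hx : x ∈ exterior M a) {v : Coord}
    (hv : metric M a x v v = 0) : omegaPhi a x v ^ 2 ≤ sinSq x * carter M a x v := by
  have hr := rad_pos_of_mem ha haM hx
  have h1 : sinSqDphi x v ^ 2 ≤ sinSq x * sphereForm x v v := sinSqDphi_sq_le hr v
  have h2 : Sig a x ^ 2 * sinSqDphi x v ^ 2 ≤ Sig a x ^ 2 * (sinSq x * sphereForm x v v) := by
    gcongr
  rw [carter_eq ha haM hx hv]
  simp only [omegaPhi]
  linarith

theorem carter_nonneg (ha : 0 ≤ a) (haM : a < M) (hx : x ∈ exterior M a) {v : Coord}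
    (hv : metric M a x v v = 0) : 0 ≤ carter M a x v := by
  have hr := rad_pos_of_mem ha haM hx
  rcases (sinSq_nonneg x).eq_or_lt with h | h
  · have h1 : sinSqDphi x v ^ 2 ≤ sinSq x * sphereForm x v v := sinSqDphi_sq_le hr v
    rw [← h, zero_mul] at h1
    have h2 : sinSqDphi x v = 0 := by nlinarith
    rw [carter_eq ha haM hx hv, ← h, h2]
    have := sphereForm_nonneg hr v
    have : 0 ≤ Sig a x ^ 2 * sphereForm x v v := by positivity
    linarith
  · have := (sq_nonneg _).trans (omegaPhi_sq_le ha haM hx hv)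
    exact nonneg_of_mul_nonneg_right this h

theorem abs_omegaPhi_le (ha : 0 ≤ a) (haM : a < M) (hx : x ∈ exterior M a) {v : Coord}
    (hv : metric M a x v v = 0) : |omegaPhi a x v| ≤ √(carter M a x v) := by
  have hr := rad_pos_of_mem ha haM hx
  refine Real.le_sqrt_of_sq_le ?_
  rw [sq_abs]
  refine (omegaPhi_sq_le ha haM hx hv).trans ?_
  have := sinSq_le_one hr
  have := carter_nonneg ha haM hx hv
  nlinarith

theorem Sig_mul_energy (hx : 0 < rad x) (v : Coord) :
    Sig a x * energy M a x v = prinMom M a x v + a * omegaPhi a x v := by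
  have hS := (Sig_pos (a := a) hx).ne'
  have hSe := Sig_eq (a := a) hx
  have h0 : v 0 = omegaT a x v + a * sinSqDphi x v := by simp only [omegaT]; ring
  simp only [energy, prinMom, omegaPhi, h0, Delta]
  field_simp
  linear_combination omegaT a x v * hSe

/-- A future directed null vector along a principal null direction has positive energy. -/
theorem energy_pos_of_carter_eq_zero (ha : 0 ≤ a) (haM : a < M) (hx : x ∈ exterior M a)
    {v : Coord} (hv : metric M a x v v = 0) (hP : 0 < prinMom M a x v)
    (hK : carter M a x v = 0) : 0 < energy M a x v ∧ 0 ≤ offset M a x v := by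
  have hr := rad_pos_of_mem ha haM hx
  have hS := Sig_pos (a := a) hr
  have h1 := omegaPhi_sq_le ha haM hx hv
  rw [hK, mul_zero] at h1
  have h2 : omegaPhi a x v = 0 := by nlinarith
  have h3 := Sig_mul_energy (M := M) (a := a) hr v
  rw [h2, mul_zero, add_zero] at h3
  have hE : 0 < energy M a x v := by
    refine pos_of_mul_pos_right ?_ hS.le
    rw [h3]; exact hP
  refine ⟨hE, ?_⟩
  simp only [offset]
  nlinarith [rad_sq_le_Sig (a := a) x]

theorem const_of_hasDerivAt_zero {β : EReal} (hβ : 0 < β) {f : ℝ → ℝ}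
    (hf : ∀ s ∈ upTo 0 β, HasDerivAt f 0 s) {s : ℝ} (hs : s ∈ upTo 0 β) : f s = f 0 := by
  have := (convex_upTo 0 β).norm_image_sub_le_of_norm_hasDerivWithin_le (C := 0)
    (fun x hx => (hf x hx).hasDerivWithinAt) (fun x _ => by simp) ⟨le_rfl, hβ⟩ hs
  rw [zero_mul] at this
  exact sub_eq_zero.1 (norm_le_zero_iff.1 this)

namespace IsNullGeodesic

variable {p w : Coord} {β : EReal} {γ v : ℝ → Coord}

theorem mem_exterior (h : IsNullGeodesic M a p w β γ v) : p ∈ exterior M a := by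
  have := (h.geo 0 ⟨le_rfl, h.pos⟩).mem
  rwa [h.init] at this

theorem metric_eq_zero (ha : 0 ≤ a) (haM : a < M) (h : IsNullGeodesic M a p w β γ v) {s : ℝ}
    (hs : s ∈ upTo 0 β) : metric M a (γ s) (v s) (v s) = 0 := by
  rw [const_of_hasDerivAt_zero h.pos (fun s hs => (h.geo s hs).hasDerivAt_metric_self ha haM) hs,
    h.init, h.init_vel, h.null]

theorem energy_eq (ha : 0 ≤ a) (haM : a < M) (h : IsNullGeodesic M a p w β γ v) {s : ℝ}
    (hs : s ∈ upTo 0 β) : energy M a (γ s) (v s) = energy M a p w := by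
  rw [const_of_hasDerivAt_zero h.pos (fun s hs => (h.geo s hs).hasDerivAt_energy ha haM) hs,
    h.init, h.init_vel]

theorem offset_eq (ha : 0 ≤ a) (haM : a < M) (h : IsNullGeodesic M a p w β γ v) {s : ℝ}
    (hs : s ∈ upTo 0 β) : offset M a (γ s) (v s) = offset M a p w := by
  rw [const_of_hasDerivAt_zero h.pos (fun s hs => (h.geo s hs).hasDerivAt_offset ha haM) hs,
    h.init, h.init_vel]

theorem hasDerivAt_carter (ha : 0 ≤ a) (haM : a < M) (h : IsNullGeodesic M a p w β γ v) {s : ℝ}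
    (hs : s ∈ upTo 0 β) : HasDerivAt (fun s => carter M a (γ s) (v s)) 0 s := by
  have hg := h.geo s hs
  have hr := rad_pos_of_mem ha haM hg.mem
  have hD := Delta_pos_of_mem ha haM hg.mem
  have hS := Sig_pos (a := a) hr
  have hrad := hasDerivAt_rad hg.pos hr
  have hu := hg.hasDerivAt_radMom ha haM (h.metric_eq_zero ha haM hs)
  have hP : HasDerivAt (fun s => prinMom M a (γ s) (v s))
      (2 * rad (γ s) * dr (γ s) (v s) * energy M a (γ s) (v s)) s := by
    have := (hg.hasDerivAt_offset ha haM).add ((hrad.pow 2).mul (hg.hasDerivAt_energy ha haM))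
    refine (this.congr_of_eventuallyEq (Eventually.of_forall fun t => ?_)).congr_deriv ?_
    · simp only [offset, Pi.add_apply, Pi.mul_apply, Pi.pow_apply]; ring
    · simp
  have hDe : HasDerivAt (fun s => Delta M a (rad (γ s)))
      (2 * (rad (γ s) - M) * dr (γ s) (v s)) s := by
    refine (((hrad.pow 2).sub (hrad.const_mul (2 * M))).add_const (a ^ 2)).congr_deriv ?_
    norm_num; ring
  refine (((hP.pow 2).sub (hu.pow 2)).div hDe hD.ne').congr_deriv ?_
  simp only [carter, Pi.sub_apply, Pi.pow_apply]
  have : radMom a (γ s) (v s) = Sig a (γ s) * dr (γ s) (v s) := rfl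
  rw [this]
  field_simp
  norm_num
  ring

theorem carter_eq_init (ha : 0 ≤ a) (haM : a < M) (h : IsNullGeodesic M a p w β γ v) {s : ℝ}
    (hs : s ∈ upTo 0 β) : carter M a (γ s) (v s) = carter M a p w := by
  rw [const_of_hasDerivAt_zero h.pos (fun s hs => h.hasDerivAt_carter ha haM hs) hs,
    h.init, h.init_vel]

theorem prinMom_eq (ha : 0 ≤ a) (haM : a < M) (h : IsNullGeodesic M a p w β γ v) {s : ℝ}
    (hs : s ∈ upTo 0 β) : prinMom M a (γ s) (v s) =
      offset M a p w + rad (γ s) ^ 2 * energy M a p w := by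
  rw [← h.offset_eq ha haM hs, ← h.energy_eq ha haM hs, offset]; ring

theorem radialOrbit (ha : 0 ≤ a) (haM : a < M) (h : IsNullGeodesic M a p w β γ v) :
    RadialOrbit M a (energy M a p w) (offset M a p w) (carter M a p w) β
      (fun s => rad (γ s)) (fun s => radMom a (γ s) (v s)) (fun s => Sig a (γ s)) := by
  have hp := h.mem_exterior
  refine ⟨h.pos, fun s hs => (h.geo s hs).mem, fun s hs => ?_, fun s hs => ?_, fun s hs => ?_,
    fun s _ => rad_sq_le_Sig _, fun s hs => Sig_le (rad_pos_of_mem ha haM (h.geo s hs).mem),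
    carter_nonneg ha haM hp h.null, energy_pos_of_carter_eq_zero ha haM hp h.null h.prinMom_pos,
    ?_⟩
  · have hg := h.geo s hs
    have hr := rad_pos_of_mem ha haM hg.mem
    refine (hasDerivAt_rad hg.pos hr).congr_deriv ?_
    rw [radMom, mul_div_cancel_left₀ _ (Sig_pos hr).ne']
  · have := (h.geo s hs).hasDerivAt_radMom ha haM (h.metric_eq_zero ha haM hs)
    rwa [h.energy_eq ha haM hs, h.prinMom_eq ha haM hs, h.carter_eq_init ha haM hs] at this
  · have hD := (Delta_pos_of_mem ha haM (h.geo s hs).mem).ne'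
    rw [← h.prinMom_eq ha haM hs, ← h.carter_eq_init ha haM hs, carter]
    field_simp
    ring
  · simp only [h.init]
    have := h.prinMom_pos
    simp only [offset]; linarith

end IsNullGeodesic

/-- A future directed null vector is trapped if its radial potential has a double root outside
the horizon which the geodesic is approaching, or at which it sits. -/
def IsTrappedVector (M a : ℝ) (x v : Coord) : Prop :=
  ∃ b, IsDoubleRoot M a (energy M a x v) (offset M a x v) (carter M a x v) b ∧
    0 ≤ (b - rad x) * radMom a x v

/-! ### Existence of geodesics -/

theorem IsGeodesicFrom.exists_isNullGeodesic {p w : Coord} {α β : EReal} {γ : ℝ → Coord}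
    (h : IsGeodesicFrom M a p w α β γ) (hw : metric M a p w w = 0)
    (hP : 0 < prinMom M a p w) : ∃ v, IsNullGeodesic M a p w β γ v := by
  obtain ⟨v, hv0, hv⟩ := h.ode
  refine ⟨v, h.right_pos, fun s hs => ?_, h.init, hv0, hw, hP⟩
  have hα : α < (s : EReal) := h.left_neg.trans_le (by exact_mod_cast hs.1)
  exact ⟨h.mem_exterior s hα hs.2, (hv s hα hs.2).1, (hv s hα hs.2).2⟩

/-- On a compact range of radii the velocity of a null geodesic is bounded in terms of the conserved
quantities. -/
theorem abs_le_of_bounds (ha : 0 ≤ a) (haM : a < M) (hx : x ∈ exterior M a) {v : Coord}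
    (hv : metric M a x v v = 0) {ρ₁ Q : ℝ} (hρ₁ : rPlus M a < ρ₁) (h1 : ρ₁ ≤ rad x)
    (hQ : |prinMom M a x v| ≤ Q) (i : Fin 4) :
    |v i| ≤ Q / ρ₁ ^ 2 + (|energy M a x v| + 2 * M / ρ₁ * (Q / Delta M a ρ₁)) := by
  have hr := rad_pos_of_mem ha haM hx
  have hD := Delta_pos_of_mem ha haM hx
  have hS := Sig_pos (a := a) hr
  have hSr := rad_sq_le_Sig (a := a) x
  have hp := rPlus_pos ha haM
  have hρ0 : 0 < ρ₁ := hp.trans hρ₁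
  have hM : 0 < M := by linarith
  have hD1 := Delta_pos ha haM hρ₁
  have hD2 := Delta_mono ha haM hρ₁.le h1
  have hQ0 : 0 ≤ Q := (abs_nonneg _).trans hQ
  set V := |energy M a x v| + 2 * M / ρ₁ * (Q / Delta M a ρ₁) with hV
  have hω : |omegaT a x v| ≤ Q / Delta M a ρ₁ := by
    rw [prinMom, abs_mul, abs_of_pos hD] at hQ
    rw [le_div_iff₀ hD1]
    nlinarith [abs_nonneg (omegaT a x v)]
  have hfrac : 2 * M * rad x / Sig a x ≤ 2 * M / ρ₁ := by
    rw [div_le_div_iff₀ hS hρ0]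
    have : rad x * ρ₁ ≤ Sig a x := by nlinarith
    nlinarith
  have h0 : |v 0| ≤ V := by
    have e : v 0 = energy M a x v + 2 * M * rad x / Sig a x * omegaT a x v := by
      simp only [energy]; ring
    rw [e]
    refine (abs_add_le _ _).trans (add_le_add le_rfl ?_)
    rw [abs_mul, abs_of_nonneg (by positivity)]
    gcongr
  have hV0 : 0 ≤ V := (abs_nonneg _).trans h0
  have hdr : |dr x v| ≤ Q / ρ₁ ^ 2 := by
    have e1 : radMom a x v ^ 2 ≤ prinMom M a x v ^ 2 := by
      have := carter_nonneg ha haM hx hv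
      rw [carter, div_nonneg_iff] at this
      rcases this with h | h <;> linarith [h.1, h.2]
    have e2 : |radMom a x v| ≤ Q := (sq_le_sq.1 e1).trans hQ
    rw [radMom, abs_mul, abs_of_pos hS] at e2
    rw [le_div_iff₀ (by positivity)]
    have : ρ₁ ^ 2 ≤ Sig a x := le_trans (by gcongr) hSr
    nlinarith [abs_nonneg (dr x v)]
  have hsum : v 1 ^ 2 + v 2 ^ 2 + v 3 ^ 2 ≤ (Q / ρ₁ ^ 2 + V) ^ 2 := by
    rw [sum_sq_eq hr]
    rw [metric_eq hr] at hv
    have e1 : 0 ≤ 2 * M * rad x / Sig a x * (omegaT a x v * omegaT a x v) :=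
      mul_nonneg (by positivity) (mul_self_nonneg _)
    have e2 : 0 ≤ Sig a x / Delta M a (rad x) * (dr x v * dr x v) :=
      mul_nonneg (by positivity) (mul_self_nonneg _)
    have e3 : Sig a x * sphereForm x v v ≤ v 0 ^ 2 := by
      nlinarith [sq_nonneg (a * sinSqDphi x v)]
    have e4 : rad x ^ 2 * sphereForm x v v ≤ v 0 ^ 2 :=
      (mul_le_mul_of_nonneg_right hSr (sphereForm_nonneg hr v)).trans e3
    have e5 : v 0 ^ 2 ≤ V ^ 2 := sq_le_sq.2 (by rwa [abs_of_nonneg hV0])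
    have hq0 : 0 ≤ Q / ρ₁ ^ 2 := by positivity
    have e6 : dr x v ^ 2 ≤ (Q / ρ₁ ^ 2) ^ 2 := sq_le_sq.2 (by rwa [abs_of_nonneg hq0])
    nlinarith [mul_nonneg hq0 hV0]
  have hq0 : 0 ≤ Q / ρ₁ ^ 2 := by positivity
  have g0 : |v 0| ≤ Q / ρ₁ ^ 2 + V := h0.trans (by linarith)
  have hb : ∀ y : ℝ, y ^ 2 ≤ v 1 ^ 2 + v 2 ^ 2 + v 3 ^ 2 → |y| ≤ Q / ρ₁ ^ 2 + V := fun y hy =>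
    abs_le_of_sq_le_sq (hy.trans hsum) (by linarith)
  have g1 := hb (v 1) (by linarith [sq_nonneg (v 2), sq_nonneg (v 3)])
  have g2 := hb (v 2) (by linarith [sq_nonneg (v 1), sq_nonneg (v 3)])
  have g3 := hb (v 3) (by linarith [sq_nonneg (v 1), sq_nonneg (v 2)])
  fin_cases i
  exacts [g0, g1, g2, g3]

/-- There is a null geodesic with the given initial data that can be continued into the future as
long as its radius stays in a compact subset of `(r₊, ∞)`; the other coordinates remain bounded
because the velocity does. -/
theorem exists_isGeodesicFrom (ha : 0 ≤ a) (haM : a < M) {p w : Coord} (hp : p ∈ exterior M a)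
    (hw : metric M a p w w = 0) (hP : 0 < prinMom M a p w) :
    ∃ (α β : EReal) (γ v : ℝ → Coord), IsGeodesicFrom M a p w α β γ ∧
      IsNullGeodesic M a p w β γ v ∧ RadialOrbit.Complete M a β (fun s => rad (γ s)) := by
  have hU : IsOpen (exterior M a ×ˢ (univ : Set Coord)) := (isOpen_exterior M a).prod isOpen_univ
  obtain ⟨ε, hε, B, z, hz, hesc⟩ := exists_maximal_solution hU
    (fun z hz => contDiffAt_spray ha haM hz.1) (z₀ := (p, w)) ⟨hp, mem_univ _⟩
  have hB : 0 < B := lt_of_lt_of_le (by exact_mod_cast hε) hz.le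
  have hneg : ∀ s : ℝ, ((-ε : ℝ) : EReal) < (s : EReal) → -ε < s := fun s hs =>
    EReal.coe_lt_coe_iff.1 hs
  have hg : IsGeodesicFrom M a p w ((-ε : ℝ) : EReal) B (fun s => (z s).1) := by
    refine ⟨?_, hB, fun s h1 h2 => (hz.mem s (hneg s h1) h2).1, by simp only [hz.init],
      fun s => (z s).2, by simp only [hz.init], fun s h1 h2 => ?_⟩
    · exact_mod_cast neg_lt_zero.2 hε
    · have := hz.hasDerivAt s (hneg s h1) h2
      exact ⟨this.fst, this.snd⟩
  have hn : IsNullGeodesic M a p w B (fun s => (z s).1) (fun s => (z s).2) := by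
    refine ⟨hB, fun s hs => ?_, by simp only [hz.init], by simp only [hz.init], hw, hP⟩
    have hs' : -ε < s := by linarith [hs.1]
    have := hz.hasDerivAt s hs' hs.2
    exact ⟨(hz.mem s hs' hs.2).1, this.fst, this.snd⟩
  refine ⟨_, B, _, _, hg, hn, fun ρ₁ ρ₂ hρ₁ hin => ?_⟩
  by_contra hBtop
  have hbot : B ≠ ⊥ := (EReal.bot_lt_zero.trans hB).ne'
  lift B to ℝ using ⟨hBtop, hbot⟩ with b
  have hb : 0 < b := by exact_mod_cast hB
  have hp0 := rPlus_pos ha haM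
  set Q := |offset M a p w| + ρ₂ ^ 2 * |energy M a p w| with hQ
  set V := Q / ρ₁ ^ 2 + (|energy M a p w| + 2 * M / ρ₁ * (Q / Delta M a ρ₁)) with hV
  have hvel : ∀ s ∈ upTo 0 (b : EReal), ∀ i, |(z s).2 i| ≤ V := by
    intro s hs i
    have := abs_le_of_bounds ha haM (hn.geo s hs).mem (hn.metric_eq_zero ha haM hs) hρ₁
      (hin s hs).1 (Q := Q) (by
        rw [hn.prinMom_eq ha haM hs]
        refine (abs_add_le _ _).trans (add_le_add le_rfl ?_)
        rw [abs_mul, abs_of_nonneg (sq_nonneg _)]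
        have h0 := hp0.trans (hn.geo s hs).mem
        have := (hin s hs).2
        gcongr) i
    rwa [hn.energy_eq ha haM hs] at this
  have hV0 : 0 ≤ V := (abs_nonneg _).trans (hvel 0 ⟨le_rfl, hB⟩ 0)
  have htime : ∀ s ∈ upTo 0 (b : EReal), |(z s).1 0| ≤ |p 0| + V * b := by
    intro s hs
    have hsb : s < b := by exact_mod_cast hs.2
    have := (convex_upTo 0 (b : EReal)).norm_image_sub_le_of_norm_hasDerivWithin_le
      (f := fun s => (z s).1 0) (f' := fun s => (z s).2 0) (C := V)
      (fun x hx => (hasDerivAt_pi.1 (hn.geo x hx).pos 0).hasDerivWithinAt)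
      (fun x hx => hvel x hx 0) ⟨le_rfl, hB⟩ hs
    simp only [hz.init, sub_zero, Real.norm_eq_abs, abs_of_nonneg hs.1] at this
    have e : (z s).1 0 = p 0 + ((z s).1 0 - p 0) := by ring
    rw [e]
    refine (abs_add_le _ _).trans (add_le_add le_rfl (this.trans ?_))
    exact mul_le_mul_of_nonneg_left hsb.le hV0
  have hspace : ∀ s ∈ upTo 0 (b : EReal), ∀ i, |(z s).1 i| ≤ |p 0| + V * b + ρ₂ := by
    intro s hs i
    have h0 := hp0.trans (hn.geo s hs).mem
    have h1 := (hin s hs).2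
    have h2 := rad_sq (z s).1
    have h3 : 0 ≤ |p 0| + V * b := by positivity
    have h4 : ∀ y : ℝ, y ^ 2 ≤ rad (z s).1 ^ 2 → |y| ≤ |p 0| + V * b + ρ₂ := fun y hy =>
      (abs_le_of_sq_le_sq hy h0.le).trans (by linarith)
    have g0 : |(z s).1 0| ≤ |p 0| + V * b + ρ₂ := (htime s hs).trans (by linarith)
    have g1 := h4 ((z s).1 1) (by linarith [sq_nonneg ((z s).1 2), sq_nonneg ((z s).1 3)])
    have g2 := h4 ((z s).1 2) (by linarith [sq_nonneg ((z s).1 1), sq_nonneg ((z s).1 3)])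
    have g3 := h4 ((z s).1 3) (by linarith [sq_nonneg ((z s).1 1), sq_nonneg ((z s).1 2)])
    fin_cases i
    exacts [g0, g1, g2, g3]
  have hX0 : 0 ≤ |p 0| + V * b + ρ₂ := (abs_nonneg _).trans (hspace 0 ⟨le_rfl, hB⟩ 0)
  set A : Set (Coord × Coord) := (Metric.closedBall 0 (|p 0| + V * b + ρ₂) ×ˢ
    Metric.closedBall 0 V) ∩ {z | ρ₁ ≤ rad z.1} with hA
  have hAc : IsCompact A := by
    refine ((isCompact_closedBall _ _).prod (isCompact_closedBall _ _)).inter_right ?_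
    have : Continuous rad := by unfold rad; fun_prop
    exact isClosed_le continuous_const (this.comp continuous_fst)
  have hAU : A ⊆ exterior M a ×ˢ univ := fun z hz => ⟨hρ₁.trans_le hz.2, mem_univ _⟩
  refine EReal.coe_ne_top b (hesc A hAU hAc fun s h1 h2 => ⟨⟨?_, ?_⟩, (hin s ⟨h1, h2⟩).1⟩)
  · rw [mem_closedBall_zero_iff, pi_norm_le_iff_of_nonneg hX0]
    exact hspace s ⟨h1, h2⟩
  · rw [mem_closedBall_zero_iff, pi_norm_le_iff_of_nonneg hV0]
    exact hvel s ⟨h1, h2⟩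

end

/-! ### Convergence in the charts covering the horizons and null infinity -/

section

variable {M a : ℝ}

theorem hasDerivAt_tortoise (ha : 0 ≤ a) (haM : a < M) {r : ℝ} (hr : rPlus M a < r) :
    HasDerivAt (tortoise M a) ((r ^ 2 + a ^ 2) / Delta M a r) r := by
  have hlt := rMinus_lt_rPlus ha haM
  have h1 : r - rPlus M a ≠ 0 := (sub_pos.2 hr).ne'
  have h2 : r - rMinus M a ≠ 0 := (sub_pos.2 (hlt.trans hr)).ne'
  have h3 : rPlus M a - rMinus M a ≠ 0 := (sub_pos.2 hlt).ne'
  have e1 := ((hasDerivAt_id r).sub_const (rPlus M a)).log h1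
  have e2 := ((hasDerivAt_id r).sub_const (rMinus M a)).log h2
  refine ((hasDerivAt_id r).add (((e1.const_mul (rPlus M a)).sub
    (e2.const_mul (rMinus M a))).const_mul (2 * M / (rPlus M a - rMinus M a)))).congr_deriv ?_
  have hs := rPlus_add_rMinus (M := M) (a := a)
  have hm := rPlus_mul_rMinus ha haM
  rw [Delta_eq_mul ha haM]
  simp only [id_eq]
  rw [← hs, ← hm]
  field_simp
  ring

theorem hasDerivAt_twist (ha : 0 ≤ a) (haM : a < M) {r : ℝ} (hr : rPlus M a < r) :
    HasDerivAt (twist M a) (a / Delta M a r) r := by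
  have hlt := rMinus_lt_rPlus ha haM
  have h1 : r - rPlus M a ≠ 0 := (sub_pos.2 hr).ne'
  have h2 : r - rMinus M a ≠ 0 := (sub_pos.2 (hlt.trans hr)).ne'
  have h3 : rPlus M a - rMinus M a ≠ 0 := (sub_pos.2 hlt).ne'
  have e1 := (hasDerivAt_id r).sub_const (rPlus M a)
  have e2 := (hasDerivAt_id r).sub_const (rMinus M a)
  refine (((e1.div e2 h2).log (div_ne_zero h1 h2)).const_mul
    (a / (rPlus M a - rMinus M a))).congr_deriv ?_
  rw [Delta_eq_mul ha haM]
  simp only [id_eq, Pi.div_apply]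
  field_simp
  ring

/-- The rate of change of the last component of `nullChart` along the tangent vector `v`. -/
def chartDirVel (M a ε : ℝ) (x v : Coord) : Fin 3 → ℝ :=
  let δ := ε * twist M a (rad x)
  let δ' := ε * (a / Delta M a (rad x) * dr x v)
  let n := (nullChart M a ε x).2.2
  ![(v 1 * Real.cos δ - v 2 * Real.sin δ) / rad x - n 0 * dr x v / rad x - δ' * n 1,
    (v 1 * Real.sin δ + v 2 * Real.cos δ) / rad x - n 1 * dr x v / rad x + δ' * n 0,
    v 3 / rad x - n 2 * dr x v / rad x]

theorem sum_chartDir_sq {ε : ℝ} {x : Coord} (hx : 0 < rad x) :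
    ∑ i, (nullChart M a ε x).2.2 i ^ 2 = 1 := by
  have hr := rad_sq x
  have hcs := Real.sin_sq_add_cos_sq (ε * twist M a (rad x))
  simp only [nullChart, Fin.sum_univ_three, Matrix.cons_val_zero, Matrix.cons_val_one,
    Matrix.cons_val]
  field_simp
  rw [hr]
  linear_combination (x 1 ^ 2 + x 2 ^ 2) * hcs

/-- `(P + ε Σ r') / Δ`, the component of the momentum that blows up in the chart
`nullChart M a ε` unless `Σ r'` has the right sign; it governs the motion in this chart. -/
def nullMom (M a ε : ℝ) (x v : Coord) : ℝ :=
  (prinMom M a x v + ε * radMom a x v) / Delta M a (rad x)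

theorem Sig_mul_chartTime {ε : ℝ} {x : Coord} (ha : 0 ≤ a) (haM : a < M) (hx : x ∈ exterior M a)
    (v : Coord) :
    Sig a x * (v 0 + ε * ((rad x ^ 2 + a ^ 2) / Delta M a (rad x) * dr x v)) =
      (rad x ^ 2 + a ^ 2) * nullMom M a ε x v + a * omegaPhi a x v := by
  have hr := rad_pos_of_mem ha haM hx
  have hD := (Delta_pos_of_mem ha haM hx).ne'
  have hSe := Sig_eq (a := a) hr
  have h0 : v 0 = omegaT a x v + a * sinSqDphi x v := by simp only [omegaT]; ring
  simp only [nullMom, prinMom, radMom, omegaPhi]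
  rw [h0]
  field_simp
  linear_combination omegaT a x v * Delta M a (rad x) * hSe

/-- In the chart, `Σ²` times the squared speed of the direction is Carter's constant up to terms that
vanish with `nullMom`. -/
theorem Sig_sq_mul_sum_chartDirVel_sq {ε : ℝ} {x : Coord} (ha : 0 ≤ a)
    (haM : a < M) (hx : x ∈ exterior M a) {v : Coord} (hv : metric M a x v v = 0) :
    Sig a x ^ 2 * ∑ i, chartDirVel M a ε x v i ^ 2 = carter M a x v
      + 2 * a * nullMom M a ε x v * omegaPhi a x v
      + a ^ 2 * sinSq x * nullMom M a ε x v ^ 2 := by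
  have hr := rad_pos_of_mem ha haM hx
  have hD := (Delta_pos_of_mem ha haM hx).ne'
  have hcs := Real.sin_sq_add_cos_sq (ε * twist M a (rad x))
  have key : ∀ δ' : ℝ, ∑ i, (![(v 1 * Real.cos (ε * twist M a (rad x))
      - v 2 * Real.sin (ε * twist M a (rad x))) / rad x
        - (nullChart M a ε x).2.2 0 * dr x v / rad x - δ' * (nullChart M a ε x).2.2 1,
      (v 1 * Real.sin (ε * twist M a (rad x)) + v 2 * Real.cos (ε * twist M a (rad x))) / rad x
        - (nullChart M a ε x).2.2 1 * dr x v / rad x + δ' * (nullChart M a ε x).2.2 0,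
      v 3 / rad x - (nullChart M a ε x).2.2 2 * dr x v / rad x] : Fin 3 → ℝ) i ^ 2
      = sphereForm x v v + 2 * δ' * sinSqDphi x v + δ' ^ 2 * sinSq x := by
    intro δ'
    have hd : dr x v * rad x = x 1 * v 1 + x 2 * v 2 + x 3 * v 3 := by
      simp only [dr]; field_simp
    have h2 := rad_sq x
    set c := Real.cos (ε * twist M a (rad x))
    set σ := Real.sin (ε * twist M a (rad x))
    simp only [nullChart, Fin.sum_univ_three, Matrix.cons_val_zero, Matrix.cons_val_one,
      Matrix.cons_val, sphereForm, sinSqDphi, sinSq]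
    generalize dr x v = d at *
    field_simp
    linear_combination ((v 1 * rad x - x 1 * d) ^ 2 + (v 2 * rad x - x 2 * d) ^ 2
        + δ' ^ 2 * (x 1 ^ 2 + x 2 ^ 2) * rad x ^ 2
        + 2 * δ' * (x 1 * v 2 - x 2 * v 1) * rad x ^ 2) * hcs + (2 * d * rad x) * hd - d ^ 2 * h2
  have hk := key (ε * (a / Delta M a (rad x) * dr x v))
  have : ∑ i, chartDirVel M a ε x v i ^ 2 = _ := hk
  rw [this, carter_eq ha haM hx hv]
  have hP : nullMom M a ε x v = omegaT a x v + ε * radMom a x v / Delta M a (rad x) := by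
    simp only [nullMom, prinMom]; field_simp
  rw [hP]
  simp only [omegaPhi, radMom]
  field_simp
  ring

theorem abs_chart_le {ε : ℝ} {x : Coord} (ha : 0 ≤ a)
    (haM : a < M) (hx : x ∈ exterior M a) {v : Coord} (hv : metric M a x v v = 0) {B : ℝ}
    (hB : (1 + a) * √(carter M a x v)
      + (rad x ^ 2 + a ^ 2 + a) * |nullMom M a ε x v| ≤ B * Sig a x) :
    |v 0 + ε * ((rad x ^ 2 + a ^ 2) / Delta M a (rad x) * dr x v)| ≤ B ∧
      ∀ i, |chartDirVel M a ε x v i| ≤ B := by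
  have hr := rad_pos_of_mem ha haM hx
  have hS := Sig_pos (a := a) hr
  have hK := carter_nonneg ha haM hx hv
  have hz := abs_omegaPhi_le ha haM hx hv
  have hk0 := Real.sqrt_nonneg (carter M a x v)
  have hη0 := abs_nonneg (nullMom M a ε x v)
  constructor
  · rw [← mul_le_mul_iff_left₀ hS]
    refine le_trans ?_ hB
    nth_rewrite 1 [← abs_of_pos hS]
    rw [← abs_mul, mul_comm, Sig_mul_chartTime ha haM hx]
    refine (abs_add_le _ _).trans ?_
    rw [abs_mul, abs_mul, abs_of_nonneg ha, abs_of_nonneg (by positivity)]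
    nlinarith [mul_le_mul_of_nonneg_left hz ha, mul_nonneg ha hη0]
  · intro i
    have h1 : (Sig a x * |chartDirVel M a ε x v i|) ^ 2 ≤
        (√(carter M a x v) + a * |nullMom M a ε x v|) ^ 2 := by
      have e1 : chartDirVel M a ε x v i ^ 2 ≤ ∑ i, chartDirVel M a ε x v i ^ 2 :=
        Finset.single_le_sum (f := fun i => chartDirVel M a ε x v i ^ 2)
          (fun i _ => sq_nonneg _) (Finset.mem_univ i)
      have e2 := mul_le_mul_of_nonneg_left e1 (sq_nonneg (Sig a x))
      rw [Sig_sq_mul_sum_chartDirVel_sq ha haM hx hv] at e2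
      rw [mul_pow, sq_abs]
      refine e2.trans ?_
      have e3 : nullMom M a ε x v * omegaPhi a x v ≤ |nullMom M a ε x v| * √(carter M a x v) :=
        (le_abs_self _).trans (by rw [abs_mul]; gcongr)
      have e4 := Real.sq_sqrt hK
      have e5 := mul_le_mul_of_nonneg_right (sinSq_le_one hr)
        (sq_nonneg (a * nullMom M a ε x v))
      have e6 := sq_abs (nullMom M a ε x v)
      have e7 := mul_le_mul_of_nonneg_left e3 ha
      nlinarith
    have h2 := abs_le_of_sq_le_sq h1 (by positivity)
    rw [abs_of_nonneg (by positivity)] at h2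
    rw [← mul_le_mul_iff_left₀ hS, mul_comm]
    refine h2.trans (le_trans ?_ hB)
    have : 0 ≤ rad x ^ 2 + a ^ 2 := by positivity
    nlinarith [mul_nonneg this hη0, mul_nonneg ha hk0]

variable {p w : Coord} {β : EReal} {γ v : ℝ → Coord}

theorem GeodesicAt.hasDerivAt_chartTime (ha : 0 ≤ a) (haM : a < M) {s : ℝ} (ε : ℝ)
    (h : GeodesicAt M a γ v s) : HasDerivAt (fun s => (nullChart M a ε (γ s)).1)
      (v s 0 + ε * ((rad (γ s) ^ 2 + a ^ 2) / Delta M a (rad (γ s)) * dr (γ s) (v s))) s := by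
  have hr := rad_pos_of_mem ha haM h.mem
  exact (hasDerivAt_pi.1 h.pos 0).add
    ((HasDerivAt.comp (h₂ := tortoise M a) s (hasDerivAt_tortoise ha haM h.mem)
      (hasDerivAt_rad h.pos hr)).const_mul ε)

theorem GeodesicAt.hasDerivAt_chartDir (ha : 0 ≤ a) (haM : a < M) {s : ℝ} (ε : ℝ)
    (h : GeodesicAt M a γ v s) (i : Fin 3) :
    HasDerivAt (fun s => (nullChart M a ε (γ s)).2.2 i) (chartDirVel M a ε (γ s) (v s) i) s := by
  have hr := rad_pos_of_mem ha haM h.mem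
  have hrad := hasDerivAt_rad h.pos hr
  have hδ := ((hasDerivAt_twist ha haM h.mem).comp s hrad).const_mul ε
  have hx := hasDerivAt_pi.1 h.pos
  have hc := hδ.cos
  have hs := hδ.sin
  have d0 : HasDerivAt (fun s => (nullChart M a ε (γ s)).2.2 0)
      (chartDirVel M a ε (γ s) (v s) 0) s := by
    refine ((((hx 1).mul hc).sub ((hx 2).mul hs)).div hrad hr.ne').congr_deriv ?_
    simp only [chartDirVel, nullChart, Matrix.cons_val_zero, Matrix.cons_val_one, Pi.mul_apply,
      Pi.sub_apply, Function.comp_apply]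
    field_simp
    ring
  have d1 : HasDerivAt (fun s => (nullChart M a ε (γ s)).2.2 1)
      (chartDirVel M a ε (γ s) (v s) 1) s := by
    refine ((((hx 1).mul hs).add ((hx 2).mul hc)).div hrad hr.ne').congr_deriv ?_
    simp only [chartDirVel, nullChart, Matrix.cons_val_zero, Matrix.cons_val_one, Pi.mul_apply,
      Pi.add_apply, Function.comp_apply]
    field_simp
    ring
  have d2 : HasDerivAt (fun s => (nullChart M a ε (γ s)).2.2 2)
      (chartDirVel M a ε (γ s) (v s) 2) s := by
    refine ((hx 3).div hrad hr.ne').congr_deriv ?_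
    simp only [chartDirVel, nullChart, Matrix.cons_val]
    field_simp
  fin_cases i
  exacts [d0, d1, d2]

/-- If the rates of change of the components of `nullChart` are integrable towards the end of
the geodesic, then it converges in this chart. -/
theorem IsNullGeodesic.exists_tendsto_nullChart (ha : 0 ≤ a) (haM : a < M)
    (h : IsNullGeodesic M a p w β γ v) {ε : ℝ} {s₁ : ℝ} (hs₁ : s₁ ∈ upTo 0 β)
    {g g' : ℝ → ℝ} {B l : ℝ} (hg : ∀ s ∈ upTo s₁ β, HasDerivAt g (g' s) s)
    (hB : ∀ s ∈ upTo s₁ β, g s ≤ B)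
    (hle : ∀ s ∈ upTo s₁ β, (1 + a) * √(carter M a p w)
      + (rad (γ s) ^ 2 + a ^ 2 + a) * |nullMom M a ε (γ s) (v s)| ≤ g' s * Sig a (γ s))
    (hl : Tendsto (fun s => 1 / rad (γ s)) (toRightEnd β) (𝓝 l)) :
    ∃ q : ℝ × ℝ × (Fin 3 → ℝ), (q.2.1 = l ∧ ∑ i, q.2.2 i ^ 2 = 1) ∧
      Tendsto (fun s => nullChart M a ε (γ s)) (toRightEnd β) (𝓝 q) := by
  have hsub : ∀ s ∈ upTo s₁ β, s ∈ upTo 0 β := fun s hs => ⟨hs₁.1.trans hs.1, hs.2⟩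
  have hbd : ∀ s ∈ upTo s₁ β, _ ∧ _ := fun s hs =>
    abs_chart_le ha haM (h.geo s (hsub s hs)).mem (h.metric_eq_zero ha haM (hsub s hs))
      (B := g' s) (by rw [h.carter_eq_init ha haM (hsub s hs)]; exact hle s hs)
  obtain ⟨l₀, h0⟩ := exists_tendsto_of_abs_deriv_le h.pos hs₁.2
    (fun s hs => (h.geo s (hsub s hs)).hasDerivAt_chartTime ha haM ε) hg
    (fun s hs => (hbd s hs).1) hB
  choose n hn using fun i => exists_tendsto_of_abs_deriv_le h.pos hs₁.2
    (fun s hs => (h.geo s (hsub s hs)).hasDerivAt_chartDir ha haM ε i) hg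
    (fun s hs => (hbd s hs).2 i) hB
  refine ⟨(l₀, l, n), ⟨rfl, ?_⟩, h0.prodMk_nhds (hl.prodMk_nhds (tendsto_pi_nhds.2 hn))⟩
  have := toRightEnd_neBot h.pos
  refine tendsto_nhds_unique (tendsto_finsetSum Finset.univ fun i _ => (hn i).pow 2) ?_
  refine (tendsto_const_nhds (x := (1 : ℝ))).congr' ?_
  filter_upwards [eventually_lt_toRightEnd h.pos hs₁.2] with s hs
  exact (sum_chartDir_sq (rad_pos_of_mem ha haM (h.geo s (hsub s hs)).mem)).symm

theorem eventually_upTo {s₁ : ℝ} (hs₁ : s₁ ∈ upTo 0 β) (hβ : 0 < β) {q : ℝ → Prop}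
    (h : ∀ᶠ s in toRightEnd β, q s) : ∃ s₂ ∈ upTo 0 β, s₁ ≤ s₂ ∧ ∀ s ∈ upTo s₂ β, q s := by
  obtain ⟨s₀, h0, h1, h2⟩ := (eventually_toRightEnd hβ).1 h
  rcases le_total s₀ s₁ with h3 | h3
  · exact ⟨s₁, hs₁, le_rfl, fun s hs => h2 s (h3.trans hs.1) hs.2⟩
  · exact ⟨s₀, ⟨h0, h1⟩, h3, fun s hs => h2 s hs.1 hs.2⟩

/-- On an infalling geodesic `nullMom M a 1 = K / (P - u)` stays bounded and `-Σ r'` stays away from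
zero, so `-r` dominates the chart components. -/
theorem IsNullGeodesic.exists_tendsto_horizonBoundary (ha : 0 ≤ a) (haM : a < M)
    (h : IsNullGeodesic M a p w β γ v) (hC : 0 < offset M a p w + rPlus M a ^ 2 * energy M a p w)
    (hr : Tendsto (fun s => rad (γ s)) (toRightEnd β) (𝓝 (rPlus M a))) {s₁ : ℝ}
    (hs₁ : s₁ ∈ upTo 0 β) (hu : ∀ s ∈ upTo s₁ β, radMom a (γ s) (v s) < 0) :
    ∃ q ∈ horizonBoundary M a,
      Tendsto (fun s => nullChart M a 1 (γ s)) (toRightEnd β) (𝓝 q) := by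
  have ho := h.radialOrbit ha haM
  set P₀ := offset M a p w + rPlus M a ^ 2 * energy M a p w with hP₀
  set K := carter M a p w with hK
  have hK0 : 0 ≤ K := ho.K_nonneg
  have hp := rPlus_pos ha haM
  have hD : Continuous (Delta M a) := by unfold Delta; fun_prop
  have t1 : Tendsto (fun s => offset M a p w + rad (γ s) ^ 2 * energy M a p w) (toRightEnd β)
      (𝓝 P₀) := tendsto_const_nhds.add ((hr.pow 2).mul_const _)
  have t2 : Tendsto (fun s => (offset M a p w + rad (γ s) ^ 2 * energy M a p w) ^ 2
      - Delta M a (rad (γ s)) * K) (toRightEnd β) (𝓝 (P₀ ^ 2 - 0 * K)) := by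
    rw [← Delta_rPlus ha haM]
    exact (t1.pow 2).sub (((hD.tendsto _).comp hr).mul_const _)
  have ev := ((t1.eventually_const_le (show P₀ / 2 < P₀ by linarith)).and
    (t2.eventually_const_le (show (P₀ / 2) ^ 2 < P₀ ^ 2 - 0 * K by nlinarith))).and
    (hr.eventually_le_const (show rPlus M a < rPlus M a + 1 by linarith))
  obtain ⟨s₂, hs₂, h12, hev⟩ := eventually_upTo hs₁ h.pos ev
  set B := ((1 + a) * √K + ((rPlus M a + 1) ^ 2 + a ^ 2 + a) * (2 * K / P₀)) * (2 / P₀) with hB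
  have hB0 : 0 ≤ B := by positivity
  have hsub : ∀ s ∈ upTo s₂ β, s ∈ upTo 0 β := fun s hs => ⟨hs₂.1.trans hs.1, hs.2⟩
  refine h.exists_tendsto_nullChart ha haM hs₂ (B := 0)
    (g := fun s => -B * rad (γ s))
    (g' := fun s => -B * (radMom a (γ s) (v s) / Sig a (γ s)))
    (fun s hs => (ho.deriv_r s (hsub s hs)).const_mul _) (fun s hs => ?_) (fun s hs => ?_)
    (tendsto_const_nhds.div hr hp.ne')
  · have := rad_nonneg (γ s)
    nlinarith
  · obtain ⟨⟨e1, e2⟩, e3⟩ := hev s hs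
    have hm := (h.geo s (hsub s hs)).mem
    have hr0 := rad_pos_of_mem ha haM hm
    have hS := Sig_pos (a := a) hr0
    have hDp := Delta_pos_of_mem ha haM hm
    have hus := hu s ⟨h12.trans hs.1, hs.2⟩
    have husq := ho.u_sq s (hsub s hs)
    have hPs := h.prinMom_eq ha haM (hsub s hs)
    set u := radMom a (γ s) (v s)
    set P := prinMom M a (γ s) (v s)
    rw [← hPs] at e1 e2 husq
    have hu2 : P₀ / 2 ≤ -u := by
      refine le_of_sq_le_sq ?_ (by linarith)
      rw [neg_sq, husq]; exact e2
    have hη : nullMom M a 1 (γ s) (v s) = K / (P - u) := by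
      rw [nullMom, div_eq_div_iff hDp.ne' (by linarith)]
      linear_combination -husq
    have hη1 : |nullMom M a 1 (γ s) (v s)| ≤ 2 * K / P₀ := by
      rw [hη, abs_of_nonneg (div_nonneg hK0 (by linarith)),
        div_le_div_iff₀ (by linarith) hC]
      nlinarith
    have e4 : -B * (u / Sig a (γ s)) * Sig a (γ s) = B * -u := by field_simp
    rw [e4]
    calc _ ≤ (1 + a) * √K + ((rPlus M a + 1) ^ 2 + a ^ 2 + a) * (2 * K / P₀) := by gcongr
      _ = B * (P₀ / 2) := by rw [hB]; field_simp
      _ ≤ _ := by gcongr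

/-- On an escaping geodesic `nullMom M a (-1) = K / (P + u)` decays like `1 / r²` while `Σ r'` grows
like `r²`, so `-1 / r` dominates the chart components. -/
theorem IsNullGeodesic.exists_tendsto_scriBoundary (ha : 0 ≤ a) (haM : a < M)
    (h : IsNullGeodesic M a p w β γ v) (hE : 0 < energy M a p w)
    (hr : Tendsto (fun s => rad (γ s)) (toRightEnd β) atTop) {s₁ : ℝ}
    (hs₁ : s₁ ∈ upTo 0 β) (hu : ∀ s ∈ upTo s₁ β, 0 < radMom a (γ s) (v s)) :
    ∃ q ∈ scriBoundary,
      Tendsto (fun s => nullChart M a (-1) (γ s)) (toRightEnd β) (𝓝 q) := by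
  have ho := h.radialOrbit ha haM
  set E := energy M a p w
  set C := offset M a p w
  set K := carter M a p w with hK
  have hK0 : 0 ≤ K := ho.K_nonneg
  have hp := rPlus_pos ha haM
  have hM : 0 < M := by linarith
  have hr2 : Tendsto (fun s => rad (γ s) ^ 2) (toRightEnd β) atTop :=
    (tendsto_pow_atTop two_ne_zero).comp hr
  have ev := ((hr.eventually_ge_atTop 1).and (hr2.eventually_ge_atTop (2 * |C| / E))).and
    (hr2.eventually_ge_atTop (16 * K * (1 + a ^ 2) / E ^ 2))
  obtain ⟨s₂, hs₂, h12, hev⟩ := eventually_upTo hs₁ h.pos ev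
  set B := ((1 + a) * √K + (1 + a ^ 2 + a) * (2 * K / E)) * (4 / E) with hB
  have hB0 : 0 ≤ B := by positivity
  have hsub : ∀ s ∈ upTo s₂ β, s ∈ upTo 0 β := fun s hs => ⟨hs₂.1.trans hs.1, hs.2⟩
  have hrs : ∀ s ∈ upTo s₂ β, 0 < rad (γ s) := fun s hs =>
    rad_pos_of_mem ha haM (h.geo s (hsub s hs)).mem
  refine h.exists_tendsto_nullChart ha haM hs₂ (B := 0)
    (g := fun s => -B * (rad (γ s))⁻¹)
    (g' := fun s => -B * (-(radMom a (γ s) (v s) / Sig a (γ s)) / rad (γ s) ^ 2))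
    (fun s hs => ((ho.deriv_r s (hsub s hs)).inv (hrs s hs).ne').const_mul _) (fun s hs => ?_)
    (fun s hs => ?_) (by simp only [one_div]; exact hr.inv_tendsto_atTop)
  · have := inv_nonneg.2 (hrs s hs).le
    nlinarith
  · obtain ⟨⟨e1, e2⟩, e3⟩ := hev s hs
    have hm := (h.geo s (hsub s hs)).mem
    have hr0 := hrs s hs
    have hS := Sig_pos (a := a) hr0
    have hDp := Delta_pos_of_mem ha haM hm
    have hus := hu s ⟨h12.trans hs.1, hs.2⟩
    have husq := ho.u_sq s (hsub s hs)
    have hPs := h.prinMom_eq ha haM (hsub s hs)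
    set u := radMom a (γ s) (v s)
    set P := prinMom M a (γ s) (v s)
    set r := rad (γ s)
    rw [← hPs] at husq
    rw [div_le_iff₀ (by positivity)] at e2 e3
    have hr1 : 1 ≤ r ^ 2 := one_le_pow₀ e1
    have hP1 : E / 2 * r ^ 2 ≤ P := by
      rw [hPs]
      have := neg_abs_le C
      nlinarith
    have hD1 : Delta M a r ≤ (1 + a ^ 2) * r ^ 2 := by
      simp only [Delta]
      nlinarith [mul_pos hM hr0, mul_nonneg (sq_nonneg a) (sub_nonneg.2 hr1)]
    have hDK : Delta M a r * K ≤ (E / 4 * r ^ 2) ^ 2 := by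
      calc Delta M a r * K ≤ (1 + a ^ 2) * r ^ 2 * K := by gcongr
        _ = r ^ 2 / 16 * (16 * K * (1 + a ^ 2)) := by ring
        _ ≤ r ^ 2 / 16 * (r ^ 2 * E ^ 2) := by gcongr
        _ = _ := by ring
    have hu2 : E / 4 * r ^ 2 ≤ u := by
      refine le_of_sq_le_sq ?_ hus.le
      have : (E / 2 * r ^ 2) ^ 2 ≤ P ^ 2 := by gcongr
      nlinarith [sq_nonneg (E * r ^ 2)]
    have hPpos : 0 < E / 2 * r ^ 2 := by positivity
    have hη : nullMom M a (-1) (γ s) (v s) = K / (P + u) := by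
      rw [nullMom, div_eq_div_iff hDp.ne' (by linarith)]
      linear_combination -husq
    have hη1 : |nullMom M a (-1) (γ s) (v s)| ≤ 2 * K / E / r ^ 2 := by
      rw [hη, abs_of_nonneg (div_nonneg hK0 (by linarith)), div_div,
        div_le_div_iff₀ (by linarith) (by positivity)]
      nlinarith
    have e4 : -B * (-(u / Sig a (γ s)) / r ^ 2) * Sig a (γ s) = B * (u / r ^ 2) := by
      field_simp
    rw [e4]
    calc _ ≤ (1 + a) * √K + (r ^ 2 + a ^ 2 + a) * (2 * K / E / r ^ 2) := by gcongr
      _ ≤ (1 + a) * √K + ((1 + a ^ 2 + a) * r ^ 2) * (2 * K / E / r ^ 2) := by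
        gcongr
        nlinarith [mul_nonneg (add_nonneg (sq_nonneg a) ha) (sub_nonneg.2 hr1)]
      _ = B * (E / 4) := by rw [hB]; field_simp
      _ ≤ _ := mul_le_mul_of_nonneg_left ((le_div_iff₀ (by positivity)).2 hu2) hB0

/-- A future directed null geodesic avoids the horizon and infinity exactly if its initial
velocity is trapped in the sense of the radial potential. -/
theorem not_meets_iff (ha : 0 ≤ a) (haM : a < M) (hp : p ∈ exterior M a)
    (hw : metric M a p w w = 0) (hP : 0 < prinMom M a p w) :
    ¬ (MeetsFutureHorizon M a p w ∨ MeetsFutureScri M a p w) ↔ IsTrappedVector M a p w := by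
  constructor
  · intro hn
    by_contra hnt
    obtain ⟨α, β, γ, v, hg, h, hc⟩ := exists_isGeodesicFrom ha haM hp hw hP
    rcases (h.radialOrbit ha haM).horizon_or_infinity ha haM hc (fun x hx => by
      by_contra hneg
      rw [h.init, h.init_vel, not_lt] at hneg
      exact hnt ⟨x, hx, hneg⟩) with ⟨h1, h2, s₁, hs₁, h3⟩ | ⟨h1, h2, s₁, hs₁, h3⟩
    · exact hn (Or.inl ⟨α, β, γ, hg, h.exists_tendsto_horizonBoundary ha haM h1 h2 hs₁ h3⟩)
    · exact hn (Or.inr ⟨α, β, γ, hg, h.exists_tendsto_scriBoundary ha haM h1 h2 hs₁ h3⟩)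
  · rintro ⟨b, hb, hu⟩
    have key : ∀ (α β : EReal) (γ : ℝ → Coord), IsGeodesicFrom M a p w α β γ →
        0 < β ∧ ∃ ρ₁ ρ₂, rPlus M a < ρ₁ ∧
          ∀ᶠ s in toRightEnd β, ρ₁ ≤ rad (γ s) ∧ rad (γ s) ≤ ρ₂ := by
      intro α β γ hg
      obtain ⟨v, h⟩ := hg.exists_isNullGeodesic hw hP
      obtain ⟨ρ₁, ρ₂, h1, h2⟩ := (h.radialOrbit ha haM).bounded_of_trapped ha haM hb
        (by simp only [h.init, h.init_vel]; exact hu)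
      exact ⟨h.pos, ρ₁, ρ₂, h1, (eventually_lt_toRightEnd h.pos h.pos).mono fun s hs => h2 s hs⟩
    have hp0 := rPlus_pos ha haM
    rintro (⟨α, β, γ, hg, q, hq, ht⟩ | ⟨α, β, γ, hg, q, hq, ht⟩)
    · obtain ⟨hβ, ρ₁, ρ₂, h1, h2⟩ := key α β γ hg
      have := toRightEnd_neBot hβ
      have hlim : Tendsto (fun s => 1 / rad (γ s)) (toRightEnd β) (𝓝 (1 / rPlus M a)) := by
        rw [← hq.1]; exact ht.snd_nhds.fst_nhds
      have := le_of_tendsto hlim (h2.mono fun s hs =>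
        one_div_le_one_div_of_le (hp0.trans h1) hs.1)
      rw [one_div_le_one_div hp0 (hp0.trans h1)] at this
      exact this.not_gt h1
    · obtain ⟨hβ, ρ₁, ρ₂, h1, h2⟩ := key α β γ hg
      have := toRightEnd_neBot hβ
      have hlim : Tendsto (fun s => 1 / rad (γ s)) (toRightEnd β) (𝓝 0) := by
        rw [← hq.1]; exact ht.snd_nhds.fst_nhds
      obtain ⟨s, hs⟩ := h2.exists
      have hρ₂ : 0 < ρ₂ := by linarith [hs.1, hs.2]
      have := ge_of_tendsto hlim (h2.mono fun s hs =>
        one_div_le_one_div_of_le (hp0.trans (h1.trans_le hs.1)) hs.2)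
      exact this.not_gt (by positivity)

end

/-! ### Double roots of the radial potential -/

/-- The value of `-C / E`, where `C = a² E - a L`, for null geodesics whose radial potential has
a double root at `x`. -/
def photonOffset (M a x : ℝ) : ℝ := x ^ 2 - 2 * x * Delta M a x / (x - M)

/-- The value of `√K / E` for null geodesics whose radial potential has a double root at `x`. -/
def photonRoot (M a x : ℝ) : ℝ := 2 * x * √(Delta M a x) / (x - M)

/-- At a point with `Σ = r² + b`, the value of `(Σ E - P) / (√K E)` for null geodesics whose
radial potential has a double root at `x`. This is `a sin θ` times the cosine of the angle around
the radial direction in the principal frame, and it determines `x`. -/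
def photonRatio (M a b x : ℝ) : ℝ := (b + photonOffset M a x) / photonRoot M a x

section

variable {M a b x : ℝ}

theorem isDoubleRoot_iff (ha : 0 ≤ a) (haM : a < M) {E C K : ℝ} (hx : rPlus M a < x)
    (hE : 0 < E) : IsDoubleRoot M a E C K x ↔
      C = -photonOffset M a x * E ∧ K = (photonRoot M a x * E) ^ 2 := by
  have h1 := rPlus_sub_pos ha haM
  have hxM : x - M ≠ 0 := by linarith
  have hD := Delta_pos ha haM hx
  have hs := Real.sq_sqrt hD.le
  have hK : (photonRoot M a x * E) ^ 2 = 4 * x ^ 2 * Delta M a x / (x - M) ^ 2 * E ^ 2 := by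
    simp only [photonRoot]; rw [mul_pow, div_pow, mul_pow, hs]; ring
  have hC : C + x ^ 2 * E = 2 * x * Delta M a x / (x - M) * E ↔ C = -photonOffset M a x * E := by
    simp only [photonOffset]
    constructor <;> intro h <;> linear_combination h
  rw [hK, ← hC]
  constructor
  · rintro ⟨-, -, h2, h3⟩
    have h4 : C + x ^ 2 * E = 2 * x * Delta M a x / (x - M) * E := by
      field_simp; linarith
    refine ⟨h4, mul_left_cancel₀ hD.ne' ?_⟩
    rw [← h3, h4]; field_simp; ring
  · rintro ⟨h2, h3⟩
    refine ⟨hx, hE, ?_, ?_⟩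
    · rw [h2]; field_simp
    · rw [h2, h3]; field_simp; ring

theorem photonRoot_pos (ha : 0 ≤ a) (haM : a < M) (hx : rPlus M a < x) :
    0 < photonRoot M a x := by
  have h1 := rPlus_sub_pos ha haM
  have h2 := rPlus_pos ha haM
  have hD := Real.sqrt_pos.2 (Delta_pos ha haM hx)
  have : 0 < x - M := by linarith
  have : 0 < x := by linarith
  unfold photonRoot; positivity

theorem photonOffset_lt (ha : 0 ≤ a) (haM : a < M) (hx : rPlus M a < x) :
    photonOffset M a x < rPlus M a ^ 2 := by
  have h1 := rPlus_sub_pos ha haM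
  have h2 := rPlus_sub_sq ha haM
  have hM : 0 < M := by linarith
  set m := rPlus M a - M with hm
  have hy : m < x - M := by linarith
  have hr : rPlus M a = M + m := by linarith
  have hy0 : 0 < x - M := by linarith
  have e : rPlus M a ^ 2 - photonOffset M a x =
      ((x - M) ^ 2 - m ^ 2) + 2 * M * m * (x - M - m) / (x - M) := by
    simp only [photonOffset, Delta, hr]
    field_simp
    linear_combination (2 * x) * h2
  have e1 : 0 < (x - M) ^ 2 - m ^ 2 := by nlinarith
  have e2 : 0 < 2 * M * m * (x - M - m) / (x - M) :=
    div_pos (by have := sub_pos.2 hy; positivity) hy0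
  linarith

theorem hasDerivAt_Delta (M a x : ℝ) : HasDerivAt (Delta M a) (2 * (x - M)) x := by
  refine ((((hasDerivAt_id x).pow 2).sub ((hasDerivAt_id x).const_mul (2 * M))).add_const
    (a ^ 2)).congr_deriv ?_
  simp; ring

theorem hasDerivAt_photonOffset (hx : x - M ≠ 0) : HasDerivAt (photonOffset M a)
    (-(2 * (x - M) + 2 * (M ^ 2 - a ^ 2) * M / (x - M) ^ 2)) x := by
  have h1 := hasDerivAt_id x
  refine ((h1.pow 2).sub (((h1.const_mul 2).mul (hasDerivAt_Delta M a x)).div (h1.sub_const M)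
    hx)).congr_deriv ?_
  simp [Delta]
  field_simp
  ring

theorem hasDerivAt_photonRoot (hx : x - M ≠ 0) (hD : 0 < Delta M a x) :
    HasDerivAt (photonRoot M a)
    ((2 * (x - M) + 2 * (M ^ 2 - a ^ 2) * M / (x - M) ^ 2) / √(Delta M a x)) x := by
  have h1 := hasDerivAt_id x
  have hs := Real.sq_sqrt hD.le
  have hs0 := (Real.sqrt_pos.2 hD).ne'
  refine (((h1.const_mul 2).mul ((hasDerivAt_Delta M a x).sqrt hD.ne')).div (h1.sub_const M)
    hx).congr_deriv ?_
  simp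
  generalize √(Delta M a x) = q at *
  field_simp
  rw [hs]
  simp only [Delta]
  ring

theorem hasDerivAt_photonRatio (ha : 0 ≤ a) (haM : a < M) (hx : rPlus M a < x) :
    HasDerivAt (photonRatio M a b)
    (-((2 * (x - M) + 2 * (M ^ 2 - a ^ 2) * M / (x - M) ^ 2) * (b + x ^ 2) /
      (photonRoot M a x ^ 2 * √(Delta M a x)))) x := by
  have h1 := rPlus_sub_pos ha haM
  have hxM : x - M ≠ 0 := by linarith
  have hD := Delta_pos ha haM hx
  have hk := (photonRoot_pos ha haM hx).ne'
  have hs := Real.sq_sqrt hD.le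
  have hs0 := (Real.sqrt_pos.2 hD).ne'
  refine (((hasDerivAt_photonOffset hxM).const_add b).div (hasDerivAt_photonRoot hxM hD)
    hk).congr_deriv ?_
  have e : x ^ 2 - photonOffset M a x = √(Delta M a x) * photonRoot M a x := by
    simp only [photonOffset, photonRoot]
    field_simp
    rw [hs]; ring
  generalize 2 * (x - M) + 2 * (M ^ 2 - a ^ 2) * M / (x - M) ^ 2 = d at *
  generalize √(Delta M a x) = q at *
  field_simp
  linear_combination d * e

theorem photonRatio_deriv_neg (ha : 0 ≤ a) (haM : a < M) (hb : 0 ≤ b) (hx : rPlus M a < x) :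
    -((2 * (x - M) + 2 * (M ^ 2 - a ^ 2) * M / (x - M) ^ 2) * (b + x ^ 2) /
      (photonRoot M a x ^ 2 * √(Delta M a x))) < 0 := by
  have h1 := rPlus_sub_pos ha haM
  have hM : 0 < M := by linarith
  have hμ := mu_pos ha haM
  have hxM : 0 < x - M := by linarith
  have hx0 : 0 < x := by linarith
  have hk := photonRoot_pos ha haM hx
  have hs := Real.sqrt_pos.2 (Delta_pos ha haM hx)
  rw [neg_lt_zero]
  positivity

theorem strictAntiOn_photonRatio (ha : 0 ≤ a) (haM : a < M) (hb : 0 ≤ b) :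
    StrictAntiOn (photonRatio M a b) (Ioi (rPlus M a)) := by
  refine strictAntiOn_of_deriv_neg (convex_Ioi _) (fun x hx =>
    (hasDerivAt_photonRatio ha haM hx).continuousAt.continuousWithinAt) fun x hx => ?_
  rw [interior_Ioi] at hx
  rw [(hasDerivAt_photonRatio ha haM hx).deriv]
  exact photonRatio_deriv_neg ha haM hb hx

theorem exists_photonRatio_ge (ha : 0 ≤ a) (haM : a < M) (hb : 0 ≤ b) (c : ℝ) :
    ∃ x, rPlus M a < x ∧ c ≤ photonRatio M a b x := by
  have h1 := rPlus_sub_pos ha haM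
  have hxM : rPlus M a - M ≠ 0 := by linarith
  have hr := rPlus_pos ha haM
  have hD : Continuous (Delta M a) := by unfold Delta; fun_prop
  have hmem : ∀ᶠ x in 𝓝[>] rPlus M a, rPlus M a < x := self_mem_nhdsWithin
  have t1 : Tendsto (photonRoot M a) (𝓝[>] rPlus M a) (𝓝[>] 0) := by
    refine tendsto_nhdsWithin_iff.2 ⟨?_, hmem.mono fun x hx => photonRoot_pos ha haM hx⟩
    have hc : ContinuousAt (photonRoot M a) (rPlus M a) := by
      unfold photonRoot
      exact ContinuousAt.div (by fun_prop) (by fun_prop) hxM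
    have h0 : photonRoot M a (rPlus M a) = 0 := by simp [photonRoot, Delta_rPlus ha haM]
    exact h0 ▸ hc.tendsto.mono_left nhdsWithin_le_nhds
  have t2 : Tendsto (fun x => b + photonOffset M a x) (𝓝[>] rPlus M a)
      (𝓝 (b + rPlus M a ^ 2)) := by
    have h0 : photonOffset M a (rPlus M a) = rPlus M a ^ 2 := by
      simp [photonOffset, Delta_rPlus ha haM]
    rw [← h0]
    exact ((hasDerivAt_photonOffset hxM).continuousAt.const_add b).tendsto.mono_left
      nhdsWithin_le_nhds
  have t3 := t2.pos_mul_atTop (by positivity) t1.inv_tendsto_nhdsGT_zero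
  obtain ⟨x, hx, hc⟩ := (hmem.and (t3.eventually_ge_atTop c)).exists
  exact ⟨x, hx, hc⟩

theorem exists_photonRatio_le (ha : 0 ≤ a) (haM : a < M) (hb : 0 ≤ b) (c : ℝ) :
    ∃ x, rPlus M a < x ∧ photonRatio M a b x ≤ c := by
  have h1 := rPlus_sub_pos ha haM
  have hμ := mu_pos ha haM
  have hM : 0 < M := by linarith
  set N := b + M ^ 2 + 2 * (M ^ 2 - a ^ 2) + 2 * M * (M ^ 2 - a ^ 2) with hN
  have hN0 : 0 < N := by positivity
  -- With `y = x - M` one has `b + photonOffset ≤ N - y² ≤ -y² / 2` and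
  -- `photonRoot ≤ 2 x ≤ 4 y`.
  set y := (rPlus M a - M) + 1 + M + 2 * N + 8 * |c| with hy
  have hc := abs_nonneg c
  have hy1 : 1 ≤ y := by linarith
  have hyM : M ≤ y := by linarith
  have hyN : 2 * N ≤ y := by linarith
  have hyc : 8 * |c| ≤ y := by linarith
  have hy0 : 0 < y := by linarith
  have hx : rPlus M a < M + y := by linarith
  have hk := photonRoot_pos ha haM hx
  refine ⟨M + y, hx, ?_⟩
  have hD := Delta_pos ha haM hx
  have hDy : Delta M a (M + y) = y ^ 2 - (M ^ 2 - a ^ 2) := by simp only [Delta]; ring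
  have e1 : b + photonOffset M a (M + y) ≤ -(y ^ 2 / 2) := by
    have : b + photonOffset M a (M + y) =
        b + M ^ 2 + 2 * (M ^ 2 - a ^ 2) + 2 * M * (M ^ 2 - a ^ 2) / y - y ^ 2 := by
      simp only [photonOffset, hDy, add_sub_cancel_left]
      field_simp; ring
    rw [this]
    have : 2 * M * (M ^ 2 - a ^ 2) / y ≤ 2 * M * (M ^ 2 - a ^ 2) :=
      div_le_self (by positivity) hy1
    nlinarith
  have e2 : photonRoot M a (M + y) ≤ 4 * y := by
    have h3 : √(Delta M a (M + y)) ≤ y := Real.sqrt_le_iff.2 ⟨hy0.le, by rw [hDy]; linarith⟩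
    simp only [photonRoot, add_sub_cancel_left]
    rw [div_le_iff₀ hy0]
    have : 2 * (M + y) * √(Delta M a (M + y)) ≤ 2 * (M + y) * y := by gcongr
    nlinarith
  rw [photonRatio, div_le_iff₀ hk]
  have := neg_abs_le c
  nlinarith

theorem exists_photonRatio_eq (ha : 0 ≤ a) (haM : a < M) (hb : 0 ≤ b) (c : ℝ) :
    ∃ x, rPlus M a < x ∧ photonRatio M a b x = c := by
  obtain ⟨x₁, h1, e1⟩ := exists_photonRatio_ge ha haM hb c
  obtain ⟨x₂, h2, e2⟩ := exists_photonRatio_le ha haM hb c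
  exact isPreconnected_Ioi.intermediate_value (mem_Ioi.2 h2) (mem_Ioi.2 h1)
    (fun x hx => (hasDerivAt_photonRatio ha haM hx).continuousAt.continuousWithinAt) ⟨e2, e1⟩

theorem contDiffAt_Delta_sqrt (ha : 0 ≤ a) (haM : a < M) (hx : rPlus M a < x) :
    ContDiffAt ℝ ∞ (fun x => √(Delta M a x)) x := by
  refine ContDiffAt.sqrt ?_ (Delta_pos ha haM hx).ne'
  unfold Delta; fun_prop

theorem contDiffAt_photonRoot (ha : 0 ≤ a) (haM : a < M) (hx : rPlus M a < x) :
    ContDiffAt ℝ ∞ (photonRoot M a) x := by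
  have h1 := rPlus_sub_pos ha haM
  exact ((contDiffAt_const.mul contDiffAt_id).mul (contDiffAt_Delta_sqrt ha haM hx)).div
    (contDiffAt_id.sub contDiffAt_const) (show x - M ≠ 0 by linarith)

theorem contDiffAt_photonOffset (hx : x - M ≠ 0) : ContDiffAt ℝ ∞ (photonOffset M a) x := by
  unfold photonOffset Delta
  exact ContDiffAt.sub (by fun_prop) (ContDiffAt.div (by fun_prop) (by fun_prop) hx)

theorem contDiffAt_photonRatio (ha : 0 ≤ a) (haM : a < M) (hx : rPlus M a < x) :
    ContDiffAt ℝ ∞ (photonRatio M a b) x := by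
  have h1 := rPlus_sub_pos ha haM
  exact (contDiffAt_const.add (contDiffAt_photonOffset (by linarith))).div
    (contDiffAt_photonRoot ha haM hx) (photonRoot_pos ha haM hx).ne'

/-- The inverse of `photonRatio` is smooth. -/
theorem exists_photonRatio_inverse (ha : 0 ≤ a) (haM : a < M) (hb : 0 ≤ b) :
    ∃ X : ℝ → ℝ, ContDiff ℝ ∞ X ∧ (∀ c, rPlus M a < X c) ∧ (∀ c, photonRatio M a b (X c) = c) ∧
      ∀ x, rPlus M a < x → X (photonRatio M a b x) = x := by
  choose X hX hFX using exists_photonRatio_eq ha haM hb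
  have hXF : ∀ x, rPlus M a < x → X (photonRatio M a b x) = x := fun x hx =>
    (strictAntiOn_photonRatio ha haM hb).injOn (hX _) hx (hFX _)
  refine ⟨X, contDiff_iff_contDiffAt.2 fun c => ?_, hX, hFX, hXF⟩
  have hd := hasDerivAt_photonRatio (b := b) ha haM (hX c)
  have hd' := hd.hasFDerivAt_equiv (photonRatio_deriv_neg ha haM hb (hX c)).ne
  have hc := contDiffAt_photonRatio (b := b) ha haM (hX c)
  have hn : (∞ : WithTop ℕ∞) ≠ 0 := by simp
  have hl := hc.to_localInverse hd' hn
  have hl0 := hc.localInverse_apply_image hd' hn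
  rw [hFX] at hl hl0
  refine hl.congr_of_eventuallyEq ?_
  have h1 : ∀ᶠ y in 𝓝 c, rPlus M a < hc.localInverse hd' hn y :=
    hl.continuousAt.eventually (lt_mem_nhds (by rw [hl0]; exact hX c))
  have h2 : ∀ᶠ y in 𝓝 c, photonRatio M a b (hc.localInverse hd' hn y) = y := by
    have := (hc.hasStrictFDerivAt' hd' hn).eventually_right_inverse
    rwa [hFX] at this
  filter_upwards [h1, h2] with y hy1 hy2
  conv_lhs => rw [← hy2]
  exact hXF _ hy1

/-- The trapped null directions in coordinates adapted to the principal null directions: those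
with `P = 1` form the ellipsoid `u² + Δ (y₁² + y₂²) = 1`, on which the trapped ones form a graph
over the circle of directions of `(y₁, y₂)`. -/
theorem exists_trapped_param (ha : 0 ≤ a) (haM : a < M) (hb : 0 ≤ b) (S : ℝ) {r : ℝ}
    (hr : rPlus M a < r) : ∃ U ϱ : ℝ → ℝ, ContDiff ℝ ∞ U ∧ ContDiff ℝ ∞ ϱ ∧
      Function.Periodic U (2 * Real.pi) ∧ Function.Periodic ϱ (2 * Real.pi) ∧ (∀ s, 0 < ϱ s) ∧
      (∀ s, U s ^ 2 + Delta M a r * ϱ s ^ 2 = 1) ∧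
      ∀ u y₁ y₂ E C : ℝ, u ^ 2 + Delta M a r * (y₁ ^ 2 + y₂ ^ 2) = 1 →
        (r ^ 2 + b) * E = 1 + S * y₁ → C = 1 - r ^ 2 * E →
        ((∃ x, IsDoubleRoot M a E C (y₁ ^ 2 + y₂ ^ 2) x ∧ 0 ≤ (x - r) * u) ↔
          ∃ s, u = U s ∧ y₁ = ϱ s * Real.cos s ∧ y₂ = ϱ s * Real.sin s) := by
  obtain ⟨X, hXc, hX, hFX, hXF⟩ := exists_photonRatio_inverse (b := b) ha haM hb
  have hp := rPlus_pos ha haM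
  have h1 := rPlus_sub_pos ha haM
  have hr0 : 0 < r := hp.trans hr
  have hDr := Delta_pos ha haM hr
  set den : ℝ → ℝ := fun x => r ^ 2 - photonOffset M a x with hden
  have hden0 : ∀ x, rPlus M a < x → 0 < den x := fun x hx => by
    have := photonOffset_lt ha haM hx
    have : rPlus M a ^ 2 < r ^ 2 := by gcongr
    simp only [hden]; linarith
  set G : ℝ → ℝ := fun x => (r + x) ^ 2 - 4 * M * x * Delta M a x / (x - M) ^ 2 with hG
  have hG0 : ∀ x, rPlus M a < x → 0 < G x := fun x hx => factor_pos ha haM hx hr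
  set ϱX : ℝ → ℝ := fun x => photonRoot M a x / den x with hϱX
  set UX : ℝ → ℝ := fun x => (x - r) * √(G x) / den x with hUX
  have hdenC : ∀ x, rPlus M a < x → ContDiffAt ℝ ∞ den x := fun x hx =>
    contDiffAt_const.sub (contDiffAt_photonOffset (by linarith))
  have hϱC : ∀ x, rPlus M a < x → ContDiffAt ℝ ∞ ϱX x := fun x hx =>
    (contDiffAt_photonRoot ha haM hx).div (hdenC x hx) (hden0 x hx).ne'
  have hGC : ∀ x, rPlus M a < x → ContDiffAt ℝ ∞ G x := fun x hx => by
    have : (x - M) ^ 2 ≠ 0 := pow_ne_zero 2 (by linarith)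
    simp only [hG, Delta]
    exact ContDiffAt.sub (by fun_prop) (ContDiffAt.div (by fun_prop) (by fun_prop) this)
  have hUC : ∀ x, rPlus M a < x → ContDiffAt ℝ ∞ UX x := fun x hx =>
    ((contDiffAt_id.sub contDiffAt_const).mul ((hGC x hx).sqrt (hG0 x hx).ne')).div (hdenC x hx)
      (hden0 x hx).ne'
  have hϱ0 : ∀ x, rPlus M a < x → 0 < ϱX x := fun x hx =>
    div_pos (photonRoot_pos ha haM hx) (hden0 x hx)
  -- the radial equation at the double root `x`, with `E = 1 / den x`
  have hsq : ∀ x, rPlus M a < x → UX x ^ 2 + Delta M a r * ϱX x ^ 2 = 1 := fun x hx => by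
    have hE := inv_pos.2 (hden0 x hx)
    obtain ⟨-, -, h2, h3⟩ := (isDoubleRoot_iff ha haM hx hE).2 ⟨rfl, rfl⟩
    have h4 := radial_eq_sq_mul ha haM hx h2 h3 r
    have h5 : -photonOffset M a x * (den x)⁻¹ + r ^ 2 * (den x)⁻¹ = 1 := by
      have := (hden0 x hx).ne'
      field_simp
      simp only [hden]; ring
    rw [h5] at h4
    have h6 := Real.sq_sqrt (hG0 x hx).le
    simp only [hUX, hϱX, div_eq_mul_inv]
    rw [mul_pow, mul_pow, h6]
    linear_combination -h4
  have hY : ContDiff ℝ ∞ fun s => X (S * Real.cos s) :=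
    hXc.comp (contDiff_const.mul Real.contDiff_cos)
  refine ⟨fun s => UX (X (S * Real.cos s)), fun s => ϱX (X (S * Real.cos s)),
    contDiff_iff_contDiffAt.2 fun s =>
      ContDiffAt.comp (g := UX) (f := fun s => X (S * Real.cos s)) s (hUC _ (hX _)) hY.contDiffAt,
    contDiff_iff_contDiffAt.2 fun s =>
      ContDiffAt.comp (g := ϱX) (f := fun s => X (S * Real.cos s)) s (hϱC _ (hX _)) hY.contDiffAt,
    fun s => by simp only [Real.cos_add_two_pi], fun s => by simp only [Real.cos_add_two_pi],
    fun s => hϱ0 _ (hX _), fun s => hsq _ (hX _), ?_⟩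
  intro u y₁ y₂ E C hu hE hC
  -- `E` and `C` at a double root `x`
  have hEC : ∀ x, rPlus M a < x → (C = -photonOffset M a x * E ↔ E = (den x)⁻¹) := by
    intro x hx
    have := (hden0 x hx).ne'
    rw [← one_div, eq_div_iff this, hC]
    simp only [hden]
    constructor <;> intro h <;> linear_combination -h
  constructor
  · rintro ⟨x, hx, hxu⟩
    have hxr := hx.gt
    obtain ⟨h2, h3⟩ := (isDoubleRoot_iff ha haM hxr hx.E_pos).1 hx
    rw [hEC x hxr] at h2
    have hϱ : ϱX x = photonRoot M a x * E := by rw [h2]; rfl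
    rw [← hϱ] at h3
    obtain ⟨s, hs1, hs2⟩ : ∃ s, y₁ = ϱX x * Real.cos s ∧ y₂ = ϱX x * Real.sin s := by
      have hn : ‖(⟨y₁, y₂⟩ : ℂ)‖ = ϱX x := by
        rw [Complex.norm_eq_sqrt_sq_add_sq, h3, Real.sqrt_sq (hϱ0 x hxr).le]
      refine ⟨Complex.arg ⟨y₁, y₂⟩, ?_, ?_⟩
      · rw [← hn, Complex.norm_mul_cos_arg]
      · rw [← hn, Complex.norm_mul_sin_arg]
    have hxs : X (S * Real.cos s) = x := by
      rw [← hXF x hxr]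
      congr 1
      have hk := (photonRoot_pos ha haM hxr).ne'
      rw [photonRatio, eq_div_iff hk]
      have hd := (hden0 x hxr).ne'
      rw [h2, hs1] at hE
      simp only [hϱX] at hE
      field_simp at hE
      simp only [hden] at hE
      linear_combination -hE
    refine ⟨s, ?_, by simpa only [hxs] using hs1, by simpa only [hxs] using hs2⟩
    simp only [hxs]
    have h4 : u ^ 2 = UX x ^ 2 := by rw [h3] at hu; linear_combination hu - hsq x hxr
    -- the two solutions of this equation differ by the direction of the radial motion
    have h5 : 0 ≤ (x - r) * UX x := by
      have := (hden0 x hxr).le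
      have e : (x - r) * UX x = (x - r) ^ 2 * √(G x) / den x := by simp only [hUX]; ring
      rw [e]; positivity
    rcases eq_or_ne x r with h6 | h6
    · have h7 : UX x = 0 := by simp only [hUX, h6, sub_self, zero_mul, zero_div]
      rw [h7] at h4 ⊢
      exact pow_eq_zero_iff two_ne_zero |>.1 (by linarith)
    · rcases sq_eq_sq_iff_eq_or_eq_neg.1 h4 with h7 | h7
      · exact h7
      · have h8 : (x - r) * UX x = 0 := le_antisymm (by rw [h7] at hxu; linarith) h5
        have := (mul_eq_zero.1 h8).resolve_left (sub_ne_zero.2 h6)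
        rw [h7, this, neg_zero]
  · rintro ⟨s, hu', hs1, hs2⟩
    beta_reduce at hu' hs1 hs2
    set x := X (S * Real.cos s) with hxdef
    have hxr : rPlus M a < x := hX _
    have hk := (photonRoot_pos ha haM hxr).ne'
    have hd := hden0 x hxr
    have hFs : (b + photonOffset M a x) = S * Real.cos s * photonRoot M a x := by
      rw [← div_eq_iff hk]; exact hFX _
    have h2 : E = (den x)⁻¹ := by
      have hb0 : 0 < r ^ 2 + b := by positivity
      refine mul_left_cancel₀ hb0.ne' ?_
      rw [hE, hs1]
      simp only [hϱX]
      field_simp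
      simp only [hden]
      linear_combination -hFs
    have h3 : y₁ ^ 2 + y₂ ^ 2 = (photonRoot M a x * E) ^ 2 := by
      have := Real.sin_sq_add_cos_sq s
      have e : photonRoot M a x * E = ϱX x := by rw [h2]; rfl
      rw [e, hs1, hs2]
      linear_combination ϱX x ^ 2 * this
    refine ⟨x, (isDoubleRoot_iff ha haM hxr (h2 ▸ inv_pos.2 hd)).2 ⟨(hEC x hxr).2 h2, h3⟩, ?_⟩
    have e : (x - r) * UX x = (x - r) ^ 2 * √(G x) / den x := by simp only [hUX]; ring
    rw [hu', e]
    positivity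

end

/-! ### The principal frame -/

section

variable {M a : ℝ} {x : Coord}

/-- The momentum functional `prinMom` as a linear map. -/
def prinMomForm (M a : ℝ) (x : Coord) : Coord →ₗ[ℝ] ℝ where
  toFun := prinMom M a x
  map_add' v w := by simp only [prinMom, omegaT, sinSqDphi_add, Pi.add_apply]; ring
  map_smul' c v := by
    simp only [prinMom, omegaT, sinSqDphi_smul, Pi.smul_apply, smul_eq_mul, RingHom.id_apply]
    ring

/-- The radial momentum `radMom` as a linear map. -/
def radMomForm (a : ℝ) (x : Coord) : Coord →ₗ[ℝ] ℝ where
  toFun := radMom a x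
  map_add' v w := by simp only [radMom, dr_add]; ring
  map_smul' c v := by simp only [radMom, dr_smul, smul_eq_mul, RingHom.id_apply]; ring

/-- Up to scaling, the four one-forms `prinMom`, `radMom`, `y₁`, `y₂` are an orthonormal coframe,
the first two spanning the plane of the principal null directions; `y₁` is the component of the
momentum along the axial direction of this frame, and `S = a sin θ`. -/
structure IsPrincipalCoframe (M a : ℝ) (x : Coord) (S : ℝ) (y₁ y₂ : Coord →ₗ[ℝ] ℝ) : Prop where
  energy_eq : ∀ v, Sig a x * energy M a x v = prinMom M a x v + S * y₁ v
  metric_eq : ∀ v w, Sig a x * Delta M a (rad x) * metric M a x v w =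
    -(prinMom M a x v * prinMom M a x w) + radMom a x v * radMom a x w
      + Delta M a (rad x) * (y₁ v * y₁ w + y₂ v * y₂ w)

/-- Away from the rotation axis the form `y₁` is `omegaPhi / sin θ` and `y₂` is `Σ dθ`, while on
the axis they are multiples of `dX` and `dY`. -/
theorem exists_isPrincipalCoframe (ha : 0 ≤ a) (haM : a < M) (hx : x ∈ exterior M a) :
    ∃ S y₁ y₂, IsPrincipalCoframe M a x S y₁ y₂ := by
  have hr := rad_pos_of_mem ha haM hx
  have hD := (Delta_pos_of_mem ha haM hx).ne'
  have hS := (Sig_pos (a := a) hr).ne'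
  have hSe := Sig_eq (a := a) hr
  have h0 : ∀ v : Coord, v 0 = omegaT a x v + a * sinSqDphi x v := fun v => by
    simp only [omegaT]; ring
  have h2 := rad_sq x
  have hDe : Delta M a (rad x) = rad x ^ 2 - 2 * M * rad x + a ^ 2 := rfl
  rcases (show 0 ≤ x 1 ^ 2 + x 2 ^ 2 by positivity).eq_or_lt with hax | hax
  · have hx1 : x 1 = 0 := by nlinarith
    have hx2 : x 2 = 0 := by nlinarith
    have hσ : ∀ v, sinSqDphi x v = 0 := fun v => by simp only [sinSqDphi, hx1, hx2]; simp
    have hs : sinSq x = 0 := by simp only [sinSq, hx1, hx2]; simp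
    have hW : ∀ v w, rad x ^ 2 * sphereForm x v w = v 1 * w 1 + v 2 * w 2 := fun v w => by
      rw [hx1, hx2] at h2
      simp only [sphereForm, dr, hx1, hx2]
      field_simp
      rw [h2]; ring
    refine ⟨0, (Sig a x / rad x) • LinearMap.proj 1, (Sig a x / rad x) • LinearMap.proj 2,
      fun v => ?_, fun v w => ?_⟩
    · rw [Sig_mul_energy hr, omegaPhi, hσ, hs]; ring
    · rw [metric_eq hr, h0 v, h0 w, hσ, hσ]
      simp only [LinearMap.smul_apply, LinearMap.proj_apply, smul_eq_mul, prinMom, radMom]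
      have := hW v w
      rw [hs] at hSe
      field_simp
      linear_combination Delta M a (rad x) * Sig a x ^ 2 * this
        + (omegaT a x v * omegaT a x w * Delta M a (rad x) * rad x ^ 2) * hDe
        - (omegaT a x v * omegaT a x w * Delta M a (rad x) * rad x ^ 2) * hSe
  · set ρ := √(x 1 ^ 2 + x 2 ^ 2) with hρ
    have hρ2 : ρ ^ 2 = x 1 ^ 2 + x 2 ^ 2 := Real.sq_sqrt hax.le
    have hρ0 : ρ ≠ 0 := (Real.sqrt_pos.2 hax).ne'
    have hs : sinSq x = ρ ^ 2 / rad x ^ 2 := by rw [hρ2]; rfl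
    have hW : ∀ v w, ρ ^ 2 * sphereForm x v w = rad x ^ 2 * (sinSqDphi x v * sinSqDphi x w)
        + ((x 1 * v 1 + x 2 * v 2) * x 3 - ρ ^ 2 * v 3)
          * ((x 1 * w 1 + x 2 * w 2) * x 3 - ρ ^ 2 * w 3) / rad x ^ 4 := fun v w => by
      simp only [sphereForm, sinSqDphi, dr, hρ2]
      field_simp
      rw [h2]; ring
    refine ⟨a * (ρ / rad x),
      { toFun := fun v => rad x / ρ * omegaPhi a x v
        map_add' := fun v w => by
          simp only [omegaPhi, omegaT, sinSqDphi_add, Pi.add_apply]; ring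
        map_smul' := fun c v => by
          simp only [omegaPhi, omegaT, sinSqDphi_smul, Pi.smul_apply, smul_eq_mul,
            RingHom.id_apply]
          ring },
      { toFun := fun v =>
          Sig a x * (((x 1 * v 1 + x 2 * v 2) * x 3 - ρ ^ 2 * v 3) / (ρ * rad x ^ 2))
        map_add' := fun v w => by simp only [Pi.add_apply]; ring
        map_smul' := fun c v => by
          simp only [Pi.smul_apply, smul_eq_mul, RingHom.id_apply]; ring }, fun v => ?_,
      fun v w => ?_⟩
    · rw [Sig_mul_energy hr]
      simp only [LinearMap.coe_mk, AddHom.coe_mk]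
      field_simp
    · have := hW v w
      rw [metric_eq hr, h0 v, h0 w]
      simp only [LinearMap.coe_mk, AddHom.coe_mk, prinMom, radMom, omegaPhi, hs]
      rw [hs] at hSe
      generalize sinSqDphi x v = σ₁ at *
      generalize sinSqDphi x w = σ₂ at *
      generalize omegaT a x v = ω₁ at *
      generalize omegaT a x w = ω₂ at *
      generalize sphereForm x v w = W at *
      generalize (x 1 * v 1 + x 2 * v 2) * x 3 - ρ ^ 2 * v 3 = t₁ at *
      generalize (x 1 * w 1 + x 2 * w 2) * x 3 - ρ ^ 2 * w 3 = t₂ at *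
      have hWe : W = (rad x ^ 2 * (σ₁ * σ₂) + t₁ * t₂ / rad x ^ 4) / ρ ^ 2 := by
        rw [eq_div_iff (pow_ne_zero 2 hρ0)]; linear_combination this
      have hωω : Sig a x * Delta M a (rad x) * (2 * M * rad x / Sig a x * (ω₁ * ω₂))
          = (Sig a x - Delta M a (rad x) + a ^ 2 * (ρ ^ 2 / rad x ^ 2))
            * Delta M a (rad x) * (ω₁ * ω₂) := by
        have hT : 2 * M * rad x = Sig a x - Delta M a (rad x) + a ^ 2 * (ρ ^ 2 / rad x ^ 2) := by
          linear_combination hDe - hSe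
        rw [← hT]
        field_simp
      have hdr : Sig a x * Delta M a (rad x)
          * (Sig a x / Delta M a (rad x) * (dr x v * dr x w))
          = Sig a x * dr x v * (Sig a x * dr x w) := by
        field_simp
      rw [hWe, mul_add, mul_add, mul_add, hωω, hdr]
      field_simp
      ring

theorem IsPrincipalCoframe.carter_eq {S : ℝ} {y₁ y₂ : Coord →ₗ[ℝ] ℝ}
    (h : IsPrincipalCoframe M a x S y₁ y₂) (hD : Delta M a (rad x) ≠ 0) {v : Coord}
    (hv : metric M a x v v = 0) : carter M a x v = y₁ v ^ 2 + y₂ v ^ 2 := by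
  have := h.metric_eq v v
  rw [hv, mul_zero] at this
  rw [carter, div_eq_iff hD]
  linear_combination this

theorem IsPrincipalCoframe.exists_linearEquiv (ha : 0 ≤ a) (haM : a < M) (hx : x ∈ exterior M a)
    {S : ℝ} {y₁ y₂ : Coord →ₗ[ℝ] ℝ} (h : IsPrincipalCoframe M a x S y₁ y₂) :
    ∃ L : Coord ≃ₗ[ℝ] Coord, ∀ v, L v = ![prinMom M a x v, radMom a x v, y₁ v, y₂ v] := by
  have hD := Delta_pos_of_mem ha haM hx
  have hS := Sig_pos (a := a) (rad_pos_of_mem ha haM hx)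
  set f : Coord →ₗ[ℝ] Coord := LinearMap.pi ![prinMomForm M a x, radMomForm a x, y₁, y₂] with hf
  have hinj : Function.Injective f := by
    rw [injective_iff_map_eq_zero]
    intro v hv
    have h0 : prinMom M a x v = 0 := congrFun hv 0
    have h1 : radMom a x v = 0 := congrFun hv 1
    have h2 : y₁ v = 0 := congrFun hv 2
    have h3 : y₂ v = 0 := congrFun hv 3
    refine metric_nondegenerate ha haM hx fun w => ?_
    have := h.metric_eq v w
    rw [h0, h1, h2, h3] at this
    have h4 : Sig a x * Delta M a (rad x) ≠ 0 := by positivity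
    refine (mul_eq_zero.1 (this.trans ?_)).resolve_left h4
    ring
  refine ⟨LinearEquiv.ofInjectiveEndo f hinj, fun v => ?_⟩
  rw [LinearEquiv.coe_ofInjectiveEndo]
  ext i
  fin_cases i <;> rfl

/-- The reversed Cauchy-Schwarz inequality for a future directed null vector and a future directed
timelike vector. -/
theorem metric_neg_of_future (ha : 0 ≤ a) (haM : a < M) (hx : x ∈ exterior M a) {v w : Coord}
    (hv : metric M a x v v = 0) (hw : metric M a x w w < 0) (hPv : 0 < prinMom M a x v)
    (hPw : 0 < prinMom M a x w) : metric M a x v w < 0 := by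
  obtain ⟨S, y₁, y₂, h⟩ := exists_isPrincipalCoframe ha haM hx
  have hD := Delta_pos_of_mem ha haM hx
  have hS := Sig_pos (a := a) (rad_pos_of_mem ha haM hx)
  have hSD : 0 < Sig a x * Delta M a (rad x) := by positivity
  have e1 := h.metric_eq v v
  have e2 := h.metric_eq w w
  have e3 := h.metric_eq v w
  rw [hv, mul_zero] at e1
  have e4 : Sig a x * Delta M a (rad x) * metric M a x w w < 0 := mul_neg_of_pos_of_neg hSD hw
  generalize prinMom M a x v = P at *
  generalize prinMom M a x w = P' at *
  generalize radMom a x v = u at *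
  generalize radMom a x w = u' at *
  generalize y₁ v = y at *
  generalize y₁ w = y' at *
  generalize y₂ v = z at *
  generalize y₂ w = z' at *
  generalize Delta M a (rad x) = D at *
  have hlt : (u * u' + D * (y * y' + z * z')) ^ 2 < (P * P') ^ 2 := by
    have c1 : (u * u' + D * (y * y' + z * z')) ^ 2 ≤
        (u ^ 2 + D * (y ^ 2 + z ^ 2)) * (u' ^ 2 + D * (y' ^ 2 + z' ^ 2)) := by
      have : 0 ≤ D * (u * y' - y * u') ^ 2 + D * (u * z' - z * u') ^ 2
          + D ^ 2 * (y * z' - z * y') ^ 2 := by positivity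
      linarith
    have c2 : u ^ 2 + D * (y ^ 2 + z ^ 2) = P ^ 2 := by linear_combination -e1
    have c3 : u' ^ 2 + D * (y' ^ 2 + z' ^ 2) < P' ^ 2 := by linarith
    rw [c2] at c1
    rw [mul_pow]
    exact c1.trans_lt (mul_lt_mul_of_pos_left c3 (by positivity))
  have h5 := (abs_lt_of_sq_lt_sq' hlt (by positivity)).2
  have h6 : Sig a x * D * metric M a x v w < 0 := by rw [e3]; linarith
  exact neg_of_mul_neg_right h6 hSD.le

end

/-! ### Observers -/

section

variable {M a : ℝ} {p : Coord} {e : Fin 4 → Coord}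

theorem IsObserverFrame.prinMom_pos (ha : 0 ≤ a) (haM : a < M) (hp : p ∈ exterior M a)
    (he : IsObserverFrame M a p e) : 0 < prinMom M a p (e 0) := by
  have := he.future
  rw [metric_timeVector (rad_pos_of_mem ha haM hp)] at this
  linarith

theorem map_nullVector (f : Coord →ₗ[ℝ] ℝ) (k : EuclideanSpace ℝ (Fin 3)) :
    f (nullVector e k) = f (e 0) + ∑ i, k i * f (e i.succ) := by
  simp only [nullVector, map_add, map_sum, map_smul, smul_eq_mul]

theorem metric_nullVector_zero (he : IsObserverFrame M a p e) (k : EuclideanSpace ℝ (Fin 3)) :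
    metric M a p (nullVector e k) (e 0) = -1 := by
  rw [metric_comm, ← metricForm_apply, map_nullVector]
  simp only [metricForm_apply, he.orthonormal]
  simp [(Fin.succ_ne_zero _).symm]

theorem metric_nullVector_succ (he : IsObserverFrame M a p e) (k : EuclideanSpace ℝ (Fin 3))
    (j : Fin 3) : metric M a p (nullVector e k) (e j.succ) = k j := by
  rw [metric_comm, ← metricForm_apply, map_nullVector]
  simp only [metricForm_apply, he.orthonormal]
  simp [Fin.succ_ne_zero]

theorem metric_nullVector_self (he : IsObserverFrame M a p e) (k : EuclideanSpace ℝ (Fin 3)) :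
    metric M a p (nullVector e k) (nullVector e k) = -1 + ∑ i, k i ^ 2 := by
  rw [← metricForm_apply, map_nullVector]
  simp only [metricForm_apply, metric_nullVector_zero he, metric_nullVector_succ he, sq]

theorem mem_celestialSphere_iff (k : EuclideanSpace ℝ (Fin 3)) :
    k ∈ celestialSphere ↔ ∑ i, k i ^ 2 = 1 := by
  rw [mem_sphere_zero_iff_norm, EuclideanSpace.norm_eq, Real.sqrt_eq_one]
  simp only [Real.norm_eq_abs, sq_abs]

theorem IsObserverFrame.exists_eq_sum (he : IsObserverFrame M a p e) (w : Coord) :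
    ∃ c : Fin 4 → ℝ, w = ∑ i, c i • e i := by
  have hinj : Function.Injective (Fintype.linearCombination ℝ e) := by
    rw [injective_iff_map_eq_zero]
    intro c hc
    ext j
    have h1 : metricForm M a p (e j) (∑ i, c i • e i) = 0 := by
      rw [← Fintype.linearCombination_apply, hc, map_zero]
    simp only [map_sum, map_smul, smul_eq_mul, metricForm_apply, he.orthonormal] at h1
    simp only [mul_ite, mul_zero, Finset.sum_ite_eq, Finset.mem_univ, if_true] at h1
    split_ifs at h1 <;> simpa using h1
  obtain ⟨c, hc⟩ := LinearMap.injective_iff_surjective.1 hinj w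
  exact ⟨c, by rw [← hc, Fintype.linearCombination_apply]⟩

/-- The direction in which an observer with frame `e` sees the vector `w`. -/
def viewDir (M a : ℝ) (p : Coord) (e : Fin 4 → Coord) (w : Coord) : EuclideanSpace ℝ (Fin 3) :=
  WithLp.toLp 2 fun i => metric M a p w (e i.succ) / -metric M a p w (e 0)

theorem eq_smul_nullVector (he : IsObserverFrame M a p e) {w : Coord}
    (hw : metric M a p w (e 0) ≠ 0) :
    w = (-metric M a p w (e 0)) • nullVector e (viewDir M a p e w) := by
  obtain ⟨c, hc⟩ := he.exists_eq_sum w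
  have hcj : ∀ j, metric M a p w (e j) = c j * if j = 0 then -1 else 1 := fun j => by
    rw [metric_comm, ← metricForm_apply, hc]
    simp only [map_sum, map_smul, smul_eq_mul, metricForm_apply, he.orthonormal]
    simp only [mul_ite, mul_zero, Finset.sum_ite_eq, Finset.mem_univ, if_true]
  have h0 : -metric M a p w (e 0) = c 0 := by rw [hcj]; simp
  have hc0 : c 0 ≠ 0 := by rw [← h0]; exact neg_ne_zero.2 hw
  have hv : ∀ i, viewDir M a p e w i = c i.succ / c 0 := fun i => by
    rw [← h0]
    simp only [viewDir, hcj i.succ, Fin.succ_ne_zero, if_false, mul_one]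
  rw [h0, nullVector, smul_add, Finset.smul_sum]
  simp only [hv, smul_smul, mul_div_cancel₀ _ hc0]
  rw [hc, Fin.sum_univ_succ]

theorem viewDir_nullVector (he : IsObserverFrame M a p e) (k : EuclideanSpace ℝ (Fin 3)) (c : ℝ)
    (hc : c ≠ 0) : viewDir M a p e (c • nullVector e k) = k := by
  ext i
  have hsm : ∀ j, metric M a p (c • nullVector e k) (e j)
      = c * metric M a p (nullVector e k) (e j) := fun j => by
    simp only [← metricForm_apply, map_smul, LinearMap.smul_apply, smul_eq_mul]
  simp only [viewDir, hsm, metric_nullVector_zero he, metric_nullVector_succ he]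
  field_simp

theorem viewDir_mem_celestialSphere (he : IsObserverFrame M a p e) {w : Coord}
    (hw : metric M a p w w = 0) (hw0 : metric M a p w (e 0) ≠ 0) :
    viewDir M a p e w ∈ celestialSphere := by
  rw [mem_celestialSphere_iff]
  have h1 := hw
  rw [eq_smul_nullVector he hw0] at h1
  simp only [← metricForm_apply, map_smul, LinearMap.smul_apply, smul_eq_mul] at h1
  simp only [metricForm_apply, metric_nullVector_self he] at h1
  have h2 := neg_ne_zero.2 hw0
  have h3 := (mul_eq_zero.1 ((mul_eq_zero.1 h1).resolve_left h2)).resolve_left h2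
  linarith

/-- The null vectors `e₀ + k₁ e₁ + k₂ e₂ + k₃ e₃` are future directed. -/
theorem prinMom_nullVector_pos (ha : 0 ≤ a) (haM : a < M) (hp : p ∈ exterior M a)
    (he : IsObserverFrame M a p e) {k : EuclideanSpace ℝ (Fin 3)} (hk : k ∈ celestialSphere) :
    0 < prinMom M a p (nullVector e k) := by
  have h0 := metric_nullVector_zero he k
  have hn : metric M a p (nullVector e k) (nullVector e k) = 0 := by
    rw [metric_nullVector_self he, (mem_celestialSphere_iff k).1 hk]; ring
  by_contra hneg
  rcases (not_lt.1 hneg).eq_or_lt with h | h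
  · obtain ⟨S, y₁, y₂, hf⟩ := exists_isPrincipalCoframe ha haM hp
    have hD := Delta_pos_of_mem ha haM hp
    have h1 := hf.metric_eq (nullVector e k) (nullVector e k)
    have h2 := hf.metric_eq (nullVector e k) (e 0)
    rw [hn, h, mul_zero] at h1
    have hu : radMom a p (nullVector e k) = 0 := by
      nlinarith [mul_nonneg hD.le (sq_nonneg (y₁ (nullVector e k))),
        mul_nonneg hD.le (sq_nonneg (y₂ (nullVector e k)))]
    have hy : y₁ (nullVector e k) ^ 2 + y₂ (nullVector e k) ^ 2 = 0 := by
      refine (mul_eq_zero.1 (?_ : Delta M a (rad p) * _ = 0)).resolve_left hD.ne'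
      rw [hu] at h1
      linear_combination -h1
    have hy1 : y₁ (nullVector e k) = 0 := by nlinarith [sq_nonneg (y₂ (nullVector e k))]
    have hy2 : y₂ (nullVector e k) = 0 := by nlinarith [sq_nonneg (y₁ (nullVector e k))]
    rw [h, hu, hy1, hy2, h0] at h2
    have : 0 < Sig a p * Delta M a (rad p) :=
      mul_pos (Sig_pos (rad_pos_of_mem ha haM hp)) hD
    linarith
  · have hm : ∀ w, metric M a p (-nullVector e k) w = -metric M a p (nullVector e k) w :=
      fun w => by simp only [← metricForm_apply, map_neg, LinearMap.neg_apply]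
    have hP : 0 < prinMom M a p (-nullVector e k) := by
      have : prinMom M a p (-nullVector e k) = -prinMom M a p (nullVector e k) :=
        map_neg (prinMomForm M a p) _
      linarith
    have h00 : metric M a p (e 0) (e 0) < 0 := by rw [he.orthonormal]; norm_num
    have := metric_neg_of_future ha haM hp (v := -nullVector e k)
      (by rw [hm, metric_comm, hm, hn]; simp) h00 hP (he.prinMom_pos ha haM hp)
    rw [hm, h0] at this
    linarith

theorem IsTrappedVector.smul {c : ℝ}
    {w : Coord} (h : IsTrappedVector M a p w) (hc : 0 < c) : IsTrappedVector M a p (c • w) := by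
  obtain ⟨b, hb, hu⟩ := h
  have eP : prinMom M a p (c • w) = c * prinMom M a p w := map_smul (prinMomForm M a p) c w
  have eu : radMom a p (c • w) = c * radMom a p w := map_smul (radMomForm a p) c w
  have eE : energy M a p (c • w) = c * energy M a p w := by
    simp only [energy, omegaT, sinSqDphi_smul, Pi.smul_apply, smul_eq_mul]; ring
  have eC : offset M a p (c • w) = c * offset M a p w := by simp only [offset, eP, eE]; ring
  have eK : carter M a p (c • w) = c ^ 2 * carter M a p w := by simp only [carter, eP, eu]; ring
  refine ⟨b, ⟨hb.gt, ?_, ?_, ?_⟩, ?_⟩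
  · rw [eE]; exact mul_pos hc hb.E_pos
  · rw [eE, eC]; linear_combination c * hb.crit
  · rw [eE, eC, eK]; linear_combination c ^ 2 * hb.root
  · rw [eu]
    have := mul_nonneg hc.le hu
    linarith

end

/-! ### The trapped directions form a smooth closed curve -/

section

variable {M a : ℝ} {p : Coord} {e : Fin 4 → Coord}

theorem futureTrappedSet_eq (ha : 0 ≤ a) (haM : a < M) (hp : p ∈ exterior M a)
    (he : IsObserverFrame M a p e) : futureTrappedSet M a p e =
      {k ∈ celestialSphere | IsTrappedVector M a p (nullVector e k)} := by
  ext k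
  refine and_congr_right fun hk => not_meets_iff ha haM hp ?_
    (prinMom_nullVector_pos ha haM hp he hk)
  rw [metric_nullVector_self he, (mem_celestialSphere_iff k).1 hk]
  ring

/-- The curve is regular because the angle of the transverse momentum `(y₁, y₂)` is the curve
parameter and depends only on the direction. -/
theorem isSmoothClosedCurve_futureTrappedSet (ha : 0 ≤ a) (haM : a < M) (hp : p ∈ exterior M a)
    (he : IsObserverFrame M a p e) : IsSmoothClosedCurve (futureTrappedSet M a p e) := by
  have hr := rad_pos_of_mem ha haM hp
  have hD := Delta_pos_of_mem ha haM hp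
  have hS := Sig_pos (a := a) hr
  obtain ⟨S, y₁, y₂, hf⟩ := exists_isPrincipalCoframe ha haM hp
  obtain ⟨L, hL⟩ := hf.exists_linearEquiv ha haM hp
  obtain ⟨U, ϱ, hUc, hϱc, hUp, hϱp, hϱ0, hsq, htr⟩ := exists_trapped_param ha haM
    (b := Sig a p - rad p ^ 2) (sub_nonneg.2 (rad_sq_le_Sig p)) S hp
  set w : ℝ → Coord := fun s => L.symm ![1, U s, ϱ s * Real.cos s, ϱ s * Real.sin s] with hw
  have hLw : ∀ s, L (w s) = ![1, U s, ϱ s * Real.cos s, ϱ s * Real.sin s] := fun s =>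
    L.apply_symm_apply _
  have hwP : ∀ s, prinMom M a p (w s) = 1 := fun s => by
    have := congrFun (hLw s) 0; rwa [hL] at this
  have hwu : ∀ s, radMom a p (w s) = U s := fun s => by
    have := congrFun (hLw s) 1; rwa [hL] at this
  have hw1 : ∀ s, y₁ (w s) = ϱ s * Real.cos s := fun s => by
    have := congrFun (hLw s) 2; rwa [hL] at this
  have hw2 : ∀ s, y₂ (w s) = ϱ s * Real.sin s := fun s => by
    have := congrFun (hLw s) 3; rwa [hL] at this
  have hnull : ∀ s, metric M a p (w s) (w s) = 0 := fun s => by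
    have h1 := hf.metric_eq (w s) (w s)
    rw [hwP, hwu, hw1, hw2] at h1
    refine (mul_eq_zero.1 (h1.trans ?_)).resolve_left (mul_pos hS hD).ne'
    linear_combination hsq s + Delta M a (rad p) * ϱ s ^ 2 * Real.sin_sq_add_cos_sq s
  have hneg : ∀ s, metric M a p (w s) (e 0) < 0 := fun s =>
    metric_neg_of_future ha haM hp (hnull s) (by rw [he.orthonormal]; norm_num)
      (by rw [hwP]; exact one_pos) (he.prinMom_pos ha haM hp)
  -- the trapped vectors in the section `P = 1` of the light cone
  have hsec : ∀ v, metric M a p v v = 0 → prinMom M a p v = 1 →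
      (IsTrappedVector M a p v ↔ ∃ s, v = w s) := by
    intro v hv hP
    have h1 := hf.metric_eq v v
    rw [hv, hP, mul_zero] at h1
    have h2 : radMom a p v ^ 2 + Delta M a (rad p) * (y₁ v ^ 2 + y₂ v ^ 2) = 1 := by
      linear_combination -h1
    have h3 : (rad p ^ 2 + (Sig a p - rad p ^ 2)) * energy M a p v = 1 + S * y₁ v := by
      rw [← hP, ← hf.energy_eq]; ring
    have h4 := htr (radMom a p v) (y₁ v) (y₂ v) (energy M a p v) (offset M a p v) h2 h3
      (by rw [← hP]; rfl)
    rw [IsTrappedVector, hf.carter_eq hD.ne' hv, h4]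
    refine exists_congr fun s => ⟨fun ⟨g1, g2, g3⟩ => ?_, fun h => ?_⟩
    · apply L.injective
      rw [hLw, hL, hP, g1, g2, g3]
    · rw [h, hwu, hw1, hw2]; exact ⟨rfl, rfl, rfl⟩
  set c : ℝ → EuclideanSpace ℝ (Fin 3) := fun s => viewDir M a p e (w s) with hc
  have hcw : ∀ s, w s = (-metric M a p (w s) (e 0)) • nullVector e (c s) := fun s =>
    eq_smul_nullVector he (hneg s).ne
  have hcs : ∀ s, c s ∈ celestialSphere := fun s =>
    viewDir_mem_celestialSphere he (hnull s) (hneg s).ne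
  have hwc : ContDiff ℝ ∞ w := by
    have h1 : ContDiff ℝ ∞ fun s => (![1, U s, ϱ s * Real.cos s, ϱ s * Real.sin s] : Coord) := by
      refine contDiff_pi.2 fun i => ?_
      have g0 : ContDiff ℝ ∞ fun _ : ℝ => (1 : ℝ) := contDiff_const
      have g2 := hϱc.mul Real.contDiff_cos
      have g3 := hϱc.mul Real.contDiff_sin
      fin_cases i
      exacts [g0, hUc, g2, g3]
    exact L.symm.toContinuousLinearEquiv.contDiff.comp h1
  have hgc : ∀ v, ContDiff ℝ ∞ fun s => metric M a p (w s) v := fun v => by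
    have h1 := (LinearMap.toContinuousLinearMap (metricForm M a p v)).contDiff (n := ∞)
    have h2 := h1.comp hwc
    have h3 : (fun s => metric M a p (w s) v)
        = LinearMap.toContinuousLinearMap (metricForm M a p v) ∘ w :=
      funext fun s => metric_comm M a p _ _
    rwa [h3]
  have hcc : ContDiff ℝ ∞ c := by
    rw [contDiff_euclidean]
    exact fun i => (hgc _).div (hgc _).neg fun s => (neg_pos.2 (hneg s)).ne'
  have hyn : ∀ s, ∀ f : Coord →ₗ[ℝ] ℝ, f (w s)
      = f (nullVector e (c s)) / prinMomForm M a p (nullVector e (c s)) := fun s f => by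
    have hPn : 0 < prinMomForm M a p (nullVector e (c s)) :=
      prinMom_nullVector_pos ha haM hp he (hcs s)
    have h1 : prinMomForm M a p (w s) = 1 := hwP s
    rw [hcw s, map_smul, smul_eq_mul] at h1
    rw [eq_div_iff hPn.ne']
    nth_rewrite 1 [hcw s]
    rw [map_smul, smul_eq_mul]
    linear_combination f (nullVector e (c s)) * h1
  refine ⟨c, hcc, fun s => ?_, fun s₀ hs₀ => ?_, fun s hs s' hs' hss => ?_, ?_⟩
  · simp only [hc, hw, hUp s, hϱp s, Real.cos_add_two_pi, Real.sin_add_two_pi]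
  · have hd : HasDerivAt c 0 s₀ := by
      rw [← hs₀]
      exact (hcc.differentiable (by simp) s₀).hasDerivAt
    have hdi : ∀ i, HasDerivAt (fun s => c s i) 0 s₀ := fun i => by
      have := (EuclideanSpace.proj (𝕜 := ℝ) i : EuclideanSpace ℝ (Fin 3) →L[ℝ] ℝ).hasFDerivAt
        |>.comp_hasDerivAt s₀ hd
      exact this.congr_deriv (map_zero _)
    have hfn : ∀ f : Coord →ₗ[ℝ] ℝ, HasDerivAt (fun s => f (nullVector e (c s))) 0 s₀ := by
      intro f
      have h1 := (HasDerivAt.fun_sum fun (i : Fin 3) (_ : i ∈ Finset.univ) =>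
        (hdi i).mul_const (f (e i.succ))).const_add (f (e 0))
      simp only [zero_mul, Finset.sum_const_zero] at h1
      simpa only [map_nullVector] using h1
    have hfw : ∀ f : Coord →ₗ[ℝ] ℝ, HasDerivAt (fun s => f (w s)) 0 s₀ := by
      intro f
      have hPn : 0 < prinMomForm M a p (nullVector e (c s₀)) :=
        prinMom_nullVector_pos ha haM hp he (hcs s₀)
      have h1 := (hfn f).div (hfn (prinMomForm M a p)) hPn.ne'
      simp only [zero_mul, mul_zero, sub_zero, zero_div] at h1
      exact h1.congr_of_eventuallyEq (Eventually.of_forall fun s => hyn s f)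
    have hA := ((hfw y₂).mul_const (Real.cos s₀)).sub ((hfw y₁).mul_const (Real.sin s₀))
    have hB : HasDerivAt (fun s => ϱ s * Real.sin (s - s₀)) (ϱ s₀) s₀ := by
      have h1 := (hϱc.differentiable (by simp) s₀).hasDerivAt
      have h2 := ((hasDerivAt_id s₀).sub_const s₀).sin
      refine (h1.mul h2).congr_deriv ?_
      simp
    have hAB := hA.congr_of_eventuallyEq (f₁ := fun s => ϱ s * Real.sin (s - s₀))
      (Eventually.of_forall fun s => by
        simp only [Pi.sub_apply, hw1, hw2, Real.sin_sub]; ring)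
    have := hB.unique hAB
    simp only [zero_mul, sub_zero] at this
    exact (hϱ0 s₀).ne' this
  · have h1 := hyn s y₁
    have h2 := hyn s y₂
    rw [hss, ← hyn s', hw1, hw1] at h1
    rw [hss, ← hyn s', hw2, hw2] at h2
    have hcs1 := Real.sin_sq_add_cos_sq s
    have hcs2 := Real.sin_sq_add_cos_sq s'
    have h3 : ϱ s ^ 2 = ϱ s' ^ 2 := by
      calc ϱ s ^ 2 = (ϱ s * Real.cos s) ^ 2 + (ϱ s * Real.sin s) ^ 2 := by
            linear_combination -ϱ s ^ 2 * hcs1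
        _ = (ϱ s' * Real.cos s') ^ 2 + (ϱ s' * Real.sin s') ^ 2 := by rw [h1, h2]
        _ = ϱ s' ^ 2 := by linear_combination ϱ s' ^ 2 * hcs2
    have h4 : ϱ s = ϱ s' := (pow_left_inj₀ (hϱ0 s).le (hϱ0 s').le two_ne_zero).1 h3
    rw [h4] at h1 h2
    have h5 := mul_left_cancel₀ (hϱ0 s').ne' h1
    have h6 := mul_left_cancel₀ (hϱ0 s').ne' h2
    have h7 : (s : Real.Angle) = (s' : Real.Angle) := Real.Angle.cos_sin_inj h5 h6
    have hpi := Real.two_pi_pos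
    have := (AddCircle.coe_eq_coe_iff_of_mem_Ico (p := 2 * Real.pi) (hp := ⟨hpi⟩) (a := 0)
      (by simpa using hs) (by simpa using hs')).1 h7
    exact this
  · rw [futureTrappedSet_eq ha haM hp he]
    ext k
    constructor
    · rintro ⟨s, rfl⟩
      refine ⟨hcs s, ?_⟩
      have h1 := (hsec (w s) (hnull s) (hwP s)).2 ⟨s, rfl⟩
      have h2 := neg_pos.2 (hneg s)
      have h3 := h1.smul (inv_pos.2 h2)
      nth_rewrite 2 [hcw s] at h3
      rwa [smul_smul, inv_mul_cancel₀ h2.ne', one_smul] at h3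
    · rintro ⟨hk, ht⟩
      have hP := prinMom_nullVector_pos ha haM hp he hk
      set t := (prinMom M a p (nullVector e k))⁻¹ with htdef
      have ht0 : 0 < t := inv_pos.2 hP
      have h1 : prinMom M a p (t • nullVector e k) = 1 := by
        have : prinMom M a p (t • nullVector e k) = t * prinMom M a p (nullVector e k) :=
          map_smul (prinMomForm M a p) t _
        rw [this, htdef, inv_mul_cancel₀ hP.ne']
      have h2 : metric M a p (t • nullVector e k) (t • nullVector e k) = 0 := by
        simp only [← metricForm_apply, map_smul, LinearMap.smul_apply, smul_eq_mul]
        simp only [metricForm_apply, metric_nullVector_self he, (mem_celestialSphere_iff k).1 hk]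
        ring
      obtain ⟨s, hs⟩ := (hsec _ h2 h1).1 (ht.smul ht0)
      refine ⟨s, ?_⟩
      simp only [hc]
      rw [← hs, viewDir_nullVector he k t ht0.ne']

end

/-! ### Time reversal -/

/-- The components of the isometry `(t, X, Y, Z) ↦ (-t, X, -Y, Z)`. -/
def revSign : Fin 4 → ℝ := ![-1, 1, -1, 1]

theorem revSign_mul_self (i : Fin 4) : revSign i * revSign i = 1 := by
  fin_cases i <;> simp [revSign]

/-- The isometry `(t, X, Y, Z) ↦ (-t, X, -Y, Z)`, i.e. `(t, φ) ↦ (-t, -φ)`, of the exterior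
region; it reverses time. -/
def rev (x : Coord) : Coord := fun i => revSign i * x i

section

variable {M a : ℝ} {x : Coord}

theorem rev_rev (x : Coord) : rev (rev x) = x := by
  ext i
  simp only [rev, ← mul_assoc, revSign_mul_self, one_mul]

theorem rev_zero (x : Coord) : rev x 0 = -x 0 := by simp [rev, revSign]
theorem rev_one (x : Coord) : rev x 1 = x 1 := by simp [rev, revSign]
theorem rev_two (x : Coord) : rev x 2 = -x 2 := by simp [rev, revSign]
theorem rev_three (x : Coord) : rev x 3 = x 3 := by simp [rev, revSign]

theorem rad_rev (x : Coord) : rad (rev x) = rad x := by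
  simp only [rad, rev_one, rev_two, rev_three, neg_sq]

theorem metric_rev (M a : ℝ) (x v w : Coord) :
    metric M a (rev x) (rev v) (rev w) = metric M a x v w := by
  simp only [metric, Sig, dr, sinSqDphi, rad_rev, rev_zero, rev_one, rev_two, rev_three]
  ring

theorem rev_mem_exterior (hx : x ∈ exterior M a) : rev x ∈ exterior M a := by
  change rPlus M a < rad (rev x)
  rw [rad_rev]; exact hx

theorem metricComp_rev (M a : ℝ) (x : Coord) (μ ν : Fin 4) :
    metricComp M a (rev x) μ ν = revSign μ * revSign ν * metricComp M a x μ ν := by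
  have hs : ∀ i : Fin 4, (Pi.single i 1 : Coord) = revSign i • rev (Pi.single i 1) := by
    intro i
    ext j
    simp only [rev, Pi.smul_apply, smul_eq_mul, ← mul_assoc]
    rcases eq_or_ne j i with rfl | h
    · rw [revSign_mul_self, one_mul]
    · simp [h]
  simp only [metricComp, Matrix.of_apply]
  rw [hs μ, hs ν, ← metricForm_apply]
  simp only [map_smul, LinearMap.smul_apply, smul_eq_mul, metricForm_apply, metric_rev]
  rw [← hs μ, ← hs ν]
  ring

theorem dMetricComp_rev (ha : 0 ≤ a) (haM : a < M) (hx : x ∈ exterior M a) (σ μ ν : Fin 4) :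
    dMetricComp M a (rev x) σ μ ν =
      revSign σ * revSign μ * revSign ν * dMetricComp M a x σ μ ν := by
  have hR : HasFDerivAt rev (ContinuousLinearMap.pi fun i =>
      revSign i • ContinuousLinearMap.proj (R := ℝ) (φ := fun _ : Fin 4 => ℝ) i) (rev x) :=
    hasFDerivAt_pi.2 fun i => (hasFDerivAt_apply i (rev x)).const_mul (revSign i)
  have hd : HasFDerivAt (fun y => metricComp M a y μ ν)
      (fderiv ℝ (fun y => metricComp M a y μ ν) x) (rev (rev x)) := by
    rw [rev_rev]
    exact ((contDiffAt_metricComp ha haM hx μ ν).differentiableAt (by simp)).hasFDerivAt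
  have h1 := (hd.comp (rev x) hR).const_mul (revSign μ * revSign ν)
  have h2 : (fun y => metricComp M a y μ ν) =
      fun y => revSign μ * revSign ν * ((fun y => metricComp M a y μ ν) ∘ rev) y := by
    ext y
    simp only [Function.comp_apply, metricComp_rev]
    linear_combination -(metricComp M a y μ ν) * revSign μ * revSign μ * revSign_mul_self ν
      - metricComp M a y μ ν * revSign_mul_self μ
  rw [dMetricComp, h2, h1.fderiv]
  have h3 : (ContinuousLinearMap.pi fun i =>
      revSign i • ContinuousLinearMap.proj (R := ℝ) (φ := fun _ : Fin 4 => ℝ) i)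
      (Pi.single σ 1 : Coord) = revSign σ • (Pi.single σ 1 : Coord) := by
    ext j
    rcases eq_or_ne j σ with rfl | h
    · simp
    · simp [h]
  simp only [smul_apply, ContinuousLinearMap.comp_apply, h3, map_smul,
    smul_eq_mul, dMetricComp]
  ring

theorem metricComp_inv_rev (M a : ℝ) (x : Coord) (κ σ : Fin 4) :
    (metricComp M a (rev x))⁻¹ κ σ = revSign κ * revSign σ * (metricComp M a x)⁻¹ κ σ := by
  have h1 : metricComp M a (rev x)
      = Matrix.diagonal revSign * (metricComp M a x * Matrix.diagonal revSign) := by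
    ext μ ν
    rw [metricComp_rev, Matrix.diagonal_mul, Matrix.mul_diagonal]
    ring
  have h2 : (Matrix.diagonal revSign)⁻¹ = Matrix.diagonal revSign := by
    refine Matrix.inv_eq_right_inv ?_
    rw [Matrix.diagonal_mul_diagonal, ← Matrix.diagonal_one]
    congr 1
    ext i
    exact revSign_mul_self i
  rw [h1, Matrix.mul_inv_rev, Matrix.mul_inv_rev, h2, Matrix.mul_diagonal, Matrix.diagonal_mul]
  ring

theorem christoffel_rev (ha : 0 ≤ a) (haM : a < M) (hx : x ∈ exterior M a) (κ μ ν : Fin 4) :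
    christoffel M a (rev x) κ μ ν =
      revSign κ * revSign μ * revSign ν * christoffel M a x κ μ ν := by
  simp only [christoffel, dMetricComp_rev ha haM hx, metricComp_inv_rev, Finset.mul_sum]
  refine Finset.sum_congr rfl fun σ _ => ?_
  linear_combination 1 / 2 * revSign κ * revSign μ * revSign ν * (metricComp M a x)⁻¹ κ σ *
    (dMetricComp M a x μ σ ν + dMetricComp M a x ν σ μ - dMetricComp M a x σ μ ν)
    * revSign_mul_self σ

theorem hasDerivAt_rev_neg {γ : ℝ → Coord} {v : Coord} {s : ℝ} (h : HasDerivAt γ v (-s)) :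
    HasDerivAt (fun s => rev (γ (-s))) (-rev v) s := by
  refine hasDerivAt_pi.2 fun i => ?_
  refine (((hasDerivAt_pi.1 h i).comp s (hasDerivAt_neg s)).const_mul (revSign i)).congr_deriv ?_
  simp only [Pi.neg_apply, rev]; ring

theorem IsGeodesicFrom.reverse (ha : 0 ≤ a) (haM : a < M) {p w : Coord} {α β : EReal}
    {γ : ℝ → Coord} (h : IsGeodesicFrom M a p w α β γ) :
    IsGeodesicFrom M a (rev p) (-rev w) (-β) (-α) (fun s => rev (γ (-s))) := by
  have hs : ∀ s : ℝ, -β < (s : EReal) → (s : EReal) < -α →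
      α < ((-s : ℝ) : EReal) ∧ ((-s : ℝ) : EReal) < β := fun s h1 h2 => by
    rw [EReal.coe_neg]
    exact ⟨EReal.lt_neg_comm.1 h2, EReal.neg_lt_comm.1 h1⟩
  obtain ⟨v, hv0, hv⟩ := h.ode
  refine ⟨by simpa using h.right_pos, by simpa using h.left_neg, fun s h1 h2 => ?_, ?_,
    fun s => -rev (v (-s)), ?_, fun s h1 h2 => ⟨?_, ?_⟩⟩
  · exact rev_mem_exterior (h.mem_exterior _ (hs s h1 h2).1 (hs s h1 h2).2)
  · simp only [neg_zero, h.init]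
  · simp only [neg_zero, hv0]
  · exact hasDerivAt_rev_neg (hv _ (hs s h1 h2).1 (hs s h1 h2).2).1
  · refine (hasDerivAt_rev_neg (hv _ (hs s h1 h2).1 (hs s h1 h2).2).2).neg.congr_deriv ?_
    have hm := h.mem_exterior _ (hs s h1 h2).1 (hs s h1 h2).2
    ext κ
    simp only [neg_neg, rev, Pi.neg_apply, mul_neg, Finset.mul_sum, neg_inj]
    refine Finset.sum_congr rfl fun μ _ => Finset.sum_congr rfl fun ν _ => ?_
    have e1 := christoffel_rev ha haM hm κ μ ν
    rw [e1]
    linear_combination -(revSign κ * christoffel M a (γ (-s)) κ μ ν * v (-s) μ * v (-s) ν) *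
      (revSign ν * revSign ν * revSign_mul_self μ + revSign_mul_self ν)

theorem tendsto_neg_toRightEnd (α : EReal) :
    Tendsto (fun s : ℝ => -s) (toRightEnd (-α)) (toLeftEnd α) := by
  refine tendsto_comap_iff.2 ?_
  have h1 : Tendsto (fun y : EReal => -y) (𝓝[<] (-α)) (𝓝[>] α) := by
    refine tendsto_nhdsWithin_iff.2 ⟨?_, ?_⟩
    · have := ((continuous_neg (G := EReal)).tendsto (-α)).mono_left (nhdsWithin_le_nhds (s := Iio (-α)))
      rwa [neg_neg] at this
    · filter_upwards [self_mem_nhdsWithin] with y hy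
      exact EReal.lt_neg_comm.1 hy
  exact (h1.comp tendsto_comap).congr fun s => (EReal.coe_neg s).symm

theorem tendsto_neg_toLeftEnd (β : EReal) :
    Tendsto (fun s : ℝ => -s) (toLeftEnd (-β)) (toRightEnd β) := by
  refine tendsto_comap_iff.2 ?_
  have h1 : Tendsto (fun y : EReal => -y) (𝓝[>] (-β)) (𝓝[<] β) := by
    refine tendsto_nhdsWithin_iff.2 ⟨?_, ?_⟩
    · have := ((continuous_neg (G := EReal)).tendsto (-β)).mono_left (nhdsWithin_le_nhds (s := Ioi (-β)))
      rwa [neg_neg] at this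
    · filter_upwards [self_mem_nhdsWithin] with y hy
      exact EReal.neg_lt_comm.1 hy
  exact (h1.comp tendsto_comap).congr fun s => (EReal.coe_neg s).symm

/-- The action of time reversal on the charts `nullChart`: it interchanges the ingoing and the
outgoing one. -/
def chartRev (q : ℝ × ℝ × (Fin 3 → ℝ)) : ℝ × ℝ × (Fin 3 → ℝ) :=
  (-q.1, q.2.1, ![q.2.2 0, -q.2.2 1, q.2.2 2])

theorem continuous_chartRev : Continuous chartRev := by
  unfold chartRev
  refine (by fun_prop : Continuous fun q : ℝ × ℝ × (Fin 3 → ℝ) => -q.1).prodMk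
    ((by fun_prop : Continuous fun q : ℝ × ℝ × (Fin 3 → ℝ) => q.2.1).prodMk
      (continuous_pi fun i => ?_))
  have h0 : Continuous fun q : ℝ × ℝ × (Fin 3 → ℝ) => q.2.2 0 := by fun_prop
  have h1 : Continuous fun q : ℝ × ℝ × (Fin 3 → ℝ) => -q.2.2 1 := by fun_prop
  have h2 : Continuous fun q : ℝ × ℝ × (Fin 3 → ℝ) => q.2.2 2 := by fun_prop
  fin_cases i
  exacts [h0, h1, h2]

theorem nullChart_rev (M a ε : ℝ) (x : Coord) :
    nullChart M a ε (rev x) = chartRev (nullChart M a (-ε) x) := by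
  refine Prod.ext ?_ (Prod.ext ?_ ?_)
  · simp only [nullChart, chartRev, rad_rev, rev_zero]; ring
  · simp only [nullChart, chartRev, rad_rev]
  · simp only [nullChart, chartRev, rad_rev, rev_one, rev_two, rev_three, neg_mul, Real.cos_neg,
      Real.sin_neg, Matrix.cons_val_zero, Matrix.cons_val_one, Matrix.cons_val]
    congr 1
    · ring
    · congr 1
      ring

theorem sum_chartRev_sq (q : ℝ × ℝ × (Fin 3 → ℝ)) :
    ∑ i, (chartRev q).2.2 i ^ 2 = ∑ i, q.2.2 i ^ 2 := by
  simp [chartRev, Fin.sum_univ_three]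

theorem meets_rev_iff (ha : 0 ≤ a) (haM : a < M) (p w : Coord) (ε : ℝ)
    {B : Set (ℝ × ℝ × (Fin 3 → ℝ))} (hB : ∀ q ∈ B, chartRev q ∈ B) :
    (∃ (α β : EReal) (γ : ℝ → Coord), IsGeodesicFrom M a p w α β γ ∧
      ∃ q ∈ B, Tendsto (fun s => nullChart M a (-ε) (γ s)) (toLeftEnd α) (𝓝 q)) ↔
    ∃ (α β : EReal) (γ : ℝ → Coord), IsGeodesicFrom M a (rev p) (-rev w) α β γ ∧
      ∃ q ∈ B, Tendsto (fun s => nullChart M a ε (γ s)) (toRightEnd β) (𝓝 q) := by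
  constructor
  · rintro ⟨α, β, γ, hg, q, hq, ht⟩
    refine ⟨_, _, _, hg.reverse ha haM, _, hB q hq, ?_⟩
    simp only [nullChart_rev]
    exact (continuous_chartRev.tendsto q).comp (ht.comp (tendsto_neg_toRightEnd α))
  · rintro ⟨α, β, γ, hg, q, hq, ht⟩
    have h1 := hg.reverse ha haM
    have h2 : -rev (-rev w) = w := by
      ext i
      simp only [rev, Pi.neg_apply, mul_neg, neg_neg, ← mul_assoc, revSign_mul_self, one_mul]
    rw [rev_rev, h2] at h1
    refine ⟨_, _, _, h1, _, hB q hq, ?_⟩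
    simp only [nullChart_rev, neg_neg]
    exact (continuous_chartRev.tendsto q).comp (ht.comp (tendsto_neg_toLeftEnd β))

/-- Time reversal turns the frame `e` at `p` into the future directed frame `-rev ∘ e`. -/
theorem IsObserverFrame.reverse {p : Coord} {e : Fin 4 → Coord} (he : IsObserverFrame M a p e) :
    IsObserverFrame M a (rev p) (fun i => -rev (e i)) := by
  have hn : ∀ v w, metric M a (rev p) (-v) (-w) = metric M a (rev p) v w := fun v w => by
    simp only [← metricForm_apply, map_neg, LinearMap.neg_apply, neg_neg]
  refine ⟨fun i j => ?_, ?_⟩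
  · rw [hn, metric_rev]; exact he.orthonormal i j
  · have h1 : timeVector a (rev p) = -rev (timeVector a p) := by
      ext i
      fin_cases i <;> simp [timeVector, rad_rev, rev, revSign]
    rw [h1, hn, metric_rev]
    exact he.future

theorem pastTrappedSet_eq (ha : 0 ≤ a) (haM : a < M) (p : Coord) (e : Fin 4 → Coord) :
    pastTrappedSet M a p e = futureTrappedSet M a (rev p) (fun i => -rev (e i)) := by
  have hn : ∀ k, nullVector (fun i => -rev (e i)) k = -rev (nullVector e k) := fun k => by
    ext i
    simp only [nullVector, rev, Pi.add_apply, Pi.neg_apply, Finset.sum_apply, Pi.smul_apply,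
      smul_eq_mul, mul_add, Finset.mul_sum, neg_add, mul_neg, Finset.sum_neg_distrib]
    congr 2
    exact Finset.sum_congr rfl fun j _ => by ring
  ext k
  refine and_congr_right fun _ => not_congr ?_
  rw [hn]
  refine or_congr (meets_rev_iff ha haM p _ 1 fun q hq => ?_) ?_
  · exact ⟨hq.1, (sum_chartRev_sq q).trans hq.2⟩
  · have := meets_rev_iff ha haM p (nullVector e k) (-1) (B := scriBoundary) fun q hq =>
      ⟨hq.1, (sum_chartRev_sq q).trans hq.2⟩
    rwa [neg_neg] at this

end

end Kerr

end

/-- In every subextremal Kerr exterior, for every point and every observer there, the future and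
the past trapped sets are smooth simple closed curves on the celestial sphere. -/
theorem theorem1 (M a : ℝ) (ha : 0 ≤ a) (haM : a < M)
    (p : Kerr.Coord) (hp : p ∈ Kerr.exterior M a)
    (e : Fin 4 → Kerr.Coord) (he : Kerr.IsObserverFrame M a p e) :
    IsSmoothClosedCurve (Kerr.futureTrappedSet M a p e) ∧
      IsSmoothClosedCurve (Kerr.pastTrappedSet M a p e) := by
  refine ⟨Kerr.isSmoothClosedCurve_futureTrappedSet ha haM hp he, ?_⟩
  rw [Kerr.pastTrappedSet_eq ha haM]
  exact Kerr.isSmoothClosedCurve_futureTrappedSet ha haM (Kerr.rev_mem_exterior hp) he.reverse
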